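/- Let $m_1\ge 1$ and $m_2\ge 0$ be integers and put $\ell=m_1+m_2$. Let $H_{m_1,m_2}$ be the cubic caterpillar-Halin graph with vertices $u_0,\dots,u_{\ell+1},v_1,\dots,v_\ell$ which is the union of the caterpillar $T$ with edges $v_iv_{i+1}$ $(1\le i<\ell)$, $v_iu_i$ $(1\le i\le\ell)$, $v_1u_0$, $v_\ell u_{\ell+1}$, and the cycle $u_0u_1\cdots u_{m_1}u_{\ell+1}u_\ell u_{\ell-1}\cdots u_{m_1+1}u_0$ through the leaves of $T$ (so $u_1,\dots,u_{m_1}$ lie above the spine and $u_{m_1+1},\dots,u_\ell$ below it; for $m_2=0$ the cycle is $u_0u_1\cdots u_{\ell+1}u_0$ and $H_{m_1,0}$ is the Ringel ladder $R_{m_1}$). A $T$-rotation system of $H_{m_1,m_2}$ consists of a cyclic permutation of the incident edges at every vertex and a map $\tau\colon E(H_{m_1,m_2})\to\{0,1\}$ (twisted or untwisted edges) that vanishes on the edges of the spanning tree $T$. It determines a cellular embedding of $H_{m_1,m_2}$ in a closed surface $S$, whose Euler-genus is $2-\chi(S)=2-|V|+|E|-|F|$, where $F$ is the set of faces. Let $\varepsilon_{m_1,m_2}(i)$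 be the number of $T$-rotation systems of $H_{m_1,m_2}$ of Euler-genus $i$, and let $\mathcal E_{m_1,m_2}(z)=\sum_{i\ge0}\varepsilon_{m_1,m_2}(i)z^i$ be the Euler-genus polynomial of $H_{m_1,m_2}$. All matrices below are over $\mathbb Z_2$. For $n\ge 2$ let $\phi_n(z)=\sum_j\phi_n[j]z^j$, where $\phi_n[j]$ is the number of rank-$j$ symmetric $n\times n$ matrices with rows and columns numbered $0,\dots,n-1$ whose $(a,b)$-entry is $0$ whenever $a,b\ge1$ and $|a-b|\ge2$, all other entries being arbitrary subject to symmetry (these are the overlap matrices of the Ringel ladder $R_{n-2}$ when $n\ge3$). For $m_1,m_2\ge1$ let $\lambda_{m_1,m_2}(z)=\sum_j\lambda_{m_1,m_2}[j]z^j$, where $\lambda_{m_1,m_2}[j]$ is the number of rank-$j$ matrices of the form $$\begin{pmatrix} x_1&0&\mathbf p&\mathbf q\\ 0&0&\mathbf 0&\mathbf 0\\ \mathbf p^{T}&\mathbf 0^{T}&A_1&0\\ \mathbf q^{T}&\mathbf 0^{T}&0&A_2\end{pmatrix},$$ where $x_1\in\mathbb Z_2$, $\mathbf p\in\mathbb Z_2^{m_1}$,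 $\mathbf q=(q,0,\dots,0)\in\mathbb Z_2^{m_2}$ with $q\in\mathbb Z_2$, and $A_i$ is a symmetric tridiagonal $m_i\times m_i$ matrix for $i=1,2$ (these are the overlap matrices of $H_{m_1,m_2}$ whose second row and second column vanish). Theorem. For all $m_1\ge 1$ and $m_2\ge 2$, $$\mathcal E_{m_1,m_2}(z)=(1+4z)\,\mathcal E_{m_1,m_2-1}(z)+16z^2\,\mathcal E_{m_1,m_2-2}(z)+2^{m_2+3}z^2\,\lambda_{m_1,m_2-1}(z),$$ with initial conditions, for all $m_1\ge1$, $\mathcal E_{m_1,0}(z)=2\phi_{m_1+2}(z)$ and $\mathcal E_{m_1,1}(z)=2\phi_{m_1+3}(z)$. -/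

import Mathlib

open Polynomial

noncomputable section

/-! ### General rotation systems, faces and Euler-genus -/

/-- A general rotation system of `G`: at every vertex `v` a cyclic permutation of the edges
incident to `v` (these are indexed by the neighbours of `v`), and a value `0` (untwisted)
or `1` (twisted) for every edge. -/
structure RotationSystem {V : Type} (G : SimpleGraph V) where
  rot : ∀ v, {σ : Equiv.Perm (G.neighborSet v) // σ.IsCycleOn Set.univ}
  twist : G.edgeSet → ZMod 2

namespace RotationSystem

variable {V : Type} {G : SimpleGraph V}

/-- The dart that follows `d` in the rotation at the initial vertex of `d`. -/
def next (R : RotationSystem G) (d : G.Dart) : G.Dart :=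
  let w := (R.rot d.fst).1 ⟨d.snd, d.adj⟩
  ⟨(d.fst, w.1), w.2⟩

/-- A flag `(d, s)` is one of the two sides of a dart `d` (`s = 0` is the side facing the
next dart of the rotation, `s = 1` the side facing the previous dart, as seen from the
initial vertex of `d`). Two flags are consecutive on a face boundary when
they meet in a corner at a vertex, or when they are the two ends of one side of an edge. -/
inductive FaceStep (R : RotationSystem G) : G.Dart × ZMod 2 → G.Dart × ZMod 2 → Prop
  | corner (d : G.Dart) : FaceStep R (d, 0) (R.next d, 1)
  | side (d : G.Dart) (s : ZMod 2) :
      FaceStep R (d, s) (d.symm, s + 1 + R.twist ⟨d.edge, d.edge_mem⟩)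

/-- The faces: the classes of flags under the equivalence relation generated by `FaceStep`. -/
def Face (R : RotationSystem G) : Type := Quot R.FaceStep

/-- The Euler-genus `2 - χ = 2 - |V| + |E| - |F|` of the closed surface in which the rotation
system embeds the (connected) graph: `2j` for the orientable surface with `j` handles and `k` for
the non-orientable surface with `k` crosscaps. -/
def eulerGenus (R : RotationSystem G) : ℤ :=
  2 - (Nat.card V : ℤ) + (Nat.card G.edgeSet : ℤ) - (Nat.card R.Face : ℤ)

end RotationSystem

/-- The `T`-rotation systems of `G`: the edges of the spanning tree `T` are untwisted. -/
def TRotationSystem {V : Type} (G T : SimpleGraph V) : Type :=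
  {R : RotationSystem G // ∀ e : G.edgeSet, e.1 ∈ T.edgeSet → R.twist e = 0}

/-- The number of `T`-rotation systems of `G` of Euler-genus `i`. -/
def embeddingCount {V : Type} (G T : SimpleGraph V) (i : ℕ) : ℕ :=
  Nat.card {R : TRotationSystem G T // R.1.eulerGenus = (i : ℤ)}

/-- The Euler-genus polynomial `∑ᵢ ε(i) zⁱ` (only finitely many terms are non-zero, see
`coeff_eulerGenusPoly`). -/
def eulerGenusPoly {V : Type} (G T : SimpleGraph V) : ℤ[X] :=
  ∑ᶠ i : ℕ, C (embeddingCount G T i : ℤ) * X ^ i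

theorem finite_tRotationSystem {V : Type} [Finite V] (G T : SimpleGraph V) :
    Finite (TRotationSystem G T) := by
  have : Finite (RotationSystem G) :=
    Finite.of_injective (fun R => (R.rot, R.twist)) (by
      rintro ⟨a, b⟩ ⟨c, d⟩ h
      simp only [Prod.mk.injEq] at h
      obtain ⟨rfl, rfl⟩ := h
      rfl)
  exact inferInstanceAs
    (Finite {R : RotationSystem G // ∀ e : G.edgeSet, e.1 ∈ T.edgeSet → R.twist e = 0})

theorem coeff_eulerGenusPoly {V : Type} [Finite V] (G T : SimpleGraph V) (j : ℕ) :
    (eulerGenusPoly G T).coeff j = embeddingCount G T j := by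
  have hfin := finite_tRotationSystem G T
  have hs : (Function.support
      fun i : ℕ => C (embeddingCount G T i : ℤ) * (X : ℤ[X]) ^ i).Finite := by
    refine (Set.finite_range
      (fun R : TRotationSystem G T => R.1.eulerGenus.toNat)).subset ?_
    intro i hi
    have h0 : embeddingCount G T i ≠ 0 := by
      rintro h
      simp [h] at hi
    obtain ⟨R, hR⟩ := (Nat.card_ne_zero.mp h0).1
    exact ⟨R, by simp [hR]⟩
  rw [eulerGenusPoly, finsum_eq_sum _ hs, finsetSum_coeff]
  simp only [coeff_C_mul, coeff_X_pow, mul_ite, mul_one, mul_zero]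
  rw [Finset.sum_ite_eq]
  split_ifs with h
  · rfl
  · by_contra hne
    apply h
    rw [Set.Finite.mem_toFinset, Function.mem_support]
    intro h0
    have := congrArg (fun p : ℤ[X] => p.coeff j) h0
    simp at this
    omega

/-! ### The cubic caterpillar-Halin graphs with two blocks -/

/-- The vertices, with `ℓ = m₁ + m₂`: `Sum.inl i` is the leaf `uᵢ` (`0 ≤ i ≤ ℓ + 1`) of the
characteristic tree, `Sum.inr i` is the spine vertex `vᵢ₊₁` (`0 ≤ i < ℓ`). -/
abbrev HalinVertex (m₁ m₂ : ℕ) : Type := Fin (m₁ + m₂ + 2) ⊕ Fin (m₁ + m₂)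

/-- The edges of the characteristic tree: the spine edges `vᵢvᵢ₊₁`, the pendant edges `vᵢuᵢ`,
and the end edges `v₁u₀` and `v_ℓ u_{ℓ+1}`. -/
def halinTreeRel (m₁ m₂ : ℕ) : HalinVertex m₁ m₂ → HalinVertex m₁ m₂ → Prop
  | Sum.inr i, Sum.inr j => i.val + 1 = j.val
  | Sum.inr i, Sum.inl j => j.val = i.val + 1 ∨ (i.val = 0 ∧ j.val = 0) ∨
      (i.val + 1 = m₁ + m₂ ∧ j.val = m₁ + m₂ + 1)
  | _, _ => False

/-- The edges of the cycle `u₀ u₁ ⋯ u_{m₁} u_{ℓ+1} u_ℓ ⋯ u_{m₁+1} u₀` through the leaves: the leaves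
`u₁, …, u_{m₁}` lie above the spine and `u_{m₁+1}, …, u_ℓ` lie below it. -/
def halinCycleRel (m₁ m₂ : ℕ) : HalinVertex m₁ m₂ → HalinVertex m₁ m₂ → Prop
  | Sum.inl i, Sum.inl j => (i.val + 1 = j.val ∧ i.val ≠ m₁) ∨
      (i.val = m₁ ∧ j.val = m₁ + m₂ + 1) ∨ (i.val = 0 ∧ j.val = m₁ + 1)
  | _, _ => False

/-- The characteristic tree, a caterpillar; it is the spanning tree of `H_{m₁,m₂}` in use. -/
def halinTree (m₁ m₂ : ℕ) : SimpleGraph (HalinVertex m₁ m₂) :=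
  SimpleGraph.fromRel (halinTreeRel m₁ m₂)

/-- The cubic caterpillar-Halin graph `H_{m₁,m₂}`; for `m₂ = 0` it is the Ringel ladder. -/
def halinGraph (m₁ m₂ : ℕ) : SimpleGraph (HalinVertex m₁ m₂) :=
  halinTree m₁ m₂ ⊔ SimpleGraph.fromRel (halinCycleRel m₁ m₂)

/-- The Euler-genus polynomial of `H_{m₁,m₂}`. -/
def halinPoly (m₁ m₂ : ℕ) : ℤ[X] := eulerGenusPoly (halinGraph m₁ m₂) (halinTree m₁ m₂)

/-! ### Overlap matrices and their rank polynomials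

The entries of the parameter vectors are read with the customary indices (starting at `1` unless
stated otherwise); entries outside the range of a vector do not occur in the matrix. -/

/-- The symmetric tridiagonal `m × m` matrix with diagonal `a₁, …, a_m` and off-diagonal
`b₁, …, b_{m-1}`. -/
def tridiag (m : ℕ) (a b : ℕ → ZMod 2) : Matrix (Fin m) (Fin m) (ZMod 2) :=
  Matrix.of fun i j =>
    if i = j then a (i.val + 1)
    else if i.val + 1 = j.val then b (i.val + 1)
    else if j.val + 1 = i.val then b (j.val + 1)
    else 0

/-- The overlap matrix `Δ` of `H_{m₁,m₂}`; here `z₁` is indexed by `1, …, m₁ + 1` and `z₂` by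
`0, …, m₂`. -/
def overlapMatrix (m₁ m₂ : ℕ) (x₀ y₀ x₁ y₁ x₂ y₂ z₁ z₂ : ℕ → ZMod 2) :
    Matrix (Fin 2 ⊕ (Fin m₁ ⊕ Fin m₂)) (Fin 2 ⊕ (Fin m₁ ⊕ Fin m₂)) (ZMod 2) :=
  let M₁ : Matrix (Fin m₁) (Fin 2) (ZMod 2) := Matrix.of fun i =>
    ![z₁ (i.val + 1), if i.val + 1 = m₁ then z₂ 0 else 0]
  let M₂ : Matrix (Fin m₂) (Fin 2) (ZMod 2) := Matrix.of fun i =>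
    ![if i.val = 0 then z₁ (m₁ + 1) else 0, z₂ (i.val + 1)]
  let M := Matrix.fromRows M₁ M₂
  Matrix.fromBlocks (tridiag 2 x₀ y₀) M.transpose M
    (Matrix.fromBlocks (tridiag m₁ x₁ y₁) 0 0 (tridiag m₂ x₂ y₂))

/-- The matrices `Λ`: the overlap matrices whose second row and second column vanish. -/
def lambdaMatrices (m₁ m₂ : ℕ) :
    Set (Matrix (Fin 2 ⊕ (Fin m₁ ⊕ Fin m₂)) (Fin 2 ⊕ (Fin m₁ ⊕ Fin m₂)) (ZMod 2)) :=
  {M | (∃ x₀ y₀ x₁ y₁ x₂ y₂ z₁ z₂, M = overlapMatrix m₁ m₂ x₀ y₀ x₁ y₁ x₂ y₂ z₁ z₂) ∧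
    (∀ j, M (Sum.inl 1) j = 0) ∧ (∀ i, M i (Sum.inl 1) = 0)}

/-- The rank polynomial `λ_{m₁,m₂}(z) = ∑ⱼ #{M of the form Λ : rank M = j} zʲ`. -/
def lambdaPoly (m₁ m₂ : ℕ) : ℤ[X] :=
  ∑ j ∈ Finset.range (2 + m₁ + m₂ + 1),
    C ((Set.ncard {M | M ∈ lambdaMatrices m₁ m₂ ∧ M.rank = j} : ℕ) : ℤ) * X ^ j

/-- The overlap matrix of a Ringel ladder, of size `n × n`, with rows and columns numbered from `0`:
first row `x₀, z₁, …, z_{n-1}`, then a tridiagonal block with diagonal `x₁, …, x_{n-1}` and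
off-diagonal `y₁, …, y_{n-2}`. -/
def ringelMatrix (n : ℕ) (x y z : ℕ → ZMod 2) : Matrix (Fin n) (Fin n) (ZMod 2) :=
  Matrix.of fun i j =>
    if i = j then x i.val
    else if i.val = 0 then z j.val
    else if j.val = 0 then z i.val
    else if i.val + 1 = j.val then y i.val
    else if j.val + 1 = i.val then y j.val
    else 0

/-- The rank polynomial `φ_n(z) = ∑ⱼ #{M an n × n Ringel-ladder overlap matrix : rank M = j} zʲ`. -/
def ringelPoly (n : ℕ) : ℤ[X] :=
  ∑ j ∈ Finset.range (n + 1),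
    C ((Set.ncard {M : Matrix (Fin n) (Fin n) (ZMod 2) |
      (∃ x y z, M = ringelMatrix n x y z) ∧ M.rank = j} : ℕ) : ℤ) * X ^ j

end

noncomputable section

/-! ### Ranks over `ZMod 2` through kernels -/

/-! The theorem is reduced to counting symmetric matrices over `ZMod 2` by rank, and the count is
then done by Gaussian elimination.

Topological half. Draw `H` in the plane with the leaf cycle around the outer face. Each bounded face
has exactly one edge outside `T`, its chord. A rotation at a cubic vertex is the planar one or its
inverse, so a `T`-rotation system is a bit `r v` per vertex and a twist `t e` per chord. The faces
of the embedding are counted through the `ZMod 2`-valued functions on them. The difference of such a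
function across the edges is a cycle of the graph, hence the boundary of a function `x` on the
bounded planar faces; what remains is a function `g` on the vertices. The pair `(g, x)` must satisfy
one equation per edge. The tree equations determine `g` up to a constant, and the chord equations
then say that the overlap matrix kills `x`. So the number of faces is the corank plus one, and
Euler's formula makes the Euler-genus equal to the rank (`PlaneScheme.eulerGenus_eq_rank`). An
off-diagonal overlap entry is `r a + r b` for the tree edge shared by two faces. As `T` is a tree,
every symmetric matrix supported on the dual adjacency arises, and exactly twice
(`PlaneScheme.eulerGenusPoly_eq`).

Algebraic half. The last face below the spine has two neighbours: the last face `a` above the spine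
and the preceding face `b` below it. A diagonal entry 1 is a pivot, and the four possible borders
give `4 * X`. With diagonal entry 0 and zero border the index is deleted. If the entry at `b` is 1,
which happens for two borders, a hyperbolic pair with `b` is eliminated; if only the entry at `a` is
1, the pair is taken with `a`, and a matrix of type `Λ` remains. In each case the Schur correction
stays inside the allowed support, so adding it merely permutes the remaining matrices
(`rankPoly_option_two`). -/

theorem card_mulVec_ker_mul_two_pow_rank {I : Type} [Fintype I] [DecidableEq I]
    (A : Matrix I I (ZMod 2)) :
    Nat.card {x : I → ZMod 2 // A.mulVec x = 0} * 2 ^ A.rank = 2 ^ Fintype.card I := by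
  have h := A.mulVecLin.finrank_range_add_finrank_ker
  have hk : Nat.card {x : I → ZMod 2 // A.mulVec x = 0} = Nat.card (LinearMap.ker A.mulVecLin) :=
    Nat.card_congr (Equiv.subtypeEquivRight fun x => by simp)
  rw [hk, Module.natCard_eq_pow_finrank (K := ZMod 2), Nat.card_zmod, ← pow_add, Matrix.rank]
  simp only [Module.finrank_fintype_fun_eq_card] at h
  rw [add_comm, h]

/-- Every elimination step is proved by a bijection of kernels; rank-nullity turns it into a
statement on ranks. The exponent `k` is the number of coordinates that become free. -/
theorem rank_add_card_eq_of_ker {I I' : Type} [Fintype I] [DecidableEq I] [Fintype I']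
    [DecidableEq I'] {A : Matrix I I (ZMod 2)} {B : Matrix I' I' (ZMod 2)} {k : ℕ}
    (h : Nat.card {x : I → ZMod 2 // A.mulVec x = 0} =
      2 ^ k * Nat.card {x : I' → ZMod 2 // B.mulVec x = 0}) :
    A.rank + k + Fintype.card I' = B.rank + Fintype.card I := by
  have hA := card_mulVec_ker_mul_two_pow_rank A
  have hB := card_mulVec_ker_mul_two_pow_rank B
  rw [h] at hA
  apply Nat.pow_right_injective (le_refl 2)
  simp only [pow_add]
  rw [← hA, ← hB]
  ring

/-- The bordered symmetric matrix with corner `d`, border `v` and core `M`. -/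
def bordered {W : Type} (d : ZMod 2) (v : W → ZMod 2) (M : Matrix W W (ZMod 2)) :
    Matrix (Option W) (Option W) (ZMod 2) :=
  Matrix.of fun i j =>
    match i, j with
    | none, none => d
    | none, some j => v j
    | some i, none => v i
    | some i, some j => M i j

theorem bordered_mulVec_eq_zero {W : Type} [Fintype W] (d : ZMod 2) (v : W → ZMod 2)
    (M : Matrix W W (ZMod 2)) (y : Option W → ZMod 2) :
    (bordered d v M).mulVec y = 0 ↔
      d * y none + v ⬝ᵥ (fun i => y (some i)) = 0 ∧
      ∀ i, v i * y none + (M.mulVec fun j => y (some j)) i = 0 := by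
  simp [funext_iff, Option.forall, Matrix.mulVec, dotProduct, Fintype.sum_option, bordered]

theorem rank_bordered_zero {W : Type} [Fintype W] [DecidableEq W] (M : Matrix W W (ZMod 2)) :
    (bordered 0 0 M).rank = M.rank := by
  have h : Nat.card {y : Option W → ZMod 2 // (bordered 0 0 M).mulVec y = 0} =
      2 ^ 1 * Nat.card {x : W → ZMod 2 // M.mulVec x = 0} := by
    have hp : Nat.card (ZMod 2 × {x : W → ZMod 2 // M.mulVec x = 0}) =
        2 ^ 1 * Nat.card {x : W → ZMod 2 // M.mulVec x = 0} := by
      rw [Nat.card_prod, Nat.card_zmod, pow_one]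
    rw [← hp]
    refine Nat.card_congr
      { toFun := fun y => (y.1 none, ⟨fun i => y.1 (some i), ?_⟩)
        invFun := fun p => ⟨fun o => o.elim p.1 p.2.1, ?_⟩
        left_inv := ?_
        right_inv := ?_ }
    · have := ((bordered_mulVec_eq_zero _ _ _ _).1 y.2).2
      funext i
      simpa using this i
    · rw [bordered_mulVec_eq_zero]
      simp [p.2.2]
    · rintro ⟨y, hy⟩
      ext (_ | i) <;> rfl
    · rintro ⟨a, x, hx⟩
      rfl
  have := rank_add_card_eq_of_ker h
  simp only [Fintype.card_option] at this
  omega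

/-- Pivot on the corner: the first equation gives the new coordinate as `v ⬝ᵥ x`, and substitution
leaves the Schur complement, with sign irrelevant in characteristic 2. -/
theorem rank_bordered_one {W : Type} [Fintype W] [DecidableEq W] (v : W → ZMod 2)
    (M : Matrix W W (ZMod 2)) :
    (bordered 1 v M).rank = (M + Matrix.vecMulVec v v).rank + 1 := by
  have key : ∀ x : W → ZMod 2, ∀ i, ((M + Matrix.vecMulVec v v).mulVec x) i =
      v i * (v ⬝ᵥ x) + (M.mulVec x) i := by
    intro x i
    rw [Matrix.add_mulVec, Matrix.vecMulVec_mulVec]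
    simp [mul_comm, add_comm]
  have h : Nat.card {y : Option W → ZMod 2 // (bordered 1 v M).mulVec y = 0} =
      2 ^ 0 * Nat.card {x : W → ZMod 2 // (M + Matrix.vecMulVec v v).mulVec x = 0} := by
    rw [pow_zero, one_mul]
    refine Nat.card_congr
      { toFun := fun y => ⟨fun i => y.1 (some i), ?_⟩
        invFun := fun x => ⟨fun o => o.elim (v ⬝ᵥ x.1) x.1, ?_⟩
        left_inv := ?_
        right_inv := ?_ }
    · obtain ⟨h1, h2⟩ := (bordered_mulVec_eq_zero _ _ _ _).1 y.2
      rw [one_mul, CharTwo.add_eq_zero] at h1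
      funext i
      rw [key, ← h1]
      exact h2 i
    · rw [bordered_mulVec_eq_zero]
      refine ⟨by simp [CharTwo.add_self_eq_zero], fun i => ?_⟩
      have := congrFun x.2 i
      rw [key] at this
      exact this
    · rintro ⟨y, hy⟩
      obtain ⟨h1, -⟩ := (bordered_mulVec_eq_zero _ _ _ _).1 hy
      rw [one_mul, CharTwo.add_eq_zero] at h1
      ext (_ | i)
      · exact h1.symm
      · rfl
    · rintro ⟨x, hx⟩
      rfl
  have := rank_add_card_eq_of_ker h
  simp only [Fintype.card_option] at this
  omega

/-- The correction term of the elimination of a hyperbolic pair. -/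
def pairCorrection {W : Type} (d : ZMod 2) (v w : W → ZMod 2) : Matrix W W (ZMod 2) :=
  Matrix.of fun i j => d * v i * v j + v i * w j + w i * v j

/-- The two outer indices carry the invertible block with rows `(0, 1)` and `(1, d)`, whose inverse
has rows `(d, 1)` and `(1, 0)`. Its Schur complement is `M + pairCorrection d v w`: the two outer
coordinates are forced by the inner ones. -/
theorem rank_bordered_pair {W : Type} [Fintype W] [DecidableEq W] (d : ZMod 2)
    (v w : W → ZMod 2) (M : Matrix W W (ZMod 2)) :
    (bordered 0 (fun o => o.elim 1 v) (bordered d w M)).rank =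
      (M + pairCorrection d v w).rank + 2 := by
  have key : ∀ x : W → ZMod 2, ∀ i, ((M + pairCorrection d v w).mulVec x) i =
      v i * (d * (v ⬝ᵥ x) + w ⬝ᵥ x) + w i * (v ⬝ᵥ x) + (M.mulVec x) i := by
    intro x i
    rw [Matrix.add_mulVec, Pi.add_apply, add_comm]
    congr 1
    simp only [Matrix.mulVec, dotProduct, pairCorrection, Matrix.of_apply, Finset.mul_sum,
      ← Finset.sum_add_distrib]
    exact Finset.sum_congr rfl fun j _ => by ring
  have char : ∀ y : Option (Option W) → ZMod 2,
      (bordered 0 (fun o => o.elim 1 v) (bordered d w M)).mulVec y = 0 ↔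
        y (some none) = v ⬝ᵥ (fun i => y (some (some i))) ∧
        y none = d * (v ⬝ᵥ (fun i => y (some (some i)))) + w ⬝ᵥ (fun i => y (some (some i))) ∧
        (M + pairCorrection d v w).mulVec (fun i => y (some (some i))) = 0 := by
    intro y
    rw [bordered_mulVec_eq_zero]
    simp only [zero_mul, zero_add, dotProduct, Fintype.sum_option, Option.elim, one_mul,
      CharTwo.add_eq_zero, Option.forall]
    rw [funext_iff]
    simp only [key, Pi.zero_apply, dotProduct]
    refine and_congr_right fun h1 => ?_
    have e1 : (bordered d w M).mulVec (fun j => y (some j)) none =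
        d * y (some none) + ∑ i, w i * y (some (some i)) := by
      simp [Matrix.mulVec, dotProduct, Fintype.sum_option, bordered]
    have e2 : ∀ i, (bordered d w M).mulVec (fun j => y (some j)) (some i) =
        w i * y (some none) + M.mulVec (fun j => y (some (some j))) i := by
      intro i
      simp [Matrix.mulVec, dotProduct, Fintype.sum_option, bordered]
    rw [e1, h1]
    refine and_congr_right fun h2 => forall_congr' fun i => ?_
    rw [e2, h1, h2, ← CharTwo.add_eq_zero, add_assoc]
  have h : Nat.card {y : Option (Option W) → ZMod 2 //
        (bordered 0 (fun o => o.elim 1 v) (bordered d w M)).mulVec y = 0} =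
      2 ^ 0 * Nat.card {x : W → ZMod 2 // (M + pairCorrection d v w).mulVec x = 0} := by
    rw [pow_zero, one_mul]
    refine Nat.card_congr
      { toFun := fun y => ⟨fun i => y.1 (some (some i)), ((char _).1 y.2).2.2⟩
        invFun := fun x => ⟨fun o => o.elim (d * (v ⬝ᵥ x.1) + w ⬝ᵥ x.1)
          (fun o => o.elim (v ⬝ᵥ x.1) x.1), (char _).2 ⟨rfl, rfl, x.2⟩⟩
        left_inv := ?_
        right_inv := ?_ }
    · rintro ⟨y, hy⟩
      obtain ⟨h1, h2, -⟩ := (char _).1 hy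
      ext (_ | _ | i)
      · exact h2.symm
      · exact h1.symm
      · rfl
    · rintro ⟨x, hx⟩
      rfl
  have := rank_add_card_eq_of_ker h
  simp only [Fintype.card_option] at this
  omega

/-! ### Symmetric matrices supported on a relation -/

/-- Symmetric matrices over `ZMod 2` whose non-zero entries lie in the relation `D`. -/
def supportedSym {I : Type} (D : I → I → Prop) : Set (Matrix I I (ZMod 2)) :=
  {M | M.IsSymm ∧ ∀ i j, ¬ D i j → M i j = 0}

/-- The rank polynomial of a set of matrices. -/
def rankPoly {I : Type} [Fintype I] (S : Set (Matrix I I (ZMod 2))) : ℤ[X] :=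
  ∑ᶠ M : S, X ^ M.1.rank

theorem rankPoly_eq_sum {I : Type} [Fintype I] (S : Set (Matrix I I (ZMod 2))) [Fintype S] :
    rankPoly S = ∑ M : S, X ^ M.1.rank := finsum_eq_sum_of_fintype _

/-- Grouping by rank. Ranks never exceed the size, so any larger cut-off `N` gives the same
polynomial. -/
theorem sum_range_ncard_rank {I : Type} [Fintype I] [DecidableEq I]
    (S : Set (Matrix I I (ZMod 2))) (N : ℕ) (hN : Fintype.card I ≤ N) :
    ∑ j ∈ Finset.range (N + 1),
      C ((Set.ncard {M | M ∈ S ∧ M.rank = j} : ℕ) : ℤ) * X ^ j = rankPoly S := by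
  classical
  have : Fintype S := Fintype.ofFinite _
  rw [rankPoly_eq_sum]
  rw [← Finset.sum_fiberwise_of_maps_to (s := Finset.univ) (t := Finset.range (N + 1))
    (g := fun M : S => M.1.rank)]
  · refine Finset.sum_congr rfl fun j _ => ?_
    rw [Finset.sum_congr rfl (g := fun _ => X ^ j) (by
      intro M hM
      rw [(Finset.mem_filter.1 hM).2])]
    rw [Finset.sum_const, nsmul_eq_mul]
    congr 1
    rw [← Fintype.card_subtype, ← Nat.card_eq_fintype_card, ← Nat.card_coe_set_eq]
    rw [Nat.card_congr (Equiv.subtypeSubtypeEquivSubtypeInter (· ∈ S)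
      (fun M : Matrix I I (ZMod 2) => M.rank = j))]
    rfl
  · intro M _
    have := M.1.rank_le_card_width
    simp
    omega

theorem rankPoly_congr {I I' : Type} [Fintype I] [Fintype I'] {S : Set (Matrix I I (ZMod 2))}
    {S' : Set (Matrix I' I' (ZMod 2))} (e : S ≃ S') (h : ∀ M : S, (e M).1.rank = M.1.rank) :
    rankPoly S = rankPoly S' := by
  unfold rankPoly
  rw [← finsum_comp_equiv e]
  simp only [h]

theorem rankPoly_reindex {I I' : Type} [Fintype I] [Fintype I']
    (e : I ≃ I') {S : Set (Matrix I I (ZMod 2))} {S' : Set (Matrix I' I' (ZMod 2))}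
    (h : ∀ M, M ∈ S ↔ Matrix.reindex e e M ∈ S') : rankPoly S = rankPoly S' :=
  rankPoly_congr ((Matrix.reindex e e).subtypeEquiv h) fun M => Matrix.rank_reindex e e M.1

theorem rankPoly_supportedSym_reindex {I I' : Type} [Fintype I] [Fintype I']
    (e : I ≃ I') {D : I → I → Prop} {D' : I' → I' → Prop} (h : ∀ i j, D i j ↔ D' (e i) (e j)) :
    rankPoly (supportedSym D) = rankPoly (supportedSym D') := by
  refine rankPoly_reindex e fun M => ?_
  simp only [supportedSym, Set.mem_ofPred_eq, Matrix.IsSymm.ext_iff, Matrix.reindex_apply,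
    Matrix.submatrix_apply]
  constructor
  · rintro ⟨h1, h2⟩
    exact ⟨fun i j => h1 _ _, fun i j hij => h2 _ _ (by rwa [h, e.apply_symm_apply,
      e.apply_symm_apply])⟩
  · rintro ⟨h1, h2⟩
    refine ⟨fun i j => by simpa using h1 (e i) (e j), fun i j hij => ?_⟩
    simpa using h2 (e i) (e j) (by rwa [← h])

/-- Vectors supported on a predicate. -/
abbrev SupportedVec {W : Type} (N : W → Prop) : Type := {v : W → ZMod 2 // ∀ i, ¬ N i → v i = 0}

theorem card_supportedVec {W : Type} [Fintype W] (N : W → Prop) [Fintype (SupportedVec N)] :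
    Fintype.card (SupportedVec N) = 2 ^ Nat.card {i // N i} := by
  classical
  rw [← Nat.card_eq_fintype_card]
  have e : SupportedVec N ≃ ({i // N i} → ZMod 2) :=
    { toFun := fun v i => v.1 i
      invFun := fun u => ⟨fun i => if h : N i then u ⟨i, h⟩ else 0, fun i h => dif_neg h⟩
      left_inv := by
        rintro ⟨v, hv⟩
        ext i
        by_cases h : N i
        · simp [h]
        · simp [h, hv]
      right_inv := by
        intro u
        funext i
        simp [i.2] }
  rw [Nat.card_congr e, Nat.card_fun, Nat.card_zmod]

/-- A supported symmetric matrix with one more index, split into corner, border and core. -/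
def supportedSymOptionEquiv {W : Type} (D : Option W → Option W → Prop) (hD : ∀ i, D i i)
    (hs : ∀ i j, D i j → D j i) :
    ZMod 2 × SupportedVec (fun i => D none (some i)) ×
      supportedSym (fun i j => D (some i) (some j)) ≃ supportedSym D where
  toFun p := ⟨bordered p.1 p.2.1.1 p.2.2.1, by
    obtain ⟨d, ⟨v, hv⟩, ⟨M, hM1, hM2⟩⟩ := p
    constructor
    · ext (_ | i) (_ | j)
      · rfl
      · rfl
      · rfl
      · exact hM1.apply i j
    · rintro (_ | i) (_ | j) h
      · exact absurd (hD _) h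
      · exact hv _ h
      · exact hv _ fun h' => h (hs _ _ h')
      · exact hM2 _ _ h⟩
  invFun M := (M.1 none none, ⟨fun i => M.1 none (some i), fun _ h => M.2.2 _ _ h⟩,
    ⟨Matrix.of fun i j => M.1 (some i) (some j), by
      refine ⟨?_, fun _ _ h => M.2.2 _ _ h⟩
      ext i j
      exact M.2.1.apply _ _⟩)
  left_inv p := rfl
  right_inv M := by
    ext (_ | i) (_ | j)
    · rfl
    · rfl
    · exact M.2.1.apply _ _
    · rfl

theorem rankPoly_option {W : Type} [Fintype W] (D : Option W → Option W → Prop)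
    (hD : ∀ i, D i i) (hs : ∀ i j, D i j → D j i)
    [Fintype (SupportedVec fun i => D none (some i))]
    [Fintype (supportedSym fun i j => D (some i) (some j))] :
    rankPoly (supportedSym D) =
      ∑ d : ZMod 2, ∑ v : SupportedVec (fun i => D none (some i)),
        ∑ M : supportedSym (fun i j => D (some i) (some j)),
          X ^ (bordered d v.1 M.1).rank := by
  unfold rankPoly
  rw [← finsum_comp_equiv (supportedSymOptionEquiv D hD hs), finsum_eq_sum_of_fintype,
    Fintype.sum_prod_type]
  refine Finset.sum_congr rfl fun d _ => ?_
  rw [Fintype.sum_prod_type]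
  rfl

/-- Adding a fixed matrix is a permutation of the supported symmetric matrices. -/
def supportedSymAdd {W : Type} {D : W → W → Prop} (A : Matrix W W (ZMod 2))
    (hA : A ∈ supportedSym D) : supportedSym D ≃ supportedSym D :=
  Function.Involutive.toPerm (fun M => ⟨M.1 + A, by
      refine ⟨M.2.1.add hA.1, fun i j h => ?_⟩
      rw [Matrix.add_apply, M.2.2 i j h, hA.2 i j h, add_zero]⟩) (by
    intro M
    ext i j
    simp [add_assoc, CharTwo.add_self_eq_zero])

theorem sum_rank_bordered_zero {W : Type} [Fintype W] (S : Set (Matrix W W (ZMod 2))) [Fintype S] :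
    ∑ M : S, (X : ℤ[X]) ^ (bordered 0 0 M.1).rank = rankPoly S := by
  classical
  rw [rankPoly_eq_sum]
  simp only [rank_bordered_zero]

/-- When the support of `v` is a clique of `D`, the correction `v vᵀ` is itself a supported matrix,
and translation by it permutes the cores. -/
theorem sum_rank_bordered_one {W : Type} [Fintype W] (D : W → W → Prop)
    [Fintype (supportedSym D)] (v : W → ZMod 2) (hv : ∀ i j, v i ≠ 0 → v j ≠ 0 → D i j) :
    ∑ M : supportedSym D, (X : ℤ[X]) ^ (bordered 1 v M.1).rank = X * rankPoly (supportedSym D) := by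
  classical
  have hA : Matrix.vecMulVec v v ∈ supportedSym D := by
    refine ⟨?_, fun i j h => ?_⟩
    · ext i j
      simp [Matrix.vecMulVec_apply, mul_comm]
    · rw [Matrix.vecMulVec_apply]
      by_contra h0
      exact h (hv i j (left_ne_zero_of_mul h0) (right_ne_zero_of_mul h0))
  rw [rankPoly_eq_sum, ← Equiv.sum_comp (supportedSymAdd _ hA) (fun M => (X : ℤ[X]) ^ M.1.rank), Finset.mul_sum]
  refine Finset.sum_congr rfl fun M _ => ?_
  rw [rank_bordered_one, pow_succ, mul_comm]
  rfl

/-- For each diagonal entry `d` and row `w` of the second index, the pair correction is supported: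
by `hv` the support of `v` is a clique joined to all neighbours of that index. Translation removes
it, and the power of 2 counts the choices of `(d, w)`. -/
theorem sum_rank_bordered_pair {W : Type} [Fintype W] (D : Option W → Option W → Prop)
    (hD : ∀ i, D i i) (hs : ∀ i j, D i j → D j i)
    [Fintype (supportedSym D)]
    (v : W → ZMod 2)
    (hv : ∀ i j, v i ≠ 0 → v j ≠ 0 ∨ D none (some j) → D (some i) (some j)) :
    ∑ M : supportedSym D, (X : ℤ[X]) ^ (bordered 0 (fun o => o.elim 1 v) M.1).rank =
      2 ^ (Nat.card {i // D none (some i)} + 1) * X ^ 2 *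
        rankPoly (supportedSym fun i j => D (some i) (some j)) := by
  classical
  have : Fintype (supportedSym fun i j => D (some i) (some j)) := Fintype.ofFinite _
  have hterm : ∀ d : ZMod 2, ∀ w : SupportedVec (fun i => D none (some i)),
      ∑ M : supportedSym (fun i j => D (some i) (some j)),
        (X : ℤ[X]) ^ (bordered 0 (fun o => o.elim 1 v) (bordered d w.1 M.1)).rank =
      X ^ 2 * rankPoly (supportedSym fun i j => D (some i) (some j)) := by
    intro d w
    have hA : pairCorrection d v w.1 ∈ supportedSym fun i j => D (some i) (some j) := by
      refine ⟨?_, fun i j h => ?_⟩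
      · ext i j
        simp only [pairCorrection, Matrix.transpose_apply, Matrix.of_apply]
        ring
      · have hw : ∀ i j, v i * w.1 j ≠ 0 → D (some i) (some j) := fun i j h0 =>
          hv i j (left_ne_zero_of_mul h0) (Or.inr (by
            by_contra h1
            exact right_ne_zero_of_mul h0 (w.2 j h1)))
        have h1 : v i * v j = 0 := by
          by_contra h0
          exact h (hv i j (left_ne_zero_of_mul h0) (Or.inl (right_ne_zero_of_mul h0)))
        have h2 : v i * w.1 j = 0 := by
          by_contra h0
          exact h (hw i j h0)
        have h3 : v j * w.1 i = 0 := by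
          by_contra h0
          exact h (hs _ _ (hw j i h0))
        simp only [pairCorrection, Matrix.of_apply]
        linear_combination d * h1 + h2 + h3
    rw [rankPoly_eq_sum, ← Equiv.sum_comp (supportedSymAdd _ hA) (fun M => (X : ℤ[X]) ^ M.1.rank), Finset.mul_sum]
    refine Finset.sum_congr rfl fun M _ => ?_
    rw [rank_bordered_pair, pow_add, mul_comm]
    rfl
  rw [← Equiv.sum_comp (supportedSymOptionEquiv D hD hs), Fintype.sum_prod_type]
  have h2 : ∀ d : ZMod 2, ∑ p : SupportedVec (fun i => D none (some i)) ×
      supportedSym (fun i j => D (some i) (some j)), (X : ℤ[X]) ^ (bordered 0 (fun o => o.elim 1 v)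
        (supportedSymOptionEquiv D hD hs (d, p)).1).rank =
      2 ^ (Nat.card {i // D none (some i)}) * (X ^ 2 *
        rankPoly (supportedSym fun i j => D (some i) (some j))) := by
    intro d
    rw [Fintype.sum_prod_type]
    refine (Finset.sum_congr rfl fun w _ => hterm d w).trans ?_
    rw [Finset.sum_const,
      Finset.card_univ, card_supportedVec, nsmul_eq_mul]
    push_cast
    rfl
  rw [Finset.sum_congr rfl fun d _ => h2 d, Finset.sum_const, Finset.card_univ, ZMod.card,
    nsmul_eq_mul]
  push_cast
  ring

/-! ### The elimination recurrence -/

theorem rank_bordered_reindex {W W' : Type} [Fintype W] [Fintype W'] (e : W' ≃ W) (d : ZMod 2)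
    (v : W → ZMod 2) (M : Matrix W W (ZMod 2)) :
    (bordered d (v ∘ e) (Matrix.reindex e.symm e.symm M)).rank = (bordered d v M).rank := by
  rw [← Matrix.rank_reindex e.optionCongr.symm e.optionCongr.symm (bordered d v M)]
  congr 1
  ext (_ | i) (_ | j) <;> rfl

/-- Lets any index `e none` of the core be the partner in the hyperbolic pair. -/
theorem sum_rank_bordered_pair_equiv {W W' : Type} [Fintype W] [Fintype W'] (e : Option W' ≃ W)
    (D : W → W → Prop) (hD : ∀ i, D i i) (hs : ∀ i j, D i j → D j i) [Fintype (supportedSym D)]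
    (v : W → ZMod 2) (h1 : v (e none) = 1)
    (hv : ∀ i j, v (e (some i)) ≠ 0 → v (e (some j)) ≠ 0 ∨ D (e none) (e (some j)) →
      D (e (some i)) (e (some j))) :
    ∑ M : supportedSym D, (X : ℤ[X]) ^ (bordered 0 v M.1).rank =
      2 ^ (Nat.card {i // D (e none) (e (some i))} + 1) * X ^ 2 *
        rankPoly (supportedSym fun i j => D (e (some i)) (e (some j))) := by
  classical
  have : Fintype (supportedSym fun i j => D (e i) (e j)) := Fintype.ofFinite _
  rw [← sum_rank_bordered_pair (fun i j => D (e i) (e j)) (fun i => hD _) (fun i j => hs _ _)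
    (fun i => v (e (some i))) hv]
  have hM : ∀ M, M ∈ supportedSym D ↔
      Matrix.reindex e.symm e.symm M ∈ supportedSym fun i j => D (e i) (e j) := by
    intro M
    simp only [supportedSym, Set.mem_ofPred_eq, Matrix.IsSymm.ext_iff, Matrix.reindex_apply,
      Matrix.submatrix_apply, Equiv.symm_symm]
    refine and_congr ⟨fun h i j => h _ _, fun h i j => ?_⟩
      ⟨fun h i j => h _ _, fun h i j => ?_⟩
    · simpa using h (e.symm i) (e.symm j)
    · simpa using h (e.symm i) (e.symm j)
  refine Fintype.sum_equiv ((Matrix.reindex e.symm e.symm).subtypeEquiv hM) _ _ fun M => ?_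
  rw [← rank_bordered_reindex e]
  congr 3
  ext (_ | i)
  · exact h1
  · rfl

/-- An index with two neighbours has four possible borders. Only the supports of the three non-zero
ones matter for the elimination, so the vectors are left unnamed. -/
theorem sum_supportedVec_pair {W : Type} [Fintype W] (N : W → Prop) [Fintype (SupportedVec N)]
    (a b : W) (hab : a ≠ b) (hN : ∀ i, N i ↔ i = a ∨ i = b) (F : (W → ZMod 2) → ℤ[X]) :
    ∃ va vb vab : W → ZMod 2,
      (∀ i, va i ≠ 0 ↔ i = a) ∧ (∀ i, vb i ≠ 0 ↔ i = b) ∧ (∀ i, vab i ≠ 0 ↔ i = a ∨ i = b) ∧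
      ∑ v : SupportedVec N, F v.1 = F 0 + F va + F vb + F vab := by
  classical
  let vec : ZMod 2 × ZMod 2 → W → ZMod 2 := fun p i => if i = a then p.1 else if i = b then p.2 else 0
  refine ⟨vec (1, 0), vec (0, 1), vec (1, 1), ?_, ?_, ?_, ?_⟩
  · intro i
    by_cases h : i = a <;> simp [vec, h]
  · intro i
    by_cases h : i = a
    · simp [vec, h, hab]
    · simp [vec, h]
  · intro i
    by_cases h : i = a
    · simp [vec, h]
    · simp [vec, h]
  · let e : ZMod 2 × ZMod 2 ≃ SupportedVec N :=
      { toFun := fun p => ⟨vec p, fun i h => by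
          rw [hN, not_or] at h
          simp [vec, h.1, h.2]⟩
        invFun := fun v => (v.1 a, v.1 b)
        left_inv := fun p => by simp [vec, hab.symm]
        right_inv := fun v => by
          ext i
          by_cases ha : i = a
          · simp [vec, ha]
          · by_cases hb : i = b
            · simp [vec, hb, hab.symm]
            · simp [vec, ha, hb, v.2 i (by simp [hN, ha, hb])] }
    rw [← Equiv.sum_comp e, Fintype.sum_prod_type]
    have h0 : vec (0, 0) = 0 := by
      funext i
      simp [vec]
    have h2 : ∀ f : ZMod 2 → ℤ[X], ∑ s, f s = f 0 + f 1 := fun f => Fin.sum_univ_two f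
    rw [h2, h2, h2]
    change F (vec (0, 0)) + F (vec (0, 1)) + (F (vec (1, 0)) + F (vec (1, 1))) = _
    rw [h0]
    ring

/-- Elimination of an index `none` with exactly two neighbours `a`, `b`, which are adjacent. -/
theorem rankPoly_option_two {W Wa Wb : Type} [Fintype W] [Fintype Wa] [Fintype Wb]
    (D : Option W → Option W → Prop) (hD : ∀ i, D i i) (hs : ∀ i j, D i j → D j i)
    (ea : Option Wa ≃ W) (eb : Option Wb ≃ W)
    (hab : ea none ≠ eb none) (hDab : D (some (ea none)) (some (eb none)))
    (hN : ∀ i, D none (some i) ↔ i = ea none ∨ i = eb none)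
    (hb : ∀ i, D (some (eb none)) (some i) → D (some (ea none)) (some i)) :
    rankPoly (supportedSym D) =
      (1 + 4 * X) * rankPoly (supportedSym fun i j => D (some i) (some j)) +
      2 ^ (Nat.card {i // D (some (eb none)) (some (eb (some i)))} + 2) * X ^ 2 *
        rankPoly (supportedSym fun i j => D (some (eb (some i))) (some (eb (some j)))) +
      2 ^ (Nat.card {i // D (some (ea none)) (some (ea (some i)))} + 1) * X ^ 2 *
        rankPoly (supportedSym fun i j => D (some (ea (some i))) (some (ea (some j)))) := by
  classical
  have : Fintype (supportedSym fun i j => D (some i) (some j)) := Fintype.ofFinite _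
  have : Fintype (SupportedVec fun i => D none (some i)) := Fintype.ofFinite _
  have h2 : ∀ f : ZMod 2 → ℤ[X], ∑ s, f s = f 0 + f 1 := fun f => Fin.sum_univ_two f
  have hclique : ∀ i j, (i = ea none ∨ i = eb none) → (j = ea none ∨ j = eb none) →
      D (some i) (some j) := by
    rintro i j (rfl | rfl) (rfl | rfl)
    · exact hD _
    · exact hDab
    · exact hs _ _ hDab
    · exact hD _
  rw [rankPoly_option D hD hs, h2]
  -- Corner 1: each of the four borders is supported on the clique formed by the two neighbours, so
  -- each contributes a factor `X`.
  have hone : ∑ v : SupportedVec (fun i => D none (some i)),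
      ∑ M : supportedSym (fun i j => D (some i) (some j)),
        (X : ℤ[X]) ^ (bordered 1 v.1 M.1).rank =
      4 * X * rankPoly (supportedSym fun i j => D (some i) (some j)) := by
    have hterm : ∀ v : W → ZMod 2, (∀ i, v i ≠ 0 → i = ea none ∨ i = eb none) →
      ∑ M : supportedSym (fun i j => D (some i) (some j)),
        (X : ℤ[X]) ^ (bordered 1 v M.1).rank =
      X * rankPoly (supportedSym fun i j => D (some i) (some j)) := fun v hv =>
      sum_rank_bordered_one _ v fun i j hi hj => hclique i j (hv i hi) (hv j hj)
    obtain ⟨va, vb, vab, hva, hvb, hvab, hsum⟩ := sum_supportedVec_pair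
      (fun i => D none (some i)) _ _ hab hN fun v =>
        ∑ M : supportedSym (fun i j => D (some i) (some j)),
        (X : ℤ[X]) ^ (bordered 1 v M.1).rank
    rw [hsum, hterm va fun i hi => Or.inl ((hva i).1 hi),
      hterm vb fun i hi => Or.inr ((hvb i).1 hi), hterm vab fun i hi => (hvab i).1 hi,
      hterm 0 fun i hi => absurd rfl hi]
    ring
  -- Corner 0: the zero border leaves the core. The two borders that are non-zero at `b` pair with
  -- `b`, whence the exponent `+ 2`; the border concentrated at `a` has to pair with `a`.
  have hzero : ∑ v : SupportedVec (fun i => D none (some i)),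
      ∑ M : supportedSym (fun i j => D (some i) (some j)),
        (X : ℤ[X]) ^ (bordered 0 v.1 M.1).rank =
      rankPoly (supportedSym fun i j => D (some i) (some j)) +
      2 ^ (Nat.card {i // D (some (eb none)) (some (eb (some i)))} + 2) * X ^ 2 *
        rankPoly (supportedSym fun i j => D (some (eb (some i))) (some (eb (some j)))) +
      2 ^ (Nat.card {i // D (some (ea none)) (some (ea (some i)))} + 1) * X ^ 2 *
        rankPoly (supportedSym fun i j => D (some (ea (some i))) (some (ea (some j)))) := by
    have eq_one : ∀ x : ZMod 2, x ≠ 0 → x = 1 := by decide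
    have htermb : ∀ v : W → ZMod 2, v (eb none) ≠ 0 →
      (∀ i, v i ≠ 0 → i = ea none ∨ i = eb none) →
      ∑ M : supportedSym (fun i j => D (some i) (some j)),
        (X : ℤ[X]) ^ (bordered 0 v M.1).rank =
      2 ^ (Nat.card {i // D (some (eb none)) (some (eb (some i)))} + 1) * X ^ 2 *
        rankPoly (supportedSym fun i j => D (some (eb (some i))) (some (eb (some j)))) := by
      intro v hv0 hv
      refine sum_rank_bordered_pair_equiv eb _ (fun i => hD _) (fun i j => hs _ _) v
        (eq_one _ hv0) ?_
      rintro i j hi hj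
      -- Once `b` is removed, `v` can be non-zero only at `a`, and `hb` makes every neighbour of `b`
      -- a neighbour of `a`.
      have hi' : eb (some i) = ea none := (hv _ hi).resolve_right fun h => by
        simpa using eb.injective h
      rcases hj with hj | hj
      · exact hclique _ _ (Or.inl hi') (hv _ hj)
      · rw [hi']
        exact hb _ hj
    have hterma : ∀ v : W → ZMod 2, (∀ i, v i ≠ 0 ↔ i = ea none) →
      ∑ M : supportedSym (fun i j => D (some i) (some j)),
        (X : ℤ[X]) ^ (bordered 0 v M.1).rank =
      2 ^ (Nat.card {i // D (some (ea none)) (some (ea (some i)))} + 1) * X ^ 2 *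
        rankPoly (supportedSym fun i j => D (some (ea (some i))) (some (ea (some j)))) := by
      intro v hv
      refine sum_rank_bordered_pair_equiv ea _ (fun i => hD _) (fun i j => hs _ _) v
        (eq_one _ ((hv _).2 rfl)) ?_
      -- The border vanishes away from `a`, so the support condition is vacuous.
      rintro i j hi hj
      simpa using ea.injective ((hv _).1 hi)
    obtain ⟨va, vb, vab, hva, hvb, hvab, hsum⟩ := sum_supportedVec_pair
      (fun i => D none (some i)) _ _ hab hN fun v =>
        ∑ M : supportedSym (fun i j => D (some i) (some j)),
        (X : ℤ[X]) ^ (bordered 0 v M.1).rank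
    rw [hsum, hterma va hva, htermb vb ((hvb _).2 rfl) fun i hi => Or.inr ((hvb i).1 hi),
      htermb vab ((hvab _).2 (Or.inr rfl)) fun i hi => (hvab i).1 hi, sum_rank_bordered_zero]
    ring
  rw [hone, hzero]
  ring

/-! ### The dual adjacency of the caterpillar-Halin graphs -/

/-- Adjacency or equality of positions on a path. -/
def pathRel (i j : ℕ) : Prop := i = j ∨ i + 1 = j ∨ j + 1 = i

theorem pathRel_refl (i : ℕ) : pathRel i i := Or.inl rfl

theorem pathRel_symm {i j : ℕ} (h : pathRel i j) : pathRel j i := by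
  unfold pathRel at *
  omega

/-- Adjacency or equality of the bounded faces of `H_{m₁,m₂}`: `Sum.inl i` is the `i`-th face above
the spine and `Sum.inr j` the `j`-th face below it, both counted from the left from `0`. -/
def halinDual (m₁ m₂ : ℕ) : Fin (m₁ + 1) ⊕ Fin (m₂ + 1) → Fin (m₁ + 1) ⊕ Fin (m₂ + 1) → Prop
  | Sum.inl i, Sum.inl j => pathRel i j
  | Sum.inr i, Sum.inr j => pathRel i j
  | Sum.inl i, Sum.inr j => i.val = m₁ ∨ j.val = 0
  | Sum.inr j, Sum.inl i => i.val = m₁ ∨ j.val = 0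

/-- The relation `halinDual` without the last face above the spine. -/
def halinDualErase (m₁ m₂ : ℕ) : Fin m₁ ⊕ Fin (m₂ + 1) → Fin m₁ ⊕ Fin (m₂ + 1) → Prop
  | Sum.inl i, Sum.inl j => pathRel i j
  | Sum.inr i, Sum.inr j => pathRel i j
  | Sum.inl _, Sum.inr j => j.val = 0
  | Sum.inr j, Sum.inl _ => j.val = 0

theorem halinDual_refl {m₁ m₂ : ℕ} (i) : halinDual m₁ m₂ i i := by
  rcases i with i | i <;> exact pathRel_refl _

theorem halinDual_symm {m₁ m₂ : ℕ} {i j} (h : halinDual m₁ m₂ i j) : halinDual m₁ m₂ j i := by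
  rcases i with i | i <;> rcases j with j | j
  · exact pathRel_symm h
  · exact h
  · exact h
  · exact pathRel_symm h

/-- `none` becomes the last index of the second summand. -/
def optionSumFinEquiv (α : Type) (n : ℕ) : Option (α ⊕ Fin n) ≃ α ⊕ Fin (n + 1) :=
  Equiv.ofBijective
    (fun o => o.elim (Sum.inr (Fin.last n)) (Sum.elim Sum.inl fun i => Sum.inr i.castSucc)) (by
    constructor
    · rintro (_ | i | i) (_ | j | j) h <;> simp_all [Fin.ext_iff] <;> omega
    · rintro (a | i)
      · exact ⟨some (Sum.inl a), rfl⟩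
      · induction i using Fin.lastCases with
        | last => exact ⟨none, rfl⟩
        | cast i => exact ⟨some (Sum.inr i), rfl⟩)

/-- `none` becomes the last index of the first summand. -/
def optionFinSumEquiv (n : ℕ) (α : Type) : Option (Fin n ⊕ α) ≃ Fin (n + 1) ⊕ α :=
  Equiv.ofBijective
    (fun o => o.elim (Sum.inl (Fin.last n)) (Sum.elim (fun i => Sum.inl i.castSucc) Sum.inr)) (by
    constructor
    · rintro (_ | i | i) (_ | j | j) h <;> simp_all [Fin.ext_iff] <;> omega
    · rintro (i | a)
      · induction i using Fin.lastCases with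
        | last => exact ⟨none, rfl⟩
        | cast i => exact ⟨some (Sum.inl i), rfl⟩
      · exact ⟨some (Sum.inr a), rfl⟩)

/-- The last lower face is eliminated. Its neighbours are the last upper face and the preceding
lower face; the former meets every lower face, which gives the inclusion of neighbourhoods needed by
`rankPoly_option_two`. -/
theorem rankPoly_halinDual_recurrence (m₁ k : ℕ) (hm₁ : 1 ≤ m₁) :
    rankPoly (supportedSym (halinDual m₁ (k + 2))) =
      (1 + 4 * X) * rankPoly (supportedSym (halinDual m₁ (k + 1))) +
      16 * X ^ 2 * rankPoly (supportedSym (halinDual m₁ k)) +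
      2 ^ (k + 4) * X ^ 2 * rankPoly (supportedSym (halinDualErase m₁ (k + 1))) := by
  -- `e₀` singles out the eliminated lower face, `eb` the lower face before it, and `ea` the last
  -- upper face.
  let e₀ := optionSumFinEquiv (Fin (m₁ + 1)) (k + 2)
  let eb := optionSumFinEquiv (Fin (m₁ + 1)) (k + 1)
  let ea := optionFinSumEquiv m₁ (Fin (k + 2))
  have hred : ∀ i j, halinDual m₁ (k + 2) (e₀ (some i)) (e₀ (some j)) ↔
      halinDual m₁ (k + 1) i j := by
    rintro (i | i) (j | j) <;> exact Iff.rfl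
  have hredb : ∀ i j, halinDual m₁ (k + 1) (eb (some i)) (eb (some j)) ↔
      halinDual m₁ k i j := by
    rintro (i | i) (j | j) <;> exact Iff.rfl
  have hreda : ∀ i j, halinDual m₁ (k + 1) (ea (some i)) (ea (some j)) ↔
      halinDualErase m₁ (k + 1) i j := by
    rintro (i | i) (j | j)
    · exact Iff.rfl
    · exact or_iff_right i.2.ne
    · exact or_iff_right j.2.ne
    · exact Iff.rfl
  -- The neighbours of `b` are the last upper face and the lower face `k`; the coefficient is `2 ^
  -- (2 + 2) = 16`.
  have hcb : Nat.card {i // halinDual m₁ (k + 1) (eb none) (eb (some i))} = 2 := by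
    let f : Fin 2 → {i // halinDual m₁ (k + 1) (eb none) (eb (some i))} :=
      ![⟨Sum.inl (Fin.last m₁), Or.inl rfl⟩, ⟨Sum.inr (Fin.last k), Or.inr (Or.inr rfl)⟩]
    have hf : Function.Bijective f := by
      constructor
      · intro i j h
        have h' := congrArg Subtype.val h
        fin_cases i <;> fin_cases j <;>
          first | rfl | exact absurd h' Sum.inl_ne_inr | exact absurd h' Sum.inr_ne_inl
      · rintro ⟨i | i, hi⟩
        · refine ⟨0, Subtype.ext (congrArg Sum.inl (Fin.ext ?_))⟩
          rcases hi with hi | hi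
          · exact hi.symm
          · simp at hi
        · refine ⟨1, Subtype.ext (congrArg Sum.inr (Fin.ext ?_))⟩
          have h1 : pathRel (k + 1) i.val := hi
          have h2 := i.2
          unfold pathRel at h1
          change k = i.val
          omega
    rw [← Nat.card_congr (Equiv.ofBijective f hf), Nat.card_fin]
  -- The last upper face meets the `k + 2` remaining lower faces and the upper face `m₁ - 1`, which
  -- exists because `1 ≤ m₁`.
  have hca : Nat.card {i // halinDual m₁ (k + 1) (ea none) (ea (some i))} = k + 3 := by
    let f : Option (Fin (k + 2)) → {i // halinDual m₁ (k + 1) (ea none) (ea (some i))} :=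
      fun o => match o with
        | none => ⟨Sum.inl ⟨m₁ - 1, by omega⟩, Or.inr (Or.inr (Nat.sub_add_cancel hm₁))⟩
        | some j => ⟨Sum.inr j, Or.inl rfl⟩
    have hf : Function.Bijective f := by
      constructor
      · intro i j h
        have h' := congrArg Subtype.val h
        rcases i with _ | i <;> rcases j with _ | j
        · rfl
        · exact absurd h' Sum.inl_ne_inr
        · exact absurd h' Sum.inr_ne_inl
        · exact congrArg some (Sum.inr_injective h')
      · rintro ⟨i | i, hi⟩
        · refine ⟨none, Subtype.ext (congrArg Sum.inl (Fin.ext ?_))⟩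
          have h1 : pathRel m₁ i.val := hi
          have h2 := i.2
          unfold pathRel at h1
          change m₁ - 1 = i.val
          omega
        · exact ⟨some i, rfl⟩
    rw [← Nat.card_congr (Equiv.ofBijective f hf)]
    simp
  have hD := rankPoly_option_two (fun i j => halinDual m₁ (k + 2) (e₀ i) (e₀ j))
    (fun i => halinDual_refl _) (fun i j => halinDual_symm) ea eb (by
      change Sum.inl _ ≠ Sum.inr _
      exact Sum.inl_ne_inr) (Or.inl rfl) (by
      rintro (i | i)
      · change (i.val = m₁ ∨ k + 2 = 0) ↔ Sum.inl i = Sum.inl (Fin.last m₁) ∨ Sum.inl i = Sum.inr _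
        simp [Fin.ext_iff]
      · change pathRel (k + 2) i.val ↔ Sum.inr i = Sum.inl _ ∨ Sum.inr i = Sum.inr (Fin.last (k + 1))
        simp only [reduceCtorEq, false_or, Sum.inr.injEq, Fin.ext_iff, Fin.val_last, pathRel]
        omega) (by
      rintro (i | i) h
      · rcases h with h | h
        · exact Or.inl h.symm
        · exact absurd h (Nat.succ_ne_zero k)
      · exact Or.inl rfl)
  simp only [hred, hredb, hreda, hcb, hca] at hD
  rw [← rankPoly_supportedSym_reindex e₀ (D := fun i j => halinDual m₁ (k + 2) (e₀ i) (e₀ j))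
    (fun _ _ => Iff.rfl), hD]
  norm_num

/-! ### Ringel-ladder matrices and the matrices `Λ` as supported symmetric matrices -/

/-- The places of the entries of a Ringel-ladder overlap matrix. -/
def ringelRel (n : ℕ) (i j : Fin n) : Prop := i.val = 0 ∨ j.val = 0 ∨ pathRel i j

theorem exists_ringelMatrix_iff {n : ℕ} (M : Matrix (Fin n) (Fin n) (ZMod 2)) :
    (∃ x y z, M = ringelMatrix n x y z) ↔ M ∈ supportedSym (ringelRel n) := by
  constructor
  · rintro ⟨x, y, z, rfl⟩
    constructor
    · ext i j
      simp only [ringelMatrix, Matrix.transpose_apply, Matrix.of_apply, Fin.ext_iff]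
      split_ifs <;> first | rfl | omega | exact congrArg _ (by assumption)
    · intro i j h
      simp only [ringelRel, pathRel, not_or] at h
      simp only [ringelMatrix, Matrix.of_apply, Fin.ext_iff]
      split_ifs <;> first | rfl | omega
  · rintro ⟨h1, h2⟩
    -- The parameters are read off the diagonal, the superdiagonal and row 0; the default values are
    -- never used by the matrix.
    refine ⟨fun k => if h : k < n then M ⟨k, h⟩ ⟨k, h⟩ else 0,
      fun k => if h : k + 1 < n then M ⟨k, by omega⟩ ⟨k + 1, h⟩ else 0,
      fun k => if h : k < n then M ⟨0, by omega⟩ ⟨k, h⟩ else 0, ?_⟩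
    ext i j
    have hi := i.2
    have hj := j.2
    simp only [ringelMatrix, Matrix.of_apply, Fin.ext_iff]
    split_ifs with c1 c2 c3 c4 h5 c5
    · congr 1
      exact Fin.ext c1.symm
    · congr 1
      exact Fin.ext c2
    · rw [← h1.apply]
      congr 1
      exact Fin.ext c3
    · congr 1
      exact Fin.ext c4.symm
    · omega
    · rw [← h1.apply]
      congr 1
      exact Fin.ext (Eq.symm (by assumption))
    · omega
    · apply h2
      simp only [ringelRel, pathRel]
      omega

theorem ringelPoly_eq_rankPoly (n : ℕ) :
    ringelPoly n = rankPoly (supportedSym (ringelRel n)) := by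
  rw [← sum_range_ncard_rank _ n (by simp), ringelPoly]
  simp only [exists_ringelMatrix_iff]

/-- The only lower face meets all upper faces, so it is row 0; the upper faces form the tridiagonal
path. -/
theorem ringelPoly_eq_halinDual_zero (m₁ : ℕ) :
    ringelPoly (m₁ + 2) = rankPoly (supportedSym (halinDual m₁ 0)) := by
  let f : Fin (m₁ + 1) ⊕ Fin (0 + 1) → Fin (m₁ + 2) := Sum.elim Fin.succ fun _ => 0
  have hf : Function.Bijective f := by
    constructor
    · rintro (i | i) (j | j) h
      · exact congrArg _ (Fin.succ_injective _ h)
      · exact absurd h (Fin.succ_ne_zero i)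
      · exact absurd h.symm (Fin.succ_ne_zero j)
      · exact congrArg _ (Fin.ext (by omega))
    · intro i
      induction i using Fin.cases with
      | zero => exact ⟨Sum.inr 0, rfl⟩
      | succ i => exact ⟨Sum.inl i, rfl⟩
  rw [ringelPoly_eq_rankPoly]
  refine (rankPoly_supportedSym_reindex (Equiv.ofBijective f hf) ?_).symm
  rintro (i | i) (j | j) <;>
    simp [halinDual, ringelRel, pathRel, f]

/-- Lower face 0 meets every other face and is row 0. Lower face 1 meets besides it only the last
upper face, so it prolongs the upper path by one position. -/
theorem ringelPoly_eq_halinDual_one (m₁ : ℕ) :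
    ringelPoly (m₁ + 3) = rankPoly (supportedSym (halinDual m₁ 1)) := by
  let f : Fin (m₁ + 1) ⊕ Fin (1 + 1) → Fin (m₁ + 3) :=
    Sum.elim (fun i => i.castSucc.succ) ![0, Fin.last _]
  have hf : Function.Bijective f := by
    constructor
    · rintro (i | i) (j | j) h
      · simpa [f] using h
      · exfalso
        have := i.2
        have h := congrArg Fin.val h
        fin_cases j
        · exact absurd h (Nat.succ_ne_zero _)
        · change i.val + 1 = m₁ + 2 at h
          omega
      · exfalso
        have := j.2
        have h := congrArg Fin.val h
        fin_cases i
        · exact absurd h.symm (Nat.succ_ne_zero _)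
        · change m₁ + 2 = j.val + 1 at h
          omega
      · fin_cases i <;> fin_cases j <;> simp [f, Fin.ext_iff] at h ⊢
    · intro i
      induction i using Fin.cases with
      | zero => exact ⟨Sum.inr 0, rfl⟩
      | succ i =>
        induction i using Fin.lastCases with
        | last => exact ⟨Sum.inr 1, rfl⟩
        | cast i => exact ⟨Sum.inl i, rfl⟩
  rw [ringelPoly_eq_rankPoly]
  refine (rankPoly_supportedSym_reindex (Equiv.ofBijective f hf) ?_).symm
  rintro (i | i) (j | j)
  · simp [halinDual, ringelRel, pathRel, f]
  · have := i.2
    fin_cases j <;> simp [halinDual, ringelRel, pathRel, f]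
    omega
  · have := j.2
    fin_cases i <;> simp [halinDual, ringelRel, pathRel, f]
    omega
  · fin_cases i <;> fin_cases j <;> simp [halinDual, ringelRel, pathRel, f]

theorem tridiag_mem_supportedSym (m : ℕ) (a b : ℕ → ZMod 2) :
    tridiag m a b ∈ supportedSym fun i j : Fin m => pathRel i j := by
  constructor
  · ext i j
    simp only [tridiag, Matrix.transpose_apply, Matrix.of_apply, Fin.ext_iff]
    split_ifs <;> first | rfl | omega | (congr 1; omega)
  · intro i j h
    simp only [pathRel, not_or] at h
    simp only [tridiag, Matrix.of_apply, Fin.ext_iff]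
    split_ifs <;> first | rfl | omega

theorem exists_eq_tridiag {m : ℕ} {A : Matrix (Fin m) (Fin m) (ZMod 2)}
    (hA : A ∈ supportedSym fun i j : Fin m => pathRel i j) : ∃ a b, A = tridiag m a b := by
  -- The shift by one is due to parameters numbered from 1 and indices numbered from 0.
  refine ⟨fun k => if h : k - 1 < m then A ⟨k - 1, h⟩ ⟨k - 1, h⟩ else 0,
    fun k => if h : k < m then A ⟨k - 1, by omega⟩ ⟨k, h⟩ else 0, ?_⟩
  ext i j
  have hi := i.2
  have hj := j.2
  simp only [tridiag, Matrix.of_apply, Fin.ext_iff, Nat.add_sub_cancel]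
  split_ifs with c1 c2 c3 c4 c5
  · congr 1
    exact Fin.ext c1.symm
  · congr 1
    exact Fin.ext c2.symm
  · omega
  · rw [← hA.1.apply]
    congr 1
    exact Fin.ext c4.symm
  · omega
  · apply hA.2
    unfold pathRel
    omega

section

variable (m₁ m₂ : ℕ) (x₀ y₀ x₁ y₁ x₂ y₂ z₁ z₂ : ℕ → ZMod 2) (a : Fin 2)

theorem overlapMatrix_inl_inr_inl (i : Fin m₁) :
    overlapMatrix m₁ m₂ x₀ y₀ x₁ y₁ x₂ y₂ z₁ z₂ (Sum.inl a) (Sum.inr (Sum.inl i)) =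
      ![z₁ (i.val + 1), if i.val + 1 = m₁ then z₂ 0 else 0] a := rfl

theorem overlapMatrix_inl_inr_inr (j : Fin m₂) :
    overlapMatrix m₁ m₂ x₀ y₀ x₁ y₁ x₂ y₂ z₁ z₂ (Sum.inl a) (Sum.inr (Sum.inr j)) =
      ![if j.val = 0 then z₁ (m₁ + 1) else 0, z₂ (j.val + 1)] a := rfl

theorem overlapMatrix_inr_inl_inl (i : Fin m₁) :
    overlapMatrix m₁ m₂ x₀ y₀ x₁ y₁ x₂ y₂ z₁ z₂ (Sum.inr (Sum.inl i)) (Sum.inl a) =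
      ![z₁ (i.val + 1), if i.val + 1 = m₁ then z₂ 0 else 0] a := rfl

theorem overlapMatrix_inr_inr_inl (j : Fin m₂) :
    overlapMatrix m₁ m₂ x₀ y₀ x₁ y₁ x₂ y₂ z₁ z₂ (Sum.inr (Sum.inr j)) (Sum.inl a) =
      ![if j.val = 0 then z₁ (m₁ + 1) else 0, z₂ (j.val + 1)] a := rfl

end

/-- The places of the entries of the matrices `Λ`. -/
def lambdaRel (m₁ m₂ : ℕ) : Fin 2 ⊕ (Fin m₁ ⊕ Fin m₂) → Fin 2 ⊕ (Fin m₁ ⊕ Fin m₂) → Prop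
  | Sum.inl i, Sum.inl j => i = 0 ∧ j = 0
  | Sum.inl i, Sum.inr (Sum.inl _) => i = 0
  | Sum.inr (Sum.inl _), Sum.inl i => i = 0
  | Sum.inl i, Sum.inr (Sum.inr j) => i = 0 ∧ j.val = 0
  | Sum.inr (Sum.inr j), Sum.inl i => i = 0 ∧ j.val = 0
  | Sum.inr (Sum.inl i), Sum.inr (Sum.inl j) => pathRel i j
  | Sum.inr (Sum.inr i), Sum.inr (Sum.inr j) => pathRel i j
  | _, _ => False

theorem lambdaMatrices_eq (m₁ m₂ : ℕ) :
    lambdaMatrices m₁ m₂ = supportedSym (lambdaRel m₁ m₂) := by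
  ext M
  constructor
  · rintro ⟨⟨x₀, y₀, x₁, y₁, x₂, y₂, z₁, z₂, rfl⟩, hr, hc⟩
    have ht0 := tridiag_mem_supportedSym 2 x₀ y₀
    have ht1 := tridiag_mem_supportedSym m₁ x₁ y₁
    have ht2 := tridiag_mem_supportedSym m₂ x₂ y₂
    constructor
    · refine Matrix.IsSymm.fromBlocks ht0.1 (Matrix.transpose_transpose _) ?_
      exact Matrix.IsSymm.fromBlocks ht1.1 (by simp) ht2.1
    · have h01 : ∀ a : Fin 2, a ≠ 0 → a = 1 := by decide
      rintro (i | i | i) (j | j | j) h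
      · by_cases hi : i = 0
        · rw [h01 j fun hj => h ⟨hi, hj⟩]
          exact hc _
        · rw [h01 i hi]
          exact hr _
      · rw [h01 i h]
        exact hr _
      · by_cases hi : i = 0
        · have hj : j.val ≠ 0 := fun hj => h ⟨hi, hj⟩
          subst hi
          simp [overlapMatrix_inl_inr_inr, hj]
        · rw [h01 i hi]
          exact hr _
      · rw [h01 j h]
        exact hc _
      · exact ht1.2 i j h
      · rfl
      · by_cases hj : j = 0
        · have hi : i.val ≠ 0 := fun hi => h ⟨hj, hi⟩
          subst hj
          simp [overlapMatrix_inr_inr_inl, hi]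
        · rw [h01 j hj]
          exact hc _
      · rfl
      · exact ht2.2 i j h
  · rintro ⟨h1, h2⟩
    have hr : ∀ j, M (Sum.inl 1) j = 0 := by
      rintro (j | j | j) <;> apply h2 <;> simp [lambdaRel]
    have hc : ∀ i, M i (Sum.inl 1) = 0 := fun i => by rw [← h1.apply, hr]
    refine ⟨?_, hr, hc⟩
    obtain ⟨x₁, y₁, ht1⟩ := exists_eq_tridiag (m := m₁)
      (A := Matrix.of fun i j => M (Sum.inr (Sum.inl i)) (Sum.inr (Sum.inl j)))
      ⟨by ext i j; exact h1.apply _ _, fun i j h => h2 _ _ h⟩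
    obtain ⟨x₂, y₂, ht2⟩ := exists_eq_tridiag (m := m₂)
      (A := Matrix.of fun i j => M (Sum.inr (Sum.inr i)) (Sum.inr (Sum.inr j)))
      ⟨by ext i j; exact h1.apply _ _, fun i j h => h2 _ _ h⟩
    -- `z₁` holds `p` at the places `1, …, m₁` and `q` at `m₁ + 1`; the latter is an entry of the
    -- matrix only if `m₂` is positive.
    let z₁ : ℕ → ZMod 2 := fun k =>
      if h : k - 1 < m₁ then M (Sum.inl 0) (Sum.inr (Sum.inl ⟨k - 1, h⟩))
      else if h : 0 < m₂ then M (Sum.inl 0) (Sum.inr (Sum.inr ⟨0, h⟩)) else 0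
    have hz1 : ∀ i : Fin m₁, M (Sum.inl 0) (Sum.inr (Sum.inl i)) = z₁ (i.val + 1) := by
      intro i
      simp [z₁]
    have hz2 : ∀ j : Fin m₂, M (Sum.inl 0) (Sum.inr (Sum.inr j)) =
        if j.val = 0 then z₁ (m₁ + 1) else 0 := by
      intro j
      split_ifs with hj
      · have := j.2
        have hm : 0 < m₂ := by omega
        simp only [z₁, Nat.add_sub_cancel, lt_irrefl, dite_false, hm, dite_true]
        congr
        exact Fin.ext hj
      · apply h2
        rintro ⟨-, h⟩
        exact hj h
    refine ⟨fun k => if k = 1 then M (Sum.inl 0) (Sum.inl 0) else 0, 0, x₁, y₁, x₂, y₂, z₁, 0, ?_⟩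
    ext (i | i | i) (j | j | j)
    · fin_cases i <;> fin_cases j <;> simp [overlapMatrix, tridiag, hr, hc]
    · fin_cases i <;> simp [overlapMatrix_inl_inr_inl, hr, hz1]
    · fin_cases i <;> simp [overlapMatrix_inl_inr_inr, hr, hz2]
    · rw [← h1.apply]
      fin_cases j <;> simp [overlapMatrix_inr_inl_inl, hr, hz1]
    · exact congrFun (congrFun ht1 i) j
    · exact h2 _ _ fun h => h
    · rw [← h1.apply]
      fin_cases j <;> simp [overlapMatrix_inr_inr_inl, hr, hz2]
    · exact h2 _ _ fun h => h
    · exact congrFun (congrFun ht2 i) j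

/-- An index in no pair of the relation contributes nothing to the rank polynomial. -/
theorem rankPoly_supportedSym_option_isolated {W : Type} [Fintype W]
    (D : Option W → Option W → Prop) (h1 : ∀ i, ¬ D none i) (h2 : ∀ i, ¬ D i none) :
    rankPoly (supportedSym D) = rankPoly (supportedSym fun i j => D (some i) (some j)) := by
  classical
  let e : (supportedSym fun i j => D (some i) (some j)) ≃ supportedSym D :=
    { toFun := fun M => ⟨bordered 0 0 M.1, by
        constructor
        · ext (_ | i) (_ | j)
          · rfl
          · rfl
          · rfl
          · exact M.2.1.apply i j
        · rintro (_ | i) (_ | j) h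
          · rfl
          · rfl
          · rfl
          · exact M.2.2 _ _ h⟩
      invFun := fun M => ⟨Matrix.of fun i j => M.1 (some i) (some j), by
        constructor
        · ext i j
          exact M.2.1.apply _ _
        · exact fun i j h => M.2.2 _ _ h⟩
      left_inv := fun M => rfl
      right_inv := by
        intro M
        ext (_ | i) (_ | j)
        · exact (M.2.2 _ _ (h1 _)).symm
        · exact (M.2.2 _ _ (h1 _)).symm
        · exact (M.2.2 _ _ (h2 _)).symm
        · rfl }
  exact (rankPoly_congr e fun M => rank_bordered_zero _).symm

/-- The vanishing second index is dropped. Of the others, the first is lower face 0, the block `A₁`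
belongs to the remaining upper faces and `A₂` to the lower faces from 1 on. -/
theorem lambdaPoly_eq_rankPoly (m₁ m₂ : ℕ) :
    lambdaPoly m₁ m₂ = rankPoly (supportedSym (halinDualErase m₁ m₂)) := by
  have h : lambdaPoly m₁ m₂ = rankPoly (lambdaMatrices m₁ m₂) :=
    sum_range_ncard_rank (lambdaMatrices m₁ m₂) (2 + m₁ + m₂) (by simp; omega)
  let f : Option (Fin m₁ ⊕ Fin (m₂ + 1)) → Fin 2 ⊕ (Fin m₁ ⊕ Fin m₂) := fun o =>
    o.elim (Sum.inl 1) (Sum.elim (fun i => Sum.inr (Sum.inl i))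
      (Fin.cases (Sum.inl 0) fun j => Sum.inr (Sum.inr j)))
  let g : Fin 2 ⊕ (Fin m₁ ⊕ Fin m₂) → Option (Fin m₁ ⊕ Fin (m₂ + 1)) :=
    Sum.elim ![some (Sum.inr 0), none] (Sum.elim (fun i => some (Sum.inl i))
      fun j => some (Sum.inr j.succ))
  let e : Option (Fin m₁ ⊕ Fin (m₂ + 1)) ≃ Fin 2 ⊕ (Fin m₁ ⊕ Fin m₂) :=
    { toFun := f
      invFun := g
      left_inv := by
        rintro (_ | i | i)
        · rfl
        · rfl
        · induction i using Fin.cases <;> rfl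
      right_inv := by
        rintro (i | i | i)
        · fin_cases i <;> rfl
        · rfl
        · rfl }
  rw [h, lambdaMatrices_eq, ← rankPoly_supportedSym_reindex e
    (D := fun i j => lambdaRel m₁ m₂ (e i) (e j)) (fun _ _ => Iff.rfl),
    rankPoly_supportedSym_option_isolated]
  · congr
    funext i j
    apply propext
    rcases i with i | i <;> rcases j with j | j
    · exact Iff.rfl
    · induction j using Fin.cases <;> simp [e, f, lambdaRel, halinDualErase]
    · induction i using Fin.cases <;> simp [e, f, lambdaRel, halinDualErase]
    · induction i using Fin.cases <;> induction j using Fin.cases <;>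
        simp [e, f, lambdaRel, halinDualErase, pathRel, eq_comm]
  · rintro (_ | i | i) <;> try simp [e, f, lambdaRel]
    induction i using Fin.cases <;> simp
  · rintro (_ | i | i) <;> try simp [e, f, lambdaRel]
    induction i using Fin.cases <;> simp

/-! ### Rotation systems of plane cubic graphs -/

/-- A planar embedding of a cubic graph `G` with a spanning tree `T` such that the outer face is
bounded by the edges outside `T`, and every bounded face contains one of these. -/
structure PlaneScheme {V : Type} (G T : SimpleGraph V) (J : Type) where
  /-- the neighbours of a vertex in their cyclic order -/
  nb : ∀ v, ZMod 3 ≃ G.neighborSet v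
  /-- the face to the left of the dart `a → b`; the outer face is `none` -/
  left : V → V → Option J
  -- The edges to two consecutive neighbours bound a common corner at `v`.
  left_next : ∀ v k, left (nb v (k + 1)) v = left v (nb v k)
  tree_le : T ≤ G
  /-- the dart outside `T` with a given bounded face to its left -/
  chord : J → V × V
  chord_adj : ∀ e, G.Adj (chord e).1 (chord e).2
  chord_not_tree : ∀ e, ¬ T.Adj (chord e).1 (chord e).2
  left_chord : ∀ e, left (chord e).1 (chord e).2 = some e
  right_chord : ∀ e, left (chord e).2 (chord e).1 = none
  exists_chord : ∀ a b, G.Adj a b → ¬ T.Adj a b → ∃ e, (a, b) = chord e ∨ (b, a) = chord e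
  left_tree : ∀ a b, T.Adj a b → ∃ e, left a b = some e
  left_ne : ∀ a b, T.Adj a b → left a b ≠ left b a
  -- Two faces share at most one tree edge, so an off-diagonal overlap entry comes from a single
  -- edge.
  tree_inj : ∀ a b a' b', T.Adj a b → T.Adj a' b' → left a b = left a' b' →
    left b a = left b' a' → a = a' ∧ b = b'
  -- This and the next field are the cohomological form of "`T` is a spanning tree": no cycles, and
  -- connected.
  exists_potential : ∀ δ : V → V → ZMod 2, (∀ a b, δ a b = δ b a) →
    ∃ g : V → ZMod 2, ∀ a b, T.Adj a b → g a + g b = δ a b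
  tree_const : ∀ g : V → ZMod 2, (∀ a b, T.Adj a b → g a = g b) → ∀ a b, g a = g b

namespace PlaneScheme

variable {V J : Type} {G T : SimpleGraph V}

/-! ### Face boundaries and cycles -/

theorem exists_nb (S : PlaneScheme G T J) {a b : V} (h : G.Adj a b) : ∃ k, (S.nb a k : V) = b :=
  ⟨(S.nb a).symm ⟨b, h⟩, by simp⟩

theorem nb_adj (S : PlaneScheme G T J) (a : V) (k : ZMod 3) : G.Adj a (S.nb a k) := (S.nb a k).2

open scoped Classical in
theorem sum_adj [Fintype V] (S : PlaneScheme G T J) (a : V) (f : V → ZMod 2) :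
    ∑ b, (if G.Adj a b then f b else 0) = ∑ k, f (S.nb a k) := by
  rw [Equiv.sum_comp (S.nb a) (fun b => f b), ← Finset.sum_filter,
    Finset.sum_subtype (p := fun b => b ∈ G.neighborSet a)]
  simp

open scoped Classical in
/-- The boundary of a face is closed. -/
theorem sum_face_boundary [Fintype V] (S : PlaneScheme G T J) (φ : V → ZMod 2) (o : Option J) :
    ∑ a, ∑ b, (if G.Adj a b then if S.left a b = o then φ a + φ b else 0 else 0) = 0 := by
  have h1 : ∑ a, ∑ b, (if G.Adj a b then if S.left a b = o then φ a + φ b else 0 else 0) =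
      ∑ a, ∑ b, (if G.Adj a b then if S.left a b = o then φ a else 0 else 0) +
      ∑ b, ∑ a, (if G.Adj b a then if S.left a b = o then φ b else 0 else 0) := by
    rw [Finset.sum_comm (f := fun b a => if G.Adj b a then if S.left a b = o then φ b else 0 else 0),
      ← Finset.sum_add_distrib]
    refine Finset.sum_congr rfl fun a _ => ?_
    rw [← Finset.sum_add_distrib]
    refine Finset.sum_congr rfl fun b _ => ?_
    simp only [G.adj_comm b a]
    split_ifs <;> simp
  rw [h1, CharTwo.add_eq_zero]
  refine Finset.sum_congr rfl fun a _ => ?_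
  rw [S.sum_adj a (fun b => if S.left a b = o then φ a else 0),
    S.sum_adj a (fun b => if S.left b a = o then φ a else 0)]
  -- A face enters and leaves `a` through the same corner, so the incoming darts are the outgoing
  -- ones shifted by one.
  rw [← Equiv.sum_comp (Equiv.addRight (1 : ZMod 3))
    (fun k => if S.left (S.nb a k) a = o then φ a else 0)]
  refine Finset.sum_congr rfl fun k _ => ?_
  rw [Equiv.coe_addRight, S.left_next]

/-- A cycle of a tree vanishes. -/
theorem tree_cycle_eq_zero [Fintype V] (S : PlaneScheme G T J) (c : V → V → ZMod 2)
    (hs : ∀ a b, c a b = c b a) (hT : ∀ a b, ¬ T.Adj a b → c a b = 0)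
    (hc : ∀ a, ∑ b, c a b = 0) (p q : V) : c p q = 0 := by
  classical
  by_cases hpq : T.Adj p q
  swap
  · exact hT p q hpq
  have eq_one : ∀ x : ZMod 2, x ≠ 0 → x = 1 := by decide
  -- `g` is the indicator of the `p`-side of the cut made by removing the edge `pq` from `T`.
  obtain ⟨g, hgp, hg⟩ : ∃ g : V → ZMod 2, g p = 1 ∧ ∀ a b, T.Adj a b → g a + g b =
      if (a = p ∧ b = q) ∨ (a = q ∧ b = p) then 1 else 0 := by
    obtain ⟨g, hg⟩ := S.exists_potential
      (fun a b => if (a = p ∧ b = q) ∨ (a = q ∧ b = p) then 1 else 0) fun a b => by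
        congr 1
        apply propext
        tauto
    refine ⟨fun a => g a + (g p + 1), ?_, fun a b h => ?_⟩
    · change g p + (g p + 1) = 1
      rw [← add_assoc, CharTwo.add_self_eq_zero, zero_add]
    · rw [← hg a b h, add_add_add_comm, CharTwo.add_self_eq_zero, add_zero]
  have hgq : g q = 0 := by
    have := hg p q hpq
    rw [if_pos (Or.inl ⟨rfl, rfl⟩), hgp] at this
    simpa using this
  -- Edges inside the `p`-side are counted twice, and `pq` is the only tree edge leaving it. Hence
  -- `c p q` is the sum of the vertex sums of `c` over the `p`-side, which are all zero.
  have h1 : ∑ x : V × V, g x.1 * g x.2 * c x.1 x.2 = 0 := by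
    refine Finset.sum_involution (fun x _ => (x.2, x.1)) ?_ ?_ ?_ ?_
    · rintro ⟨a, b⟩ -
      rw [hs b a, mul_comm (g b), CharTwo.add_self_eq_zero]
    · rintro ⟨a, b⟩ - h hab
      obtain rfl : b = a := (Prod.ext_iff.1 hab).1
      exact h (by rw [hT b b (T.loopless.irrefl b), mul_zero])
    · simp
    · simp
  have h2 : ∑ x : V × V, g x.1 * (1 + g x.2) * c x.1 x.2 = c p q := by
    rw [Finset.sum_eq_single (p, q)]
    · rw [hgp, hgq]
      ring
    · rintro ⟨a, b⟩ - hne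
      by_contra h
      have h3 := left_ne_zero_of_mul h
      have h4 := left_ne_zero_of_mul h3
      have h5 := right_ne_zero_of_mul h3
      have h6 : T.Adj a b := by
        by_contra h7
        exact right_ne_zero_of_mul h (hT a b h7)
      have h8 : g a + g b ≠ 0 := by
        have : ∀ x y : ZMod 2, x ≠ 0 → 1 + y ≠ 0 → x + y ≠ 0 := by decide
        exact this _ _ h4 h5
      rw [hg a b h6] at h8
      rcases (ne_eq _ _ ▸ h8 : ¬ _) with h9
      split_ifs at h9 with h10
      · rcases h10 with ⟨rfl, rfl⟩ | ⟨rfl, rfl⟩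
        · exact hne rfl
        · exact h4 hgq
      · exact h9 rfl
    · simp
  have h3 : ∑ x : V × V, g x.1 * (1 + g x.2) * c x.1 x.2 + ∑ x : V × V, g x.1 * g x.2 * c x.1 x.2 =
      ∑ a, g a * ∑ b, c a b := by
    rw [← Finset.sum_add_distrib, Fintype.sum_prod_type]
    refine Finset.sum_congr rfl fun a _ => ?_
    rw [Finset.mul_sum]
    refine Finset.sum_congr rfl fun b _ => ?_
    have h2 : (2 : ZMod 2) = 0 := rfl
    linear_combination g a * g b * c a b * h2
  rw [h1, h2, add_zero] at h3
  rw [h3]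
  simp [hc]

/-! ### The overlap matrix and its kernel -/

/-- The value of a face function, which vanishes on the outer face. -/
def val (x : J → ZMod 2) (o : Option J) : ZMod 2 := o.elim 0 x

open scoped Classical in
/-- The twist of an edge, given the twists of the chords. -/
def twistOf [Fintype J] (S : PlaneScheme G T J) (t : J → ZMod 2) (a b : V) : ZMod 2 :=
  ∑ e, if (a, b) = S.chord e ∨ (b, a) = S.chord e then t e else 0

theorem twistOf_symm [Fintype J] (S : PlaneScheme G T J) (t : J → ZMod 2) (a b : V) :
    S.twistOf t a b = S.twistOf t b a := by
  classical
  unfold twistOf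
  exact Finset.sum_congr rfl fun e _ => if_congr or_comm rfl rfl

theorem chord_inj (S : PlaneScheme G T J) {e e' : J}
    (h : S.chord e = S.chord e' ∨ (S.chord e).swap = S.chord e') : e = e' := by
  rcases h with h | h
  · have h1 := S.left_chord e
    rw [h, S.left_chord e'] at h1
    exact (Option.some_injective _ h1).symm
  · have h1 := S.left_chord e'
    rw [← h] at h1
    exact absurd ((S.right_chord e).symm.trans h1) (by simp)

theorem twistOf_chord [Fintype J] (S : PlaneScheme G T J) (t : J → ZMod 2) (e : J) :
    S.twistOf t (S.chord e).1 (S.chord e).2 = t e := by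
  classical
  rw [twistOf, Finset.sum_eq_single e]
  · exact if_pos (Or.inl rfl)
  · intro e' _ hne
    exact if_neg fun h => hne (S.chord_inj h).symm
  · simp

theorem twistOf_tree [Fintype J] (S : PlaneScheme G T J) (t : J → ZMod 2) {a b : V}
    (h : T.Adj a b) : S.twistOf t a b = 0 := by
  classical
  refine Finset.sum_eq_zero fun e _ => if_neg ?_
  have h1 := S.chord_not_tree e
  rintro (h2 | h2)
  · rw [← h2] at h1
    exact h1 h
  · rw [← h2] at h1
    exact h1 h.symm

open scoped Classical in
/-- The overlap matrix of a rotation system, given by its bits at the vertices, relative to the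
planar rotation, and by the twists of the chords. -/
def overlap [Fintype V] (S : PlaneScheme G T J) (r : V → ZMod 2) (t : J → ZMod 2) :
    Matrix J J (ZMod 2) :=
  Matrix.of fun e e' => (if e = e' then t e else 0) +
    ∑ a, ∑ b, if T.Adj a b ∧ S.left a b = some e ∧ S.left b a = some e' then r a + r b else 0

/-- The value that `g a + g b` must have when `g` and `x` give a function on the faces. -/
def jump [Fintype J] (S : PlaneScheme G T J) (r : V → ZMod 2) (t x : J → ZMod 2) (a b : V) :
    ZMod 2 :=
  (r a + r b + S.twistOf t a b) * (val x (S.left a b) + val x (S.left b a))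

theorem jump_symm [Fintype J] (S : PlaneScheme G T J) (r : V → ZMod 2) (t x : J → ZMod 2)
    (a b : V) : S.jump r t x a b = S.jump r t x b a := by
  simp only [jump, S.twistOf_symm t a b]
  ring

open scoped Classical in
-- The chord `e` is the only edge outside `T` on the boundary of the bounded face `e`.
theorem sum_face_split [Fintype V] (S : PlaneScheme G T J) (e : J) (f : V → V → ZMod 2) :
    ∑ a, ∑ b, (if G.Adj a b then if S.left a b = some e then f a b else 0 else 0) =
      f (S.chord e).1 (S.chord e).2 +
        ∑ a, ∑ b, (if T.Adj a b then if S.left a b = some e then f a b else 0 else 0) := by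
  have h1 : ∑ a, ∑ b, (if (a, b) = S.chord e then f a b else 0) =
      f (S.chord e).1 (S.chord e).2 := by
    rw [← Fintype.sum_prod_type' (f := fun a b => if (a, b) = S.chord e then f a b else 0)]
    simp
  rw [← h1, ← Finset.sum_add_distrib]
  refine Finset.sum_congr rfl fun a _ => ?_
  rw [← Finset.sum_add_distrib]
  refine Finset.sum_congr rfl fun b _ => ?_
  by_cases hT : T.Adj a b
  · have hne : (a, b) ≠ S.chord e := by
      intro h
      have := S.chord_not_tree e
      rw [← h] at this
      exact this hT
    rw [if_pos hT, if_pos (S.tree_le hT), if_neg hne, zero_add]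
  · rw [if_neg hT, add_zero]
    by_cases hc : (a, b) = S.chord e
    · have h2 := S.chord_adj e
      have h3 := S.left_chord e
      rw [← hc] at h2 h3
      rw [if_pos hc, if_pos h2, if_pos h3]
    · rw [if_neg hc]
      by_cases hG : G.Adj a b
      · rw [if_pos hG, if_neg]
        intro hl
        obtain ⟨e', h | h⟩ := S.exists_chord a b hG hT
        · have h3 := S.left_chord e'
          rw [← h] at h3
          rw [hl] at h3
          exact hc (h.trans (by rw [Option.some_injective _ h3]))
        · have h3 := S.right_chord e'
          rw [← h] at h3
          rw [hl] at h3
          simp at h3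
      · rw [if_neg hG]

open scoped Classical in
-- A tree edge between `e` and `e'` contributes `(r a + r b) * (x e + x e')` to the sum around `e`.
-- The `x e'` parts are the off-diagonal entries. The `x e` parts, with that of the chord, add up to
-- `x e` times the sum of `r a + r b` around a closed boundary, which is zero; only `t e * x e` is
-- left.
theorem overlap_mulVec [Fintype V] [Fintype J] (S : PlaneScheme G T J) (r : V → ZMod 2)
    (t x : J → ZMod 2) (e : J) :
    (S.overlap r t).mulVec x e =
      ∑ a, ∑ b, (if G.Adj a b then if S.left a b = some e then S.jump r t x a b else 0 else 0) := by
  have h0 := congrArg (· * x e) (S.sum_face_boundary r (some e))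
  simp only [S.sum_face_split, add_mul, zero_mul, Finset.sum_mul] at h0
  rw [sum_face_split]
  refine Eq.trans ?_ ((congrArg (_ + ·) h0).trans (add_zero _))
  rw [add_add_add_comm, ← Finset.sum_add_distrib]
  have hchord : S.jump r t x (S.chord e).1 (S.chord e).2 +
      (r (S.chord e).1 * x e + r (S.chord e).2 * x e) = t e * x e := by
    simp only [jump, twistOf_chord, left_chord, right_chord, val, Option.elim]
    have h2 : (2 : ZMod 2) = 0 := rfl
    linear_combination (r (S.chord e).1 + r (S.chord e).2) * x e * h2
  have htree : ∀ a b, (∑ e', (if T.Adj a b ∧ S.left a b = some e ∧ S.left b a = some e' then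
      r a + r b else 0) * x e') =
      (if T.Adj a b then if S.left a b = some e then S.jump r t x a b else 0 else 0) +
      (if T.Adj a b then if S.left a b = some e then r a + r b else 0 else 0) * x e := by
    intro a b
    by_cases hT : T.Adj a b
    · by_cases hl : S.left a b = some e
      · obtain ⟨e', he'⟩ := S.left_tree b a hT.symm
        simp only [hT, hl, he', jump, S.twistOf_tree t hT, val, Option.elim, true_and, if_true,
          Option.some.injEq, ite_mul, zero_mul, Finset.sum_ite_eq, Finset.mem_univ]
        have h2 : (2 : ZMod 2) = 0 := rfl
        linear_combination -(r a + r b) * x e * h2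
      · simp [hl]
    · simp [hT]
  rw [hchord]
  simp only [Matrix.mulVec, dotProduct, overlap, Matrix.of_apply, add_mul, Finset.sum_add_distrib]
  congr 1
  · simp
  · rw [← Finset.sum_add_distrib]
    simp only [Finset.sum_mul]
    rw [Finset.sum_comm]
    refine Finset.sum_congr rfl fun a _ => ?_
    rw [Finset.sum_comm, ← Finset.sum_add_distrib]
    refine Finset.sum_congr rfl fun b _ => ?_
    rw [htree]

/-- Pairs of a vertex and a face function that give a function on the faces. -/
abbrev Solution [Fintype J] (S : PlaneScheme G T J) (r : V → ZMod 2) (t : J → ZMod 2) : Type :=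
  {p : (V → ZMod 2) × (J → ZMod 2) // ∀ a b, G.Adj a b → p.1 a + p.1 b = S.jump r t p.2 a b}

theorem overlap_mulVec_solution [Fintype V] [Fintype J] (S : PlaneScheme G T J) {r : V → ZMod 2}
    {t : J → ZMod 2} (p : S.Solution r t) : (S.overlap r t).mulVec p.1.2 = 0 := by
  classical
  funext e
  refine Eq.trans ?_ (S.sum_face_boundary p.1.1 (some e))
  rw [overlap_mulVec]
  refine Finset.sum_congr rfl fun a _ => Finset.sum_congr rfl fun b _ => ?_
  by_cases hG : G.Adj a b
  · rw [p.2 a b hG]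
  · rw [if_neg hG, if_neg hG]

/-- Given `x`, the tree equations have a solution `g`, unique up to a constant fixed by `g v₀`; this
is the factor 2. The chord equations hold precisely when `x` lies in the kernel. -/
theorem card_solution [Fintype V] [Fintype J] (S : PlaneScheme G T J) (v₀ : V)
    (r : V → ZMod 2) (t : J → ZMod 2) :
    Nat.card (S.Solution r t) = 2 * Nat.card {x // (S.overlap r t).mulVec x = 0} := by
  classical
  have hp : Nat.card (ZMod 2 × {x // (S.overlap r t).mulVec x = 0}) =
      2 * Nat.card {x // (S.overlap r t).mulVec x = 0} := by
    rw [Nat.card_prod, Nat.card_zmod]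
  rw [← hp]
  refine Nat.card_congr (Equiv.ofBijective
    (fun p => (p.1.1 v₀, ⟨p.1.2, S.overlap_mulVec_solution p⟩)) ⟨?_, ?_⟩)
  · rintro ⟨⟨g, x⟩, h⟩ ⟨⟨g', x'⟩, h'⟩ heq
    simp only [Prod.mk.injEq, Subtype.mk.injEq] at heq
    obtain ⟨h0, rfl⟩ := heq
    have hconst := S.tree_const (fun a => g a + g' a) fun a b hab => by
      have h1 := h a b (S.tree_le hab)
      have h2 := h' a b (S.tree_le hab)
      rw [← h2] at h1
      change g a + g b = g' a + g' b at h1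
      change g a + g' a = g b + g' b
      revert h1
      generalize g a = p1
      generalize g b = p2
      generalize g' a = p3
      generalize g' b = p4
      revert p1 p2 p3 p4
      decide
    have : g = g' := by
      funext a
      have h1 : g a + g' a = g v₀ + g' v₀ := hconst a v₀
      rwa [h0, CharTwo.add_self_eq_zero, CharTwo.add_eq_zero] at h1
    subst this
    rfl
  · rintro ⟨c, x, hx⟩
    obtain ⟨g, hg⟩ := S.exists_potential (S.jump r t x) (S.jump_symm r t x)
    -- Both `g a + g b` and the jumps sum to zero around face `e`, and they agree on its tree edges,
    -- so they agree on its chord.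
    have hchord : ∀ e, g (S.chord e).1 + g (S.chord e).2 =
        S.jump r t x (S.chord e).1 (S.chord e).2 := by
      intro e
      have h1 := S.overlap_mulVec r t x e
      have h2 := S.sum_face_boundary g (some e)
      rw [hx, Pi.zero_apply] at h1
      replace h1 := h2.trans h1
      rw [S.sum_face_split, S.sum_face_split] at h1
      have h3 : ∀ a b, (if T.Adj a b then if S.left a b = some e then S.jump r t x a b else 0
          else 0) = (if T.Adj a b then if S.left a b = some e then g a + g b else 0 else 0) := by
        intro a b
        by_cases hT : T.Adj a b
        · rw [hg a b hT]
        · rw [if_neg hT, if_neg hT]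
      simp only [h3] at h1
      exact add_right_cancel h1
    have hall : ∀ a b, G.Adj a b → g a + g b = S.jump r t x a b := by
      intro a b hG
      by_cases hT : T.Adj a b
      · exact hg a b hT
      · obtain ⟨e, h | h⟩ := S.exists_chord a b hG hT
        · have := hchord e
          rwa [← h] at this
        · have := hchord e
          rw [← h] at this
          rw [add_comm, this, jump_symm]
    refine ⟨⟨(fun a => g a + (g v₀ + c), x), fun a b hG => ?_⟩, ?_⟩
    · rw [← hall a b hG, add_add_add_comm, CharTwo.add_self_eq_zero, add_zero]
    · ext
      · change g v₀ + (g v₀ + c) = c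
        rw [← add_assoc, CharTwo.add_self_eq_zero, zero_add]
      · rfl

/-! ### Rotation systems as bits and chord twists -/

/-- The step of a rotation at a cubic vertex: `1` for the planar rotation and `2` for its inverse. -/
def step (b : ZMod 2) : ZMod 3 := if b = 0 then 1 else 2

theorem step_cases (b : ZMod 2) : (b = 0 ∧ step b = 1) ∨ (b = 1 ∧ step b = 2) := by
  revert b
  decide

theorem isCycleOn_addRight_step (b : ZMod 2) :
    (Equiv.addRight (step b)).IsCycleOn (Set.univ : Set (ZMod 3)) := by
  refine ⟨⟨fun _ _ => Set.mem_univ _, (Equiv.injective _).injOn, (Equiv.surjective _).surjOn⟩, ?_⟩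
  intro x _ y _
  have key : ∀ b x y, ∃ n : Fin 3, ((Equiv.addRight (step b)) ^ n.val) x = y := by decide
  obtain ⟨n, hn⟩ := key b x y
  exact ⟨n.val, by simpa using hn⟩

/-- The only fixed-point-free permutations of three elements are the two rotations. -/
theorem exists_step (σ : Equiv.Perm (ZMod 3)) (h : σ.IsCycleOn Set.univ) :
    ∃ b, σ = Equiv.addRight (step b) := by
  have hne : ∀ k, σ k ≠ k := fun k => h.apply_ne Set.nontrivial_univ (Set.mem_univ k)
  have key : ∀ τ : Equiv.Perm (Fin 3), (∀ k, τ k ≠ k) →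
      (∀ k : Fin 3, τ k = k + 1) ∨ ∀ k : Fin 3, τ k = k + 2 := by decide
  rcases key σ hne with h1 | h1
  · exact ⟨0, Equiv.ext h1⟩
  · exact ⟨1, Equiv.ext h1⟩

theorem isCycleOn_univ_conj {α β : Type} (e : α ≃ β) (σ : Equiv.Perm α)
    (h : σ.IsCycleOn Set.univ) : (e.permCongr σ).IsCycleOn Set.univ := by
  refine ⟨⟨fun _ _ => Set.mem_univ _, (Equiv.injective _).injOn, (Equiv.surjective _).surjOn⟩, ?_⟩
  intro x _ y _
  obtain ⟨n, hn⟩ := h.2 (Set.mem_univ (e.symm x)) (Set.mem_univ (e.symm y))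
  refine ⟨n, ?_⟩
  have : (e.permCongr σ) ^ n = e.permCongr (σ ^ n) :=
    (map_zpow e.permCongrHom σ n).symm
  rw [this, Equiv.permCongr_apply, hn, e.apply_symm_apply]

theorem exists_bit (S : PlaneScheme G T J) (R : RotationSystem G) (v : V) :
    ∃ b, ∀ k, (R.rot v).1 (S.nb v k) = S.nb v (k + step b) := by
  obtain ⟨b, hb⟩ := exists_step ((S.nb v).symm.permCongr (R.rot v).1)
    (isCycleOn_univ_conj _ _ (R.rot v).2)
  refine ⟨b, fun k => ?_⟩
  have := Equiv.congr_fun hb k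
  rw [Equiv.permCongr_apply, Equiv.symm_symm, Equiv.symm_apply_eq] at this
  exact this

/-- The bit of a rotation system at a vertex: does its rotation differ from the planar one? -/
def bit (S : PlaneScheme G T J) (R : RotationSystem G) (v : V) : ZMod 2 :=
  (S.exists_bit R v).choose

theorem rot_nb (S : PlaneScheme G T J) (R : RotationSystem G) (v : V) (k : ZMod 3) :
    (R.rot v).1 (S.nb v k) = S.nb v (k + step (S.bit R v)) :=
  (S.exists_bit R v).choose_spec k

theorem bit_eq (S : PlaneScheme G T J) (R : RotationSystem G) (v : V) (b : ZMod 2)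
    (h : ∀ k, (R.rot v).1 (S.nb v k) = S.nb v (k + step b)) : S.bit R v = b := by
  have h1 := (S.nb v).injective ((S.rot_nb R v 0).symm.trans (h 0))
  generalize S.bit R v = b' at h1 ⊢
  clear h
  revert b b'
  decide

/-- The twists of the chords of a rotation system. -/
def chordTwist (S : PlaneScheme G T J) (R : RotationSystem G) (e : J) : ZMod 2 :=
  R.twist ⟨s((S.chord e).1, (S.chord e).2), S.chord_adj e⟩

theorem twist_eq [Fintype J] (S : PlaneScheme G T J) (R : TRotationSystem G T) {a b : V}
    (h : G.Adj a b) : R.1.twist ⟨s(a, b), h⟩ = S.twistOf (S.chordTwist R.1) a b := by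
  by_cases hT : T.Adj a b
  · rw [S.twistOf_tree _ hT]
    exact R.2 _ hT
  · obtain ⟨e, he | he⟩ := S.exists_chord a b h hT
    · obtain ⟨rfl, rfl⟩ := Prod.ext_iff.1 he
      rw [twistOf_chord]
      rfl
    · obtain ⟨rfl, rfl⟩ := Prod.ext_iff.1 he
      rw [twistOf_symm, twistOf_chord]
      congr 2
      exact Sym2.eq_swap

/-- A `T`-rotation system of a plane cubic graph is given by bits and by twists of chords. -/
def rotationEquiv [Fintype J] (S : PlaneScheme G T J) :
    TRotationSystem G T ≃ (V → ZMod 2) × (J → ZMod 2) :=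
  Equiv.ofBijective (fun R => (S.bit R.1, S.chordTwist R.1)) (by
    constructor
    · intro R R' h
      simp only [Prod.mk.injEq] at h
      obtain ⟨h1, h2⟩ := h
      have hrot : R.1.rot = R'.1.rot := by
        funext v
        refine Subtype.ext (Equiv.ext fun w => ?_)
        obtain ⟨k, rfl⟩ := (S.nb v).surjective w
        rw [rot_nb, rot_nb, h1]
      have htw : R.1.twist = R'.1.twist := by
        funext ⟨e, he⟩
        induction e using Sym2.ind with
        | _ a b => rw [S.twist_eq R he, S.twist_eq R' he, h2]
      apply Subtype.ext
      obtain ⟨⟨ρ, τ⟩, hR⟩ := R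
      obtain ⟨⟨ρ', τ'⟩, hR'⟩ := R'
      obtain rfl : ρ = ρ' := hrot
      obtain rfl : τ = τ' := htw
      rfl
    · rintro ⟨r, t⟩
      let R : RotationSystem G :=
        { rot := fun v => ⟨(S.nb v).permCongr (Equiv.addRight (step (r v))),
            isCycleOn_univ_conj _ _ (isCycleOn_addRight_step _)⟩
          twist := fun e => Sym2.lift ⟨S.twistOf t, S.twistOf_symm t⟩ e.1 }
      refine ⟨⟨R, ?_⟩, ?_⟩
      · rintro ⟨e, he⟩
        induction e using Sym2.ind with
        | _ a b => exact fun h => S.twistOf_tree t h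
      · refine Prod.ext ?_ ?_
        · funext v
          refine S.bit_eq R v (r v) fun k => ?_
          simp [R]
        · funext e
          exact S.twistOf_chord t e)

/-! ### Functions on flags and on faces -/

variable (S : PlaneScheme G T J)

/-- The face of the planar embedding that a side of a dart meets at the initial vertex. -/
def sideFace (r : V → ZMod 2) (d : G.Dart × ZMod 2) : Option J :=
  if d.2 = r d.1.fst then S.left d.1.fst d.1.snd else S.left d.1.snd d.1.fst

theorem exists_dart_nb (d : G.Dart) : ∃ k, d = ⟨(d.fst, S.nb d.fst k), S.nb_adj d.fst k⟩ := by
  obtain ⟨⟨a, b⟩, h⟩ := d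
  obtain ⟨k, hk⟩ := S.exists_nb h
  refine ⟨k, ?_⟩
  ext
  · rfl
  · exact hk.symm

theorem next_nb (R : RotationSystem G) (v : V) (k : ZMod 3) :
    R.next ⟨(v, S.nb v k), S.nb_adj v k⟩ =
      ⟨(v, S.nb v (k + step (S.bit R v))), S.nb_adj v _⟩ := by
  have := S.rot_nb R v k
  unfold RotationSystem.next
  ext
  · rfl
  · exact congrArg Subtype.val this

/-- The corner between consecutive darts lies in one planar face, whichever way the rotation turns;
reversing it exchanges the two sides, which `sideFace` accounts for by comparing with the bit. -/
theorem sideFace_corner (R : RotationSystem G) (d : G.Dart) :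
    S.sideFace (S.bit R) (d, 0) = S.sideFace (S.bit R) (R.next d, 1) := by
  obtain ⟨k, hk⟩ := S.exists_dart_nb d
  generalize d.fst = v at hk
  subst hk
  rw [next_nb]
  simp only [sideFace]
  rcases step_cases (S.bit R v) with ⟨h1, h2⟩ | ⟨h1, h2⟩
  · rw [h2, h1, if_pos rfl, if_neg one_ne_zero, S.left_next]
  · rw [h2, h1, if_neg zero_ne_one, if_pos rfl, ← S.left_next]
    congr 3
    -- `2 + 1` is `0` in `ZMod 3`.
    rw [add_assoc]
    exact (add_zero k).symm

/-- The function on flags given by a vertex function and a face function. -/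
def flagFun (r : V → ZMod 2) (p : (V → ZMod 2) × (J → ZMod 2)) (d : G.Dart × ZMod 2) : ZMod 2 :=
  p.1 d.1.fst + val p.2 (S.sideFace r d)

/-- If the bits at the ends and the twist sum to 0, a side of the edge stays in one planar face, so
`g` must agree at the ends. Otherwise it crosses to the opposite face and `g` must make up the
difference. The condition is the same for both sides `s`. -/
theorem flagFun_side_iff [Fintype J] (R : TRotationSystem G T) (p : (V → ZMod 2) × (J → ZMod 2)) (d : G.Dart) (s : ZMod 2) :
    S.flagFun (S.bit R.1) p (d, s) =
      S.flagFun (S.bit R.1) p (d.symm, s + 1 + R.1.twist ⟨d.edge, d.edge_mem⟩) ↔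
    p.1 d.fst + p.1 d.snd = S.jump (S.bit R.1) (S.chordTwist R.1) p.2 d.fst d.snd := by
  obtain ⟨⟨a, b⟩, h⟩ := d
  have h1 : R.1.twist ⟨(⟨(a, b), h⟩ : G.Dart).edge, SimpleGraph.Dart.edge_mem _⟩ =
    S.twistOf (S.chordTwist R.1) a b := S.twist_eq R h
  rw [h1]
  change p.1 a + val p.2 (if s = S.bit R.1 a then S.left a b else S.left b a) =
      p.1 b + val p.2 (if s + 1 + S.twistOf (S.chordTwist R.1) a b = S.bit R.1 b
        then S.left b a else S.left a b) ↔
    p.1 a + p.1 b = (S.bit R.1 a + S.bit R.1 b + S.twistOf (S.chordTwist R.1) a b) *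
      (val p.2 (S.left a b) + val p.2 (S.left b a))
  have key : ∀ x1 x2 x3 x4 x5 x6 x7 s : ZMod 2,
      (x1 + (if s = x3 then x6 else x7) = x2 + (if s + 1 + x5 = x4 then x7 else x6)) ↔
        x1 + x2 = (x3 + x4 + x5) * (x6 + x7) := by decide
  rw [apply_ite (val p.2), apply_ite (val p.2)]
  exact key _ _ _ _ _ _ _ _

end PlaneScheme

namespace PlaneScheme

variable {V J : Type} {G T : SimpleGraph V}

theorem flagFun_faceStep [Fintype J] (S : PlaneScheme G T J) (R : TRotationSystem G T)
    (p : S.Solution (S.bit R.1) (S.chordTwist R.1)) (a b : G.Dart × ZMod 2)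
    (h : R.1.FaceStep a b) : S.flagFun (S.bit R.1) p.1 a = S.flagFun (S.bit R.1) p.1 b := by
  cases h with
  | corner d =>
    unfold flagFun
    rw [S.sideFace_corner]
    rfl
  | side d s => exact (S.flagFun_side_iff R p.1 d s).2 (p.2 _ _ d.adj)

/-- The function on the faces given by a solution. -/
def faceFun [Fintype J] (S : PlaneScheme G T J) (R : TRotationSystem G T)
    (p : S.Solution (S.bit R.1) (S.chordTwist R.1)) : R.1.Face → ZMod 2 :=
  Quot.lift (S.flagFun (S.bit R.1) p.1) (S.flagFun_faceStep R p)

theorem flagFun_add (S : PlaneScheme G T J) (r : V → ZMod 2) (p : (V → ZMod 2) × (J → ZMod 2))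
    (d : G.Dart) : S.flagFun r p (d, 0) + S.flagFun r p (d, 1) =
      val p.2 (S.left d.fst d.snd) + val p.2 (S.left d.snd d.fst) := by
  simp only [flagFun, sideFace, apply_ite (val p.2)]
  have key : ∀ x r y z : ZMod 2,
      x + (if 0 = r then y else z) + (x + (if 1 = r then y else z)) = y + z := by decide
  exact key _ _ _ _

/-- Across chord `e` the function changes by `x e`, because the outer face has value 0; then `g` is
what remains. -/
theorem flagFun_injective (S : PlaneScheme G T J) (r : V → ZMod 2) :
    Function.Injective (S.flagFun r) := by
  rintro ⟨g, x⟩ ⟨g', x'⟩ h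
  have hx : x = x' := by
    funext e
    have h1 := S.flagFun_add r (g, x) ⟨S.chord e, S.chord_adj e⟩
    have h2 := S.flagFun_add r (g', x') ⟨S.chord e, S.chord_adj e⟩
    rw [h, h2] at h1
    simpa [S.left_chord, S.right_chord, val] using h1.symm
  subst hx
  have hg : g = g' := by
    funext v
    exact add_right_cancel (congrFun h (⟨(v, S.nb v 0), S.nb_adj v 0⟩, 0))
  rw [hg]

/-- A function on the vertices, constant along the corners of every vertex, comes from the
vertices. -/
theorem eq_of_next_eq (S : PlaneScheme G T J) (R : RotationSystem G) (u : G.Dart → ZMod 2)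
    (hu : ∀ d, u (R.next d) = u d) (d : G.Dart) :
    u d = u ⟨(d.fst, S.nb d.fst 0), S.nb_adj _ _⟩ := by
  obtain ⟨k, hk⟩ := S.exists_dart_nb d
  generalize d.fst = v at hk ⊢
  subst hk
  have h1 : ∀ k, u ⟨(v, S.nb v (k + step (S.bit R v))), S.nb_adj v _⟩ =
      u ⟨(v, S.nb v k), S.nb_adj v k⟩ := fun k => by rw [← S.next_nb R v k, hu]
  have key : ∀ (b : ZMod 2) (k : ZMod 3),
      k = 0 ∨ k + step b = 0 ∨ k + step b + step b = 0 := by decide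
  rcases key (S.bit R v) k with h | h | h
  · rw [h]
  · rw [← h1 k, h]
  · rw [← h1 k, ← h1 (k + _), h]

/-- The difference of `f` between the two sides of an edge is a cycle, since each corner matches a
side 0 with a side 1. Choosing `x` to match it on the chords and subtracting the boundary of `x`
leaves a cycle of the tree, which is zero. -/
theorem exists_faceValues [Fintype V] (S : PlaneScheme G T J) (R : TRotationSystem G T)
    (f : G.Dart × ZMod 2 → ZMod 2) (hf : ∀ a b, R.1.FaceStep a b → f a = f b) :
    ∃ x : J → ZMod 2, ∀ d : G.Dart, f (d, 0) + f (d, 1) =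
      val x (S.left d.fst d.snd) + val x (S.left d.snd d.fst) := by
  classical
  let c₀ : G.Dart → ZMod 2 := fun d => f (d, 0) + f (d, 1)
  have hc₀ : ∀ d, c₀ d.symm = c₀ d := by
    intro d
    have h0 := hf _ _ (.side d 0)
    have h1 := hf _ _ (.side d 1)
    simp only [c₀, h0, h1]
    generalize R.1.twist _ = τ
    have h01 : ∀ τ : ZMod 2, τ = 0 ∨ τ = 1 := by decide
    have e1 : (0 + 1 + 0 : ZMod 2) = 1 := rfl
    have e2 : (1 + 1 + 0 : ZMod 2) = 0 := rfl
    have e3 : (0 + 1 + 1 : ZMod 2) = 0 := rfl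
    have e4 : (1 + 1 + 1 : ZMod 2) = 1 := rfl
    rcases h01 τ with rfl | rfl
    · rw [e1, e2, add_comm]
    · rw [e3, e4]
  let x : J → ZMod 2 := fun e => c₀ ⟨S.chord e, S.chord_adj e⟩
  let w : V → V → ZMod 2 := fun a b => val x (S.left a b) + val x (S.left b a)
  let c : V → V → ZMod 2 := fun a b => if h : G.Adj a b then c₀ ⟨(a, b), h⟩ + w a b else 0
  refine ⟨x, fun d => ?_⟩
  have hw : ∀ a b, w a b = w b a := fun a b => add_comm _ _
  have hcs : ∀ a b, c a b = c b a := by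
    intro a b
    by_cases h : G.Adj a b
    · simp only [c, h, h.symm, dite_true]
      rw [hw, ← hc₀ ⟨(a, b), h⟩]
      rfl
    · have h' : ¬ G.Adj b a := fun h' => h h'.symm
      simp only [c, h, h', dite_false]
  have hcT : ∀ a b, ¬ T.Adj a b → c a b = 0 := by
    intro a b hT
    by_cases h : G.Adj a b
    · have hch : ∀ e, c (S.chord e).1 (S.chord e).2 = 0 := by
        intro e
        simp only [c, S.chord_adj e, dite_true, w, S.left_chord, S.right_chord, val, Option.elim,
          add_zero]
        exact CharTwo.add_self_eq_zero _
      obtain ⟨e, he | he⟩ := S.exists_chord a b h hT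
      · rw [← hch e, ← he]
      · rw [← hch e, ← he, hcs]
    · simp only [c, h, dite_false]
  have hsum : ∀ a, ∑ b, c a b = 0 := by
    intro a
    have h1 : ∑ b, c a b = ∑ b, (if G.Adj a b then c a b else 0) := by
      refine Finset.sum_congr rfl fun b _ => ?_
      by_cases h : G.Adj a b
      · rw [if_pos h]
      · rw [if_neg h]
        simp only [c, h, dite_false]
    have h2 : ∀ k, c a (S.nb a k) = c₀ ⟨(a, S.nb a k), S.nb_adj a k⟩ + w a (S.nb a k) := by
      intro k
      simp only [c, S.nb_adj a k, dite_true]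
    rw [h1, S.sum_adj a (c a)]
    simp only [h2, Finset.sum_add_distrib, c₀, w]
    -- Corners of the given embedding pair the sides at `a`; for `h4` the corners of the planar one
    -- do.
    have h3 : ∑ k, f (⟨(a, S.nb a k), S.nb_adj a k⟩, 1) =
        ∑ k, f (⟨(a, S.nb a k), S.nb_adj a k⟩, 0) := by
      rw [← Equiv.sum_comp (Equiv.addRight (step (S.bit R.1 a)))
        (fun k => f (⟨(a, S.nb a k), S.nb_adj a k⟩, 1))]
      refine Finset.sum_congr rfl fun k _ => ?_
      rw [hf _ _ (.corner _), S.next_nb]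
      rfl
    have h4 : ∑ k, val x (S.left (S.nb a k) a) = ∑ k, val x (S.left a (S.nb a k)) := by
      rw [← Equiv.sum_comp (Equiv.addRight (1 : ZMod 3)) (fun k => val x (S.left (S.nb a k) a))]
      refine Finset.sum_congr rfl fun k _ => ?_
      rw [Equiv.coe_addRight, S.left_next]
    rw [h3, h4, CharTwo.add_self_eq_zero, CharTwo.add_self_eq_zero, add_zero]
  have h0 := S.tree_cycle_eq_zero c hcs hcT hsum d.fst d.snd
  simp only [c, d.adj, dite_true, w] at h0
  rwa [CharTwo.add_eq_zero] at h0

/-- For surjectivity, subtract the planar face values `x` from the flag function: the rest `u`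
agrees on the two sides of a dart and across corners, so it depends only on the vertex and defines
`g`. -/
theorem faceFun_bijective [Fintype V] [Fintype J] (S : PlaneScheme G T J)
    (R : TRotationSystem G T) : Function.Bijective (S.faceFun R) := by
  constructor
  · intro p p' h
    apply Subtype.ext
    apply S.flagFun_injective (S.bit R.1)
    funext d
    exact congrFun h (Quot.mk _ d)
  · intro F
    let f : G.Dart × ZMod 2 → ZMod 2 := fun d => F (Quot.mk _ d)
    have hf : ∀ a b, R.1.FaceStep a b → f a = f b := fun a b h => congrArg F (Quot.sound h)
    obtain ⟨x, hx⟩ := S.exists_faceValues R f hf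
    let u : G.Dart × ZMod 2 → ZMod 2 := fun d => f d + val x (S.sideFace (S.bit R.1) d)
    have hu01 : ∀ d, u (d, 0) = u (d, 1) := by
      intro d
      have h1 := hx d
      have h2 := S.flagFun_add (S.bit R.1) (0, x) d
      simp only [flagFun, Pi.zero_apply, zero_add] at h2
      rw [← h2] at h1
      have h2 : (2 : ZMod 2) = 0 := rfl
      change f (d, 0) + _ = f (d, 1) + _
      linear_combination h1 + (val x (S.sideFace (S.bit R.1) (d, 0)) - f (d, 1)) * h2
    have hnext : ∀ d, u (R.1.next d, 0) = u (d, 0) := by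
      intro d
      rw [hu01 (R.1.next d)]
      simp only [u]
      rw [← hf _ _ (.corner d), S.sideFace_corner R.1 d]
    let g : V → ZMod 2 := fun v => u (⟨(v, S.nb v 0), S.nb_adj v 0⟩, 0)
    have hu : ∀ d s, u (d, s) = g d.fst := by
      intro d s
      have h01 : ∀ s : ZMod 2, s = 0 ∨ s = 1 := by decide
      have := S.eq_of_next_eq R.1 (fun d => u (d, 0)) hnext d
      rcases h01 s with rfl | rfl
      · exact this
      · rw [← hu01]
        exact this
    have hflag : ∀ d, S.flagFun (S.bit R.1) (g, x) d = f d := by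
      rintro ⟨d, s⟩
      simp only [flagFun, ← hu d s, u]
      rw [add_assoc, CharTwo.add_self_eq_zero, add_zero]
    refine ⟨⟨(g, x), fun a b hG => ?_⟩, ?_⟩
    · refine (S.flagFun_side_iff R (g, x) ⟨(a, b), hG⟩ 0).1 ?_
      rw [hflag, hflag]
      exact hf _ _ (.side _ _)
    · funext q
      induction q using Quot.ind with
      | mk d => exact hflag d

/-! ### The Euler-genus is the rank -/

theorem finite_face [Finite V] (R : RotationSystem G) : Finite R.Face := by
  have : Finite G.Dart := Finite.of_injective (fun d => d.toProd) fun _ _ h => SimpleGraph.Dart.ext _ _ h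
  exact inferInstanceAs (Finite (Quot _))

/-- Counting the `ZMod 2`-valued functions on the faces in two ways gives `2 ^ |F| = 2 * |ker|`. -/
theorem card_face_add_rank [Fintype V] [Fintype J] (S : PlaneScheme G T J) (v₀ : V)
    (R : TRotationSystem G T) :
    Nat.card R.1.Face + (S.overlap (S.bit R.1) (S.chordTwist R.1)).rank = Fintype.card J + 1 := by
  classical
  have := finite_face R.1
  have h1 : Nat.card (R.1.Face → ZMod 2) = 2 ^ Nat.card R.1.Face := by
    rw [Nat.card_fun, Nat.card_zmod]
  rw [← Nat.card_congr (Equiv.ofBijective _ (S.faceFun_bijective R)), S.card_solution v₀] at h1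
  have h2 := card_mulVec_ker_mul_two_pow_rank (S.overlap (S.bit R.1) (S.chordTwist R.1))
  apply Nat.pow_right_injective (le_refl 2)
  simp only [pow_add]
  rw [← h1, ← h2]
  ring

theorem two_mul_card_edgeSet [Fintype V] (S : PlaneScheme G T J) :
    2 * Nat.card G.edgeSet = 3 * Fintype.card V := by
  classical
  have h1 := G.dart_card_eq_twice_card_edges
  have e : V × ZMod 3 ≃ G.Dart := Equiv.ofBijective
    (fun p => ⟨(p.1, S.nb p.1 p.2), S.nb_adj p.1 p.2⟩) (by
      constructor
      · rintro ⟨v, k⟩ ⟨v', k'⟩ h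
        simp only [SimpleGraph.Dart.mk.injEq, Prod.mk.injEq] at h
        obtain ⟨rfl, h⟩ := h
        rw [(S.nb v).injective (Subtype.ext h)]
      · intro d
        obtain ⟨k, hk⟩ := S.exists_dart_nb d
        exact ⟨(d.fst, k), hk.symm⟩)
  rw [← Fintype.card_congr e, Fintype.card_prod, ZMod.card] at h1
  rw [Nat.card_eq_fintype_card, ← SimpleGraph.edgeFinset_card, ← h1, mul_comm]

/-- For a cubic graph, `hJ` is Euler's formula in the plane with `|J| + 1` faces. -/
theorem eulerGenus_eq_rank [Fintype V] [Fintype J] (S : PlaneScheme G T J) (v₀ : V)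
    (hJ : 2 * Fintype.card J = Fintype.card V + 2) (R : TRotationSystem G T) :
    R.1.eulerGenus = (S.overlap (S.bit R.1) (S.chordTwist R.1)).rank := by
  have h1 := S.card_face_add_rank v₀ R
  have h2 := S.two_mul_card_edgeSet
  unfold RotationSystem.eulerGenus
  rw [Nat.card_eq_fintype_card (α := V)]
  omega

/-! ### Overlap matrices are the supported symmetric matrices -/

/-- Two bounded faces are equal or share an edge of the tree. -/
def dualRel (S : PlaneScheme G T J) (e e' : J) : Prop :=
  e = e' ∨ ∃ a b, T.Adj a b ∧ S.left a b = some e ∧ S.left b a = some e'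

theorem overlap_tree [Fintype V] (S : PlaneScheme G T J) (r : V → ZMod 2) (t : J → ZMod 2)
    {a b : V} {e e' : J} (h : T.Adj a b) (hl : S.left a b = some e) (hr : S.left b a = some e') :
    S.overlap r t e e' = r a + r b := by
  classical
  have hne : e ≠ e' := by
    rintro rfl
    exact S.left_ne a b h (hl.trans hr.symm)
  simp only [overlap, Matrix.of_apply]
  rw [if_neg hne, zero_add, Finset.sum_eq_single a, Finset.sum_eq_single b]
  · exact if_pos ⟨h, hl, hr⟩
  · rintro b' - hb
    refine if_neg ?_
    rintro ⟨h1, h2, h3⟩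
    exact hb (S.tree_inj _ _ _ _ h1 h (h2.trans hl.symm) (h3.trans hr.symm)).2
  · simp
  · rintro a' - ha
    refine Finset.sum_eq_zero fun b' _ => if_neg ?_
    rintro ⟨h1, h2, h3⟩
    exact ha (S.tree_inj _ _ _ _ h1 h (h2.trans hl.symm) (h3.trans hr.symm)).1
  · simp

theorem overlap_diag [Fintype V] (S : PlaneScheme G T J) (r : V → ZMod 2) (t : J → ZMod 2)
    (e : J) : S.overlap r t e e = t e := by
  classical
  rw [overlap, Matrix.of_apply, if_pos rfl, Finset.sum_eq_zero, add_zero]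
  intro a _
  refine Finset.sum_eq_zero fun b _ => if_neg ?_
  rintro ⟨h1, h2, h3⟩
  exact S.left_ne a b h1 (h2.trans h3.symm)

theorem overlap_of_not_dualRel [Fintype V] (S : PlaneScheme G T J) (r : V → ZMod 2)
    (t : J → ZMod 2) {e e' : J} (h : ¬ S.dualRel e e') : S.overlap r t e e' = 0 := by
  classical
  simp only [dualRel, not_or, not_exists] at h
  simp only [overlap, Matrix.of_apply]
  rw [if_neg h.1, zero_add]
  exact Finset.sum_eq_zero fun a _ => Finset.sum_eq_zero fun b _ => if_neg (h.2 a b)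

theorem dualRel_symm (S : PlaneScheme G T J) {e e' : J} (h : S.dualRel e e') : S.dualRel e' e := by
  rcases h with h | ⟨a, b, h1, h2, h3⟩
  · exact Or.inl h.symm
  · exact Or.inr ⟨b, a, h1.symm, h3, h2⟩

theorem overlap_mem [Fintype V] (S : PlaneScheme G T J) (r : V → ZMod 2) (t : J → ZMod 2) :
    S.overlap r t ∈ supportedSym S.dualRel := by
  refine ⟨?_, fun e e' h => S.overlap_of_not_dualRel r t h⟩
  ext e e'
  rw [Matrix.transpose_apply]
  by_cases h : S.dualRel e e'
  · rcases h with rfl | ⟨a, b, h1, h2, h3⟩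
    · rfl
    · rw [S.overlap_tree r t h1 h2 h3, S.overlap_tree r t h1.symm h3 h2, add_comm]
  · rw [S.overlap_of_not_dualRel r t h,
      S.overlap_of_not_dualRel r t fun h' => h (S.dualRel_symm h')]

/-- Bits and chord twists amount to one bit and an overlap matrix. -/
def overlapEquiv [Fintype V] (S : PlaneScheme G T J) (v₀ : V) :
    (V → ZMod 2) × (J → ZMod 2) ≃ ZMod 2 × supportedSym S.dualRel :=
  Equiv.ofBijective (fun p => (p.1 v₀, ⟨S.overlap p.1 p.2, S.overlap_mem p.1 p.2⟩)) (by
    constructor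
    · rintro ⟨r, t⟩ ⟨r', t'⟩ h
      simp only [Prod.mk.injEq, Subtype.mk.injEq] at h
      obtain ⟨h0, hM⟩ := h
      have ht : t = t' := by
        funext e
        rw [← S.overlap_diag r t e, hM, overlap_diag]
      have hconst := S.tree_const (fun a => r a + r' a) fun a b h => by
        obtain ⟨e, he⟩ := S.left_tree a b h
        obtain ⟨e', he'⟩ := S.left_tree b a h.symm
        have h1 := S.overlap_tree r t h he he'
        rw [hM, S.overlap_tree r' t' h he he'] at h1
        rw [← CharTwo.add_eq_zero] at h1 ⊢
        rw [← h1]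
        ring
      have hr : r = r' := by
        funext a
        have h1 : r a + r' a = r v₀ + r' v₀ := hconst a v₀
        rwa [h0, CharTwo.add_self_eq_zero, CharTwo.add_eq_zero] at h1
      rw [ht, hr]
    · rintro ⟨c, M, hM⟩
      -- The matrix prescribes `r a + r b` on every tree edge; a potential on the tree realises it,
      -- and a constant adjusts the bit at `v₀`.
      let δ : V → V → ZMod 2 := fun a b =>
        match S.left a b, S.left b a with
        | some e, some e' => M e e'
        | _, _ => 0
      have hδ : ∀ a b, δ a b = δ b a := by
        intro a b
        simp only [δ]
        cases S.left a b <;> cases S.left b a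
        · rfl
        · rfl
        · rfl
        · exact hM.1.apply _ _
      obtain ⟨r, hr⟩ := S.exists_potential δ hδ
      have hr' : ∀ a b, T.Adj a b → (r a + (r v₀ + c)) + (r b + (r v₀ + c)) = δ a b := by
        intro a b h
        rw [← hr a b h, add_add_add_comm, CharTwo.add_self_eq_zero, add_zero]
      refine ⟨(fun a => r a + (r v₀ + c), fun e => M e e), ?_⟩
      refine Prod.ext ?_ (Subtype.ext ?_)
      · change r v₀ + (r v₀ + c) = c
        rw [← add_assoc, CharTwo.add_self_eq_zero, zero_add]
      · ext e e'
        by_cases h : S.dualRel e e'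
        · rcases h with rfl | ⟨a, b, h1, h2, h3⟩
          · exact S.overlap_diag _ _ e
          · refine (S.overlap_tree _ _ h1 h2 h3).trans ?_
            rw [hr' a b h1]
            simp only [δ, h2, h3]
        · exact (S.overlap_of_not_dualRel _ _ h).trans (hM.2 e e' h).symm)

/-- The factor 2 is the bit at `v₀`: reversing the rotation at every vertex leaves the overlap
matrix unchanged. -/
theorem eulerGenusPoly_eq [Fintype V] [Fintype J] (S : PlaneScheme G T J) (v₀ : V)
    (hJ : 2 * Fintype.card J = Fintype.card V + 2) :
    eulerGenusPoly G T = 2 * rankPoly (supportedSym S.dualRel) := by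
  classical
  ext j
  rw [coeff_eulerGenusPoly, embeddingCount]
  have e : {R : TRotationSystem G T // R.1.eulerGenus = (j : ℤ)} ≃
      ZMod 2 × {M | M ∈ supportedSym S.dualRel ∧ M.rank = j} := by
    refine (((S.rotationEquiv.trans (S.overlapEquiv v₀)).subtypeEquiv
      (q := fun p => p.2.1.rank = j) fun R => ?_).trans ?_)
    · rw [S.eulerGenus_eq_rank v₀ hJ R, Nat.cast_inj]
      rfl
    · exact
        { toFun := fun p => (p.1.1, ⟨p.1.2.1, p.1.2.2, p.2⟩)
          invFun := fun p => ⟨(p.1, ⟨p.2.1, p.2.2.1⟩), p.2.2.2⟩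
          left_inv := fun p => rfl
          right_inv := fun p => rfl }
  rw [Nat.card_congr e, Nat.card_prod, Nat.card_zmod, Nat.card_coe_set_eq,
    -- The cut-off includes `j`, so the coefficient is read from the sum even when `j` exceeds the
    -- matrix size.
    ← sum_range_ncard_rank _ (max (Fintype.card J) j) (le_max_left _ _), Finset.mul_sum,
    finsetSum_coeff]
  have h2 : ∀ (n : ℤ) (i : ℕ), (2 * (C n * X ^ i) : ℤ[X]) = C (2 * n) * X ^ i := by
    intro n i
    rw [C_mul, mul_assoc]
    rfl
  simp only [h2, coeff_C_mul_X_pow]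
  rw [Finset.sum_ite_eq, if_pos]
  · push_cast
    rfl
  · simp

end PlaneScheme

/-! ### The planar embedding of the caterpillar-Halin graphs -/

namespace Halin

variable {m₁ m₂ : ℕ}

/-! ### Vertices by position, and adjacency -/

/-- The vertices `u₀, v₁, …, v_ℓ, u_{ℓ+1}` of the spine with its two end leaves. -/
def sp (m₁ m₂ p : ℕ) : HalinVertex m₁ m₂ :=
  if h : 1 ≤ p ∧ p ≤ m₁ + m₂ then Sum.inr ⟨p - 1, by omega⟩
  else Sum.inl ⟨if p = 0 then 0 else m₁ + m₂ + 1, by split_ifs <;> omega⟩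

/-- The leaf `u_p`. -/
def lf (m₁ m₂ p : ℕ) : HalinVertex m₁ m₂ := Sum.inl ⟨min p (m₁ + m₂ + 1), by omega⟩

theorem sp_eq_inr {p : ℕ} (j : Fin (m₁ + m₂)) : sp m₁ m₂ p = Sum.inr j ↔ p = j.val + 1 := by
  have := j.2
  unfold sp
  split_ifs with h
  · simp only [Sum.inr.injEq, Fin.ext_iff]
    omega
  · simp only [false_iff]
    omega

theorem sp_eq_inl {p : ℕ} (hp : p ≤ m₁ + m₂ + 1) (j : Fin (m₁ + m₂ + 2)) :
    sp m₁ m₂ p = Sum.inl j ↔ p = j.val ∧ (p = 0 ∨ p = m₁ + m₂ + 1) := by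
  unfold sp
  split_ifs with h h'
  · simp only [false_iff]
    omega
  · simp only [Sum.inl.injEq, Fin.ext_iff]
    omega
  · simp only [Sum.inl.injEq, Fin.ext_iff]
    omega

theorem lf_eq_inl {p : ℕ} (hp : p ≤ m₁ + m₂ + 1) (j : Fin (m₁ + m₂ + 2)) :
    lf m₁ m₂ p = Sum.inl j ↔ p = j.val := by
  simp only [lf, Sum.inl.injEq, Fin.ext_iff]
  omega

theorem lf_eq_inr {p : ℕ} (j : Fin (m₁ + m₂)) : lf m₁ m₂ p = Sum.inr j ↔ False := by
  simp [lf]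

theorem inr_eq_sp (j : Fin (m₁ + m₂)) : Sum.inr j = sp m₁ m₂ (j.val + 1) :=
  ((sp_eq_inr j).2 rfl).symm

theorem inl_eq_lf (j : Fin (m₁ + m₂ + 2)) : Sum.inl j = lf m₁ m₂ j.val :=
  ((lf_eq_inl (by omega) j).2 rfl).symm

theorem sp_zero : sp m₁ m₂ 0 = lf m₁ m₂ 0 := by
  rw [lf, sp_eq_inl (by omega)]
  simp

theorem sp_last : sp m₁ m₂ (m₁ + m₂ + 1) = lf m₁ m₂ (m₁ + m₂ + 1) := by
  rw [lf, sp_eq_inl (by omega)]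
  simp

theorem tree_adj_inr_inr (i j : Fin (m₁ + m₂)) :
    (halinTree m₁ m₂).Adj (Sum.inr i) (Sum.inr j) ↔ i.val + 1 = j.val ∨ j.val + 1 = i.val := by
  simp only [halinTree, SimpleGraph.fromRel_adj, halinTreeRel, ne_eq, Sum.inr.injEq, Fin.ext_iff]
  omega

theorem tree_adj_inr_inl (i : Fin (m₁ + m₂)) (j : Fin (m₁ + m₂ + 2)) :
    (halinTree m₁ m₂).Adj (Sum.inr i) (Sum.inl j) ↔ j.val = i.val + 1 ∨ (i.val = 0 ∧ j.val = 0) ∨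
      (i.val + 1 = m₁ + m₂ ∧ j.val = m₁ + m₂ + 1) := by
  simp [halinTree, SimpleGraph.fromRel_adj, halinTreeRel]

theorem tree_adj_inl_inl (i j : Fin (m₁ + m₂ + 2)) :
    ¬ (halinTree m₁ m₂).Adj (Sum.inl i) (Sum.inl j) := by
  simp [halinTree, SimpleGraph.fromRel_adj, halinTreeRel]

theorem graph_adj_inr_right (a : HalinVertex m₁ m₂) (j : Fin (m₁ + m₂)) :
    (halinGraph m₁ m₂).Adj a (Sum.inr j) ↔ (halinTree m₁ m₂).Adj a (Sum.inr j) := by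
  rcases a with i | i <;>
    simp [halinGraph, SimpleGraph.sup_adj, SimpleGraph.fromRel_adj, halinCycleRel]

theorem graph_adj_inr_left (a : HalinVertex m₁ m₂) (j : Fin (m₁ + m₂)) :
    (halinGraph m₁ m₂).Adj (Sum.inr j) a ↔ (halinTree m₁ m₂).Adj (Sum.inr j) a := by
  rw [SimpleGraph.adj_comm, graph_adj_inr_right, SimpleGraph.adj_comm]

theorem graph_adj_inl_inl (i j : Fin (m₁ + m₂ + 2)) :
    (halinGraph m₁ m₂).Adj (Sum.inl i) (Sum.inl j) ↔
      ((i.val + 1 = j.val ∧ i.val ≠ m₁) ∨ (i.val = m₁ ∧ j.val = m₁ + m₂ + 1) ∨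
        (i.val = 0 ∧ j.val = m₁ + 1)) ∨
      ((j.val + 1 = i.val ∧ j.val ≠ m₁) ∨ (j.val = m₁ ∧ i.val = m₁ + m₂ + 1) ∨
        (j.val = 0 ∧ i.val = m₁ + 1)) := by
  have h := tree_adj_inl_inl i j
  simp only [halinGraph, SimpleGraph.sup_adj, h, false_or, SimpleGraph.fromRel_adj, halinCycleRel,
    ne_eq, Sum.inl.injEq, Fin.ext_iff]
  omega

theorem tree_adj_sp {p : ℕ} (hm : 1 ≤ m₁) (hp : p ≤ m₁ + m₂) :
    (halinTree m₁ m₂).Adj (sp m₁ m₂ p) (sp m₁ m₂ (p + 1)) := by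
  generalize ha : sp m₁ m₂ p = a
  generalize hb : sp m₁ m₂ (p + 1) = b
  rcases a with i | i <;> rcases b with j | j <;>
    simp only [sp_eq_inr, sp_eq_inl (show p ≤ m₁ + m₂ + 1 by omega),
      sp_eq_inl (show p + 1 ≤ m₁ + m₂ + 1 by omega)] at ha hb
  · omega
  · rw [SimpleGraph.adj_comm, tree_adj_inr_inl]
    omega
  · rw [tree_adj_inr_inl]
    omega
  · rw [tree_adj_inr_inr]
    omega

theorem tree_adj_lf {p : ℕ} (h1 : 1 ≤ p) (hp : p ≤ m₁ + m₂) :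
    (halinTree m₁ m₂).Adj (sp m₁ m₂ p) (lf m₁ m₂ p) := by
  generalize ha : sp m₁ m₂ p = a
  rcases a with i | i
  · rw [sp_eq_inl (by omega)] at ha
    omega
  · rw [sp_eq_inr] at ha
    rw [lf, tree_adj_inr_inl]
    simp
    omega

/-- Induction over the edges of the tree. -/
theorem tree_induction {P : HalinVertex m₁ m₂ → HalinVertex m₁ m₂ → Prop}
    (h1 : ∀ p, p ≤ m₁ + m₂ → P (sp m₁ m₂ p) (sp m₁ m₂ (p + 1)))
    (h2 : ∀ p, p ≤ m₁ + m₂ → P (sp m₁ m₂ (p + 1)) (sp m₁ m₂ p))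
    (h3 : ∀ p, 1 ≤ p → p ≤ m₁ + m₂ → P (sp m₁ m₂ p) (lf m₁ m₂ p))
    (h4 : ∀ p, 1 ≤ p → p ≤ m₁ + m₂ → P (lf m₁ m₂ p) (sp m₁ m₂ p))
    (a b : HalinVertex m₁ m₂) (hab : (halinTree m₁ m₂).Adj a b) : P a b := by
  rcases a with i | i <;> rcases b with j | j
  · exact absurd hab (tree_adj_inl_inl i j)
  · rw [SimpleGraph.adj_comm, tree_adj_inr_inl] at hab
    rw [inr_eq_sp, inl_eq_lf]
    rcases hab with h | ⟨h, h'⟩ | ⟨h, h'⟩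
    · rw [h]
      exact h4 _ (by omega) (by omega)
    · rw [h, h', ← sp_zero]
      exact h1 _ (by omega)
    · rw [h, h', ← sp_last]
      exact h2 _ le_rfl
  · rw [tree_adj_inr_inl] at hab
    rw [inr_eq_sp, inl_eq_lf]
    rcases hab with h | ⟨h, h'⟩ | ⟨h, h'⟩
    · rw [h]
      exact h3 _ (by omega) (by omega)
    · rw [h, h', ← sp_zero]
      exact h2 _ (by omega)
    · rw [h, h', ← sp_last]
      exact h1 _ le_rfl
  · rw [tree_adj_inr_inr] at hab
    rw [inr_eq_sp, inr_eq_sp]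
    rcases hab with h | h
    · rw [← h]
      exact h1 _ (by omega)
    · rw [← h]
      exact h2 _ (by omega)

/-! ### Planar faces beside each dart -/

/-- The face above the edge of the spine at position `p`. -/
def top (m₁ m₂ p : ℕ) : Option (Fin (m₁ + 1) ⊕ Fin (m₂ + 1)) :=
  some (Sum.inl ⟨min p m₁, by omega⟩)

/-- The face below the edge of the spine at position `p`. -/
def bot (m₁ m₂ p : ℕ) : Option (Fin (m₁ + 1) ⊕ Fin (m₂ + 1)) :=
  some (Sum.inr ⟨min (p - m₁) m₂, by omega⟩)

theorem top_eq_top {p q : ℕ} : top m₁ m₂ p = top m₁ m₂ q ↔ min p m₁ = min q m₁ := by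
  simp [top]

theorem bot_eq_bot {p q : ℕ} : bot m₁ m₂ p = bot m₁ m₂ q ↔ min (p - m₁) m₂ = min (q - m₁) m₂ := by
  simp [bot]

theorem top_eq_bot {p q : ℕ} : top m₁ m₂ p = bot m₁ m₂ q ↔ False := by
  simp [top, bot]

theorem bot_eq_top {p q : ℕ} : bot m₁ m₂ p = top m₁ m₂ q ↔ False := by
  simp [top, bot]

/-- The face to the left of a dart. -/
def left (m₁ m₂ : ℕ) : HalinVertex m₁ m₂ → HalinVertex m₁ m₂ → Option (Fin (m₁ + 1) ⊕ Fin (m₂ + 1))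
  | Sum.inr i, Sum.inr j => if i.val + 1 = j.val then top m₁ m₂ (i.val + 1) else bot m₁ m₂ (j.val + 1)
  | Sum.inr i, Sum.inl j =>
    if j.val = i.val + 1 then if j.val ≤ m₁ then top m₁ m₂ i.val else bot m₁ m₂ (i.val + 1)
    else if j.val = 0 then bot m₁ m₂ 0 else top m₁ m₂ (m₁ + m₂)
  | Sum.inl j, Sum.inr i =>
    if j.val = i.val + 1 then if j.val ≤ m₁ then top m₁ m₂ (i.val + 1) else bot m₁ m₂ i.val
    else if j.val = 0 then top m₁ m₂ 0 else bot m₁ m₂ (m₁ + m₂)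
  | Sum.inl i, Sum.inl j =>
    if (i.val = j.val + 1 ∧ j.val < m₁) ∨ (i.val = m₁ + m₂ + 1 ∧ j.val = m₁) then top m₁ m₂ j.val
    else if i.val = 0 ∧ j.val = m₁ + 1 then bot m₁ m₂ 0
    else if m₁ < i.val ∧ j.val = i.val + 1 then bot m₁ m₂ i.val else none

theorem left_sp_sp_succ {p : ℕ} (hm : 1 ≤ m₁) (hp : p ≤ m₁ + m₂) :
    left m₁ m₂ (sp m₁ m₂ p) (sp m₁ m₂ (p + 1)) = top m₁ m₂ p := by
  generalize ha : sp m₁ m₂ p = a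
  generalize hb : sp m₁ m₂ (p + 1) = b
  rcases a with i | i <;> rcases b with j | j <;>
    simp only [sp_eq_inr, sp_eq_inl (show p ≤ m₁ + m₂ + 1 by omega),
      sp_eq_inl (show p + 1 ≤ m₁ + m₂ + 1 by omega)] at ha hb <;> simp only [left]
  · omega
  · split_ifs <;> first | omega | (congr 1; omega)
  · split_ifs <;> first | omega | (congr 1; omega)
  · split_ifs <;> first | omega | (congr 1; omega)

theorem left_sp_succ_sp {p : ℕ} (hm : 1 ≤ m₁) (hp : p ≤ m₁ + m₂) :
    left m₁ m₂ (sp m₁ m₂ (p + 1)) (sp m₁ m₂ p) = bot m₁ m₂ p := by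
  generalize ha : sp m₁ m₂ p = a
  generalize hb : sp m₁ m₂ (p + 1) = b
  rcases a with i | i <;> rcases b with j | j <;>
    simp only [sp_eq_inr, sp_eq_inl (show p ≤ m₁ + m₂ + 1 by omega),
      sp_eq_inl (show p + 1 ≤ m₁ + m₂ + 1 by omega)] at ha hb <;> simp only [left]
  · omega
  · split_ifs <;> first | omega | (congr 1; omega)
  · split_ifs <;> first | omega | (congr 1; omega)
  · split_ifs <;> first | omega | (congr 1; omega)

theorem left_sp_lf {p : ℕ} (h1 : 1 ≤ p) (hp : p ≤ m₁ + m₂) :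
    left m₁ m₂ (sp m₁ m₂ p) (lf m₁ m₂ p) =
      if p ≤ m₁ then top m₁ m₂ (p - 1) else bot m₁ m₂ p := by
  obtain ⟨i, hi⟩ : ∃ i, sp m₁ m₂ p = Sum.inr i := ⟨⟨p - 1, by omega⟩, by
    rw [sp_eq_inr]
    change p = p - 1 + 1
    omega⟩
  rw [hi]
  rw [sp_eq_inr] at hi
  subst hi
  simp only [left, lf, show min (i.val + 1) (m₁ + m₂ + 1) = i.val + 1 by omega, if_true,
    Nat.add_sub_cancel]

theorem left_lf_sp {p : ℕ} (h1 : 1 ≤ p) (hp : p ≤ m₁ + m₂) :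
    left m₁ m₂ (lf m₁ m₂ p) (sp m₁ m₂ p) =
      if p ≤ m₁ then top m₁ m₂ p else bot m₁ m₂ (p - 1) := by
  obtain ⟨i, hi⟩ : ∃ i, sp m₁ m₂ p = Sum.inr i := ⟨⟨p - 1, by omega⟩, by
    rw [sp_eq_inr]
    change p = p - 1 + 1
    omega⟩
  rw [hi]
  rw [sp_eq_inr] at hi
  subst hi
  simp only [left, lf, show min (i.val + 1) (m₁ + m₂ + 1) = i.val + 1 by omega, if_true,
    Nat.add_sub_cancel]

theorem left_lf_lf {p q : ℕ} (hp : p ≤ m₁ + m₂ + 1) (hq : q ≤ m₁ + m₂ + 1) :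
    left m₁ m₂ (lf m₁ m₂ p) (lf m₁ m₂ q) =
      if (p = q + 1 ∧ q < m₁) ∨ (p = m₁ + m₂ + 1 ∧ q = m₁) then top m₁ m₂ q
      else if p = 0 ∧ q = m₁ + 1 then bot m₁ m₂ 0
      else if m₁ < p ∧ q = p + 1 then bot m₁ m₂ p else none := by
  simp only [left, lf, min_eq_left hp, min_eq_left hq]

section LeftLeaf

variable {p : ℕ}

theorem left_top_backward (hp : p < m₁) :
    left m₁ m₂ (lf m₁ m₂ (p + 1)) (lf m₁ m₂ p) = top m₁ m₂ p := by
  rw [left_lf_lf (by omega) (by omega), if_pos (by omega)]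

theorem left_top_forward (hp : p < m₁) :
    left m₁ m₂ (lf m₁ m₂ p) (lf m₁ m₂ (p + 1)) = none := by
  rw [left_lf_lf (by omega) (by omega), if_neg (by omega), if_neg (by omega), if_neg (by omega)]

theorem left_last_top :
    left m₁ m₂ (lf m₁ m₂ (m₁ + m₂ + 1)) (lf m₁ m₂ m₁) = top m₁ m₂ m₁ := by
  rw [left_lf_lf (by omega) (by omega), if_pos (by omega)]

theorem left_top_last (hm : 1 ≤ m₁) :
    left m₁ m₂ (lf m₁ m₂ m₁) (lf m₁ m₂ (m₁ + m₂ + 1)) = none := by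
  rw [left_lf_lf (by omega) (by omega), if_neg (by omega), if_neg (by omega), if_neg (by omega)]

theorem left_zero_bot (hm : 1 ≤ m₁) :
    left m₁ m₂ (lf m₁ m₂ 0) (lf m₁ m₂ (m₁ + 1)) = bot m₁ m₂ 0 := by
  rw [left_lf_lf (by omega) (by omega), if_neg (by omega), if_pos (by omega)]

theorem left_bot_zero (hm : 1 ≤ m₁) :
    left m₁ m₂ (lf m₁ m₂ (m₁ + 1)) (lf m₁ m₂ 0) = none := by
  rw [left_lf_lf (by omega) (by omega), if_neg (by omega), if_neg (by omega), if_neg (by omega)]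

theorem left_bot_forward (h1 : m₁ < p) (h2 : p ≤ m₁ + m₂) :
    left m₁ m₂ (lf m₁ m₂ p) (lf m₁ m₂ (p + 1)) = bot m₁ m₂ p := by
  rw [left_lf_lf (by omega) (by omega), if_neg (by omega), if_neg (by omega), if_pos (by omega)]

theorem left_bot_backward (h1 : m₁ < p) (h2 : p ≤ m₁ + m₂) :
    left m₁ m₂ (lf m₁ m₂ (p + 1)) (lf m₁ m₂ p) = none := by
  rw [left_lf_lf (by omega) (by omega), if_neg (by omega), if_neg (by omega), if_neg (by omega)]

end LeftLeaf

/-! ### The planar rotation -/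

/-- The first cycle neighbour of the leaf `u_p`, in the cyclic order after the tree neighbour. -/
def cyc₁ (m₁ m₂ p : ℕ) : ℕ :=
  if p = 0 then 1
  else if p = m₁ + m₂ + 1 then if m₂ = 0 then 0 else m₁ + m₂
  else if p ≤ m₁ then if p = m₁ then m₁ + m₂ + 1 else p + 1
  else if p = m₁ + 1 then 0 else p - 1

/-- The second cycle neighbour of the leaf `u_p`, in the cyclic order after the tree neighbour. -/
def cyc₂ (m₁ m₂ p : ℕ) : ℕ :=
  if p = 0 then m₁ + 1 else if p = m₁ + m₂ + 1 then m₁ else if p ≤ m₁ then p - 1 else p + 1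

/-- The position of the tree neighbour of the leaf `u_p`. -/
def treePos (m₁ m₂ p : ℕ) : ℕ :=
  if p = 0 then 1 else if p = m₁ + m₂ + 1 then m₁ + m₂ else p

/-- The neighbours of a vertex in their planar cyclic order. -/
def nb (m₁ m₂ : ℕ) : HalinVertex m₁ m₂ → ZMod 3 → HalinVertex m₁ m₂
  | Sum.inl i => ![sp m₁ m₂ (treePos m₁ m₂ i.val), lf m₁ m₂ (cyc₁ m₁ m₂ i.val),
      lf m₁ m₂ (cyc₂ m₁ m₂ i.val)]
  | Sum.inr i =>
    if i.val + 1 ≤ m₁ then ![sp m₁ m₂ (i.val + 2), lf m₁ m₂ (i.val + 1), sp m₁ m₂ i.val]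
    else ![sp m₁ m₂ (i.val + 2), sp m₁ m₂ i.val, lf m₁ m₂ (i.val + 1)]

theorem nb_inr_top {i : Fin (m₁ + m₂)} (h : i.val + 1 ≤ m₁) : nb m₁ m₂ (Sum.inr i) =
    ![sp m₁ m₂ (i.val + 2), lf m₁ m₂ (i.val + 1), sp m₁ m₂ i.val] := if_pos h

theorem nb_inr_bot {i : Fin (m₁ + m₂)} (h : ¬ i.val + 1 ≤ m₁) : nb m₁ m₂ (Sum.inr i) =
    ![sp m₁ m₂ (i.val + 2), sp m₁ m₂ i.val, lf m₁ m₂ (i.val + 1)] := if_neg h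

theorem exists_zmod_three (P : ZMod 3 → Prop) : (∃ k, P k) ↔ P 0 ∨ P 1 ∨ P 2 :=
  Fin.exists_fin_succ.trans (or_congr_right (Fin.exists_fin_succ.trans
    (or_congr_right (Fin.exists_fin_one))))

theorem forall_zmod_three (P : ZMod 3 → Prop) : (∀ k, P k) ↔ P 0 ∧ P 1 ∧ P 2 :=
  Fin.forall_fin_succ.trans (and_congr_right fun _ => (Fin.forall_fin_succ.trans
    (and_congr_right fun _ => Fin.forall_fin_one)))

theorem cyc₁_le (hm : 1 ≤ m₁) {p : ℕ} (hp : p ≤ m₁ + m₂ + 1) : cyc₁ m₁ m₂ p ≤ m₁ + m₂ + 1 := by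
  unfold cyc₁
  split_ifs <;> omega

theorem cyc₂_le {p : ℕ} (hp : p ≤ m₁ + m₂ + 1) : cyc₂ m₁ m₂ p ≤ m₁ + m₂ + 1 := by
  unfold cyc₂
  split_ifs <;> omega

theorem treePos_le {p : ℕ} (hm : 1 ≤ m₁) (hp : p ≤ m₁ + m₂ + 1) :
    1 ≤ treePos m₁ m₂ p ∧ treePos m₁ m₂ p ≤ m₁ + m₂ := by
  unfold treePos
  split_ifs <;> omega

theorem adj_iff_exists_nb (hm : 1 ≤ m₁) (a b : HalinVertex m₁ m₂) :
    (halinGraph m₁ m₂).Adj a b ↔ ∃ k, nb m₁ m₂ a k = b := by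
  rw [exists_zmod_three]
  rcases a with i | i
  · have hi : i.val ≤ m₁ + m₂ + 1 := by omega
    have h1 := cyc₁_le hm hi
    have h2 := cyc₂_le hi
    have h3 := treePos_le hm hi
    change _ ↔ sp m₁ m₂ (treePos m₁ m₂ i.val) = b ∨ lf m₁ m₂ (cyc₁ m₁ m₂ i.val) = b ∨
      lf m₁ m₂ (cyc₂ m₁ m₂ i.val) = b
    rcases b with j | j
    · have hj : j.val ≤ m₁ + m₂ + 1 := by omega
      rw [graph_adj_inl_inl, sp_eq_inl (by omega), lf_eq_inl h1, lf_eq_inl h2]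
      clear h1 h2
      unfold cyc₁ cyc₂
      split_ifs <;> omega
    · rw [graph_adj_inr_right, SimpleGraph.adj_comm, tree_adj_inr_inl, sp_eq_inr, lf_eq_inr,
        lf_eq_inr, or_false, or_false]
      clear h3
      unfold treePos
      split_ifs <;> omega
  · have hi := i.2
    rw [graph_adj_inr_left]
    have key : (nb m₁ m₂ (Sum.inr i) 0 = b ∨ nb m₁ m₂ (Sum.inr i) 1 = b ∨
        nb m₁ m₂ (Sum.inr i) 2 = b) ↔
        (sp m₁ m₂ (i.val + 2) = b ∨ lf m₁ m₂ (i.val + 1) = b ∨ sp m₁ m₂ i.val = b) := by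
      by_cases h : i.val + 1 ≤ m₁
      · rw [nb_inr_top h]
        exact Iff.rfl
      · rw [nb_inr_bot h]
        exact or_congr_right or_comm
    rw [key]
    rcases b with j | j
    · rw [tree_adj_inr_inl, sp_eq_inl (by omega), sp_eq_inl (by omega), lf_eq_inl (by omega)]
      omega
    · rw [tree_adj_inr_inr, sp_eq_inr, sp_eq_inr, lf_eq_inr, false_or]
      omega

theorem sp_injective {p q : ℕ} (hp : p ≤ m₁ + m₂ + 1) (hq : q ≤ m₁ + m₂ + 1)
    (h : sp m₁ m₂ p = sp m₁ m₂ q) : p = q := by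
  generalize ha : sp m₁ m₂ q = a at h
  rcases a with i | i
  · rw [sp_eq_inl (by omega)] at h ha
    omega
  · rw [sp_eq_inr] at h ha
    omega

theorem sp_ne_lf {p q : ℕ} (h1 : 1 ≤ q) (hp : p ≤ m₁ + m₂ + 1) (hq : q ≤ m₁ + m₂) :
    sp m₁ m₂ p ≠ lf m₁ m₂ q := by
  intro h
  rw [lf, sp_eq_inl hp] at h
  simp only at h
  omega

theorem sp_ne_lf_of_pos {p q : ℕ} (h1 : 1 ≤ p) (hp : p ≤ m₁ + m₂) : sp m₁ m₂ p ≠ lf m₁ m₂ q := by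
  intro h
  rw [lf, sp_eq_inl (by omega)] at h
  omega

theorem nb_injective (hm : 1 ≤ m₁) (a : HalinVertex m₁ m₂) : Function.Injective (nb m₁ m₂ a) := by
  have key : ∀ f : ZMod 3 → HalinVertex m₁ m₂, f 0 ≠ f 1 → f 0 ≠ f 2 → f 1 ≠ f 2 →
      Function.Injective f := by
    intro f h01 h02 h12 i j h
    revert i j
    simp only [forall_zmod_three, h01, h02, h12, h01.symm, h02.symm, h12.symm, false_imp_iff,
      and_true, imp_self]
  rcases a with i | i
  · have hi : i.val ≤ m₁ + m₂ + 1 := by omega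
    have h1 := cyc₁_le hm hi
    have h2 := cyc₂_le hi
    have h3 := treePos_le hm hi
    refine key _ (sp_ne_lf_of_pos h3.1 h3.2) (sp_ne_lf_of_pos h3.1 h3.2) ?_
    change lf m₁ m₂ (cyc₁ m₁ m₂ i.val) ≠ lf m₁ m₂ (cyc₂ m₁ m₂ i.val)
    intro h
    have h4 := congrArg (Sum.elim Fin.val Fin.val) h
    simp only [lf, Sum.elim_inl, min_eq_left h1, min_eq_left h2] at h4
    clear h1 h2
    unfold cyc₁ cyc₂ at h4
    split_ifs at h4 <;> omega
  · have hi := i.2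
    have h1 : sp m₁ m₂ (i.val + 2) ≠ sp m₁ m₂ i.val := fun h => by
      have := sp_injective (by omega) (by omega) h
      omega
    have h2 := sp_ne_lf (m₁ := m₁) (m₂ := m₂) (p := i.val + 2) (q := i.val + 1) (by omega) (by omega)
      (by omega)
    have h3 := sp_ne_lf (m₁ := m₁) (m₂ := m₂) (p := i.val) (q := i.val + 1) (by omega) (by omega)
      (by omega)
    by_cases h : i.val + 1 ≤ m₁
    · rw [nb_inr_top h]
      exact key _ h2 h1 h3.symm
    · rw [nb_inr_bot h]
      exact key _ h1 h2 h3

theorem left_nb_succ (hm : 1 ≤ m₁) (a : HalinVertex m₁ m₂) (k : ZMod 3) :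
    left m₁ m₂ (nb m₁ m₂ a (k + 1)) a = left m₁ m₂ a (nb m₁ m₂ a k) := by
  revert k
  rw [forall_zmod_three]
  change left m₁ m₂ (nb m₁ m₂ a 1) a = _ ∧ left m₁ m₂ (nb m₁ m₂ a 2) a = _ ∧
    left m₁ m₂ (nb m₁ m₂ a 0) a = _
  rcases a with i | i
  · have hi : i.val ≤ m₁ + m₂ + 1 := by omega
    have h1 := cyc₁_le hm hi
    have h2 := cyc₂_le hi
    change left m₁ m₂ (lf m₁ m₂ (cyc₁ m₁ m₂ i.val)) _ =
        left m₁ m₂ _ (sp m₁ m₂ (treePos m₁ m₂ i.val)) ∧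
      left m₁ m₂ (lf m₁ m₂ (cyc₂ m₁ m₂ i.val)) _ =
        left m₁ m₂ _ (lf m₁ m₂ (cyc₁ m₁ m₂ i.val)) ∧
      left m₁ m₂ (sp m₁ m₂ (treePos m₁ m₂ i.val)) _ =
        left m₁ m₂ _ (lf m₁ m₂ (cyc₂ m₁ m₂ i.val))
    rw [inl_eq_lf]
    generalize i.val = p at *
    clear h1 h2
    by_cases hp0 : p = 0
    · subst hp0
      have e1 : treePos m₁ m₂ 0 = 0 + 1 := rfl
      have e2 : cyc₁ m₁ m₂ 0 = 0 + 1 := rfl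
      have e3 : cyc₂ m₁ m₂ 0 = m₁ + 1 := rfl
      rw [e1, e2, e3, left_top_backward (by omega), left_top_forward (by omega), left_zero_bot hm,
        left_bot_zero hm, ← sp_zero, left_sp_sp_succ hm (Nat.zero_le _),
        left_sp_succ_sp hm (Nat.zero_le _)]
      exact ⟨rfl, rfl, rfl⟩
    · by_cases hpl : p = m₁ + m₂ + 1
      · subst hpl
        have e1 : treePos m₁ m₂ (m₁ + m₂ + 1) = m₁ + m₂ := by simp [treePos]
        have e3 : cyc₂ m₁ m₂ (m₁ + m₂ + 1) = m₁ := by simp [cyc₂]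
        rw [e1, e3, left_last_top, left_top_last hm]
        have r1 := left_sp_sp_succ (m₁ := m₁) (m₂ := m₂) hm le_rfl
        have r2 := left_sp_succ_sp (m₁ := m₁) (m₂ := m₂) hm le_rfl
        rw [sp_last] at r1 r2
        rw [r1, r2]
        -- Without lower leaves the cycle joins `u_{ℓ+1}` directly to `u₀`.
        by_cases h2 : m₂ = 0
        · subst h2
          have e2 : cyc₁ m₁ 0 (m₁ + 0 + 1) = 0 := by simp [cyc₁]
          rw [e2]
          refine ⟨(left_zero_bot hm).trans ?_, (left_bot_zero hm).symm, ?_⟩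
          · rw [bot_eq_bot]
            omega
          · rw [top_eq_top]
            omega
        · have e2 : cyc₁ m₁ m₂ (m₁ + m₂ + 1) = m₁ + m₂ := by simp [cyc₁, h2]
          rw [e2]
          refine ⟨left_bot_forward (by omega) le_rfl, (left_bot_backward (by omega) le_rfl).symm, ?_⟩
          rw [top_eq_top]
          omega
      · have e1 : treePos m₁ m₂ p = p := by simp [treePos, hp0, hpl]
        rw [e1, left_sp_lf (by omega) (by omega), left_lf_sp (by omega) (by omega)]
        by_cases hpm : p ≤ m₁
        · have e3 : cyc₂ m₁ m₂ p = p - 1 := by simp [cyc₂, hp0, hpl, hpm]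
          obtain ⟨q, rfl⟩ : ∃ q, p = q + 1 := ⟨p - 1, by omega⟩
          rw [if_pos hpm, if_pos hpm, e3, Nat.add_sub_cancel, left_top_backward (by omega),
            left_top_forward (by omega)]
          by_cases hq : q + 1 = m₁
          · have e2 : cyc₁ m₁ m₂ (q + 1) = m₁ + m₂ + 1 := by
              rw [cyc₁, if_neg hp0, if_neg hpl, if_pos hpm, if_pos hq]
            rw [e2, hq]
            exact ⟨left_last_top, (left_top_last hm).symm, rfl⟩
          · have e2 : cyc₁ m₁ m₂ (q + 1) = q + 1 + 1 := by
              rw [cyc₁, if_neg hp0, if_neg hpl, if_pos hpm, if_neg hq]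
            rw [e2]
            exact ⟨left_top_backward (by omega), (left_top_forward (by omega)).symm, rfl⟩
        · have e3 : cyc₂ m₁ m₂ p = p + 1 := by simp [cyc₂, hp0, hpl, hpm]
          rw [if_neg hpm, if_neg hpm, e3, left_bot_backward (by omega) (by omega),
            left_bot_forward (by omega) (by omega)]
          by_cases hq : p = m₁ + 1
          · subst hq
            have e2 : cyc₁ m₁ m₂ (m₁ + 1) = 0 := by
              rw [cyc₁, if_neg hp0, if_neg hpl, if_neg hpm, if_pos rfl]
            rw [e2]
            refine ⟨(left_zero_bot hm).trans ?_, (left_bot_zero hm).symm, rfl⟩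
            rw [bot_eq_bot]
            omega
          · obtain ⟨q, rfl⟩ : ∃ q, p = q + 1 := ⟨p - 1, by omega⟩
            have e2 : cyc₁ m₁ m₂ (q + 1) = q := by
              rw [cyc₁, if_neg hp0, if_neg hpl, if_neg hpm, if_neg hq, Nat.add_sub_cancel]
            rw [e2]
            exact ⟨left_bot_forward (by omega) (by omega),
              (left_bot_backward (by omega) (by omega)).symm, rfl⟩
  · have hi := i.2
    have r1 := left_sp_sp_succ (m₁ := m₁) (m₂ := m₂) (p := i.val + 1) hm (by omega)
    have r2 := left_sp_succ_sp (m₁ := m₁) (m₂ := m₂) (p := i.val + 1) hm (by omega)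
    have r3 := left_sp_sp_succ (m₁ := m₁) (m₂ := m₂) (p := i.val) hm (by omega)
    have r4 := left_sp_succ_sp (m₁ := m₁) (m₂ := m₂) (p := i.val) hm (by omega)
    have r5 := left_sp_lf (m₁ := m₁) (m₂ := m₂) (p := i.val + 1) (by omega) (by omega)
    have r6 := left_lf_sp (m₁ := m₁) (m₂ := m₂) (p := i.val + 1) (by omega) (by omega)
    rw [inr_eq_sp]
    by_cases h : i.val + 1 ≤ m₁
    · have e : nb m₁ m₂ (sp m₁ m₂ (i.val + 1)) =
          ![sp m₁ m₂ (i.val + 2), lf m₁ m₂ (i.val + 1), sp m₁ m₂ i.val] := by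
        rw [← inr_eq_sp]
        exact if_pos h
      rw [if_pos h] at r5 r6
      rw [e]
      refine ⟨r6.trans r1.symm, r3.trans r5.symm, r2.trans (Eq.trans ?_ r4.symm)⟩
      -- Below a spine vertex whose leaf lies above, the lower face does not change; the dual remark
      -- applies to lower leaves.
      rw [bot_eq_bot]
      omega
    · have e : nb m₁ m₂ (sp m₁ m₂ (i.val + 1)) =
          ![sp m₁ m₂ (i.val + 2), sp m₁ m₂ i.val, lf m₁ m₂ (i.val + 1)] := by
        rw [← inr_eq_sp]
        exact if_neg h
      rw [if_neg h] at r5 r6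
      rw [e]
      refine ⟨r3.trans (Eq.trans ?_ r1.symm), r6.trans r4.symm, r2.trans r5.symm⟩
      rw [top_eq_top]
      omega

end Halin

namespace Halin

variable {m₁ m₂ : ℕ}

/-! ### Tree edges and their two faces; potentials -/

theorem left_tree_eq_some (hm : 1 ≤ m₁) (a b : HalinVertex m₁ m₂)
    (h : (halinTree m₁ m₂).Adj a b) : ∃ e, left m₁ m₂ a b = some e := by
  revert a b
  refine tree_induction ?_ ?_ ?_ ?_
  · intro p hp
    exact ⟨_, left_sp_sp_succ hm hp⟩
  · intro p hp
    exact ⟨_, left_sp_succ_sp hm hp⟩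
  · intro p h1 hp
    rw [left_sp_lf h1 hp]
    split_ifs
    · exact ⟨_, rfl⟩
    · exact ⟨_, rfl⟩
  · intro p h1 hp
    rw [left_lf_sp h1 hp]
    split_ifs
    · exact ⟨_, rfl⟩
    · exact ⟨_, rfl⟩

theorem left_tree_ne (hm : 1 ≤ m₁) (a b : HalinVertex m₁ m₂)
    (h : (halinTree m₁ m₂).Adj a b) : left m₁ m₂ a b ≠ left m₁ m₂ b a := by
  revert a b
  refine tree_induction ?_ ?_ ?_ ?_
  · intro p hp
    rw [left_sp_sp_succ hm hp, left_sp_succ_sp hm hp, ne_eq, top_eq_bot]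
    exact id
  · intro p hp
    rw [left_sp_sp_succ hm hp, left_sp_succ_sp hm hp, ne_eq, bot_eq_top]
    exact id
  · intro p h1 hp
    rw [left_sp_lf h1 hp, left_lf_sp h1 hp]
    split_ifs
    · rw [ne_eq, top_eq_top]
      omega
    · rw [ne_eq, bot_eq_bot]
      omega
  · intro p h1 hp
    rw [left_sp_lf h1 hp, left_lf_sp h1 hp]
    split_ifs
    · rw [ne_eq, top_eq_top]
      omega
    · rw [ne_eq, bot_eq_bot]
      omega

/-- A spine edge has an upper and a lower face, whose indices add up to its position; a pendant edge
has two consecutive faces on the same side of the spine, in an order that fixes its direction. -/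
theorem left_tree_injective (hm : 1 ≤ m₁) (a b : HalinVertex m₁ m₂)
    (h : (halinTree m₁ m₂).Adj a b) : ∀ a' b', (halinTree m₁ m₂).Adj a' b' →
      left m₁ m₂ a b = left m₁ m₂ a' b' → left m₁ m₂ b a = left m₁ m₂ b' a' →
        a = a' ∧ b = b' := by
  revert a b
  refine tree_induction ?_ ?_ ?_ ?_
  · intro p hp
    refine tree_induction ?_ ?_ ?_ ?_
    · intro q hq
      rw [left_sp_sp_succ hm hp, left_sp_succ_sp hm hp, left_sp_sp_succ hm hq,
        left_sp_succ_sp hm hq, top_eq_top, bot_eq_bot]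
      intro h1 h2
      obtain rfl : p = q := by omega
      exact ⟨rfl, rfl⟩
    · intro q hq
      rw [left_sp_sp_succ hm hp, left_sp_succ_sp hm hq, top_eq_bot]
      exact False.elim
    · intro q hq1 hq
      rw [left_sp_sp_succ hm hp, left_sp_succ_sp hm hp, left_sp_lf hq1 hq, left_lf_sp hq1 hq]
      split_ifs
      · rw [bot_eq_top]
        exact fun _ => False.elim
      · rw [top_eq_bot]
        exact False.elim
    · intro q hq1 hq
      rw [left_sp_sp_succ hm hp, left_sp_succ_sp hm hp, left_sp_lf hq1 hq, left_lf_sp hq1 hq]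
      split_ifs
      · rw [bot_eq_top]
        exact fun _ => False.elim
      · rw [top_eq_bot]
        exact False.elim
  · intro p hp
    refine tree_induction ?_ ?_ ?_ ?_
    · intro q hq
      rw [left_sp_succ_sp hm hp, left_sp_sp_succ hm hq, bot_eq_top]
      exact False.elim
    · intro q hq
      rw [left_sp_sp_succ hm hp, left_sp_succ_sp hm hp, left_sp_sp_succ hm hq,
        left_sp_succ_sp hm hq, top_eq_top, bot_eq_bot]
      intro h1 h2
      obtain rfl : p = q := by omega
      exact ⟨rfl, rfl⟩
    · intro q hq1 hq
      rw [left_sp_sp_succ hm hp, left_sp_succ_sp hm hp, left_sp_lf hq1 hq, left_lf_sp hq1 hq]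
      split_ifs
      · rw [bot_eq_top]
        exact False.elim
      · rw [top_eq_bot]
        exact fun _ => False.elim
    · intro q hq1 hq
      rw [left_sp_sp_succ hm hp, left_sp_succ_sp hm hp, left_sp_lf hq1 hq, left_lf_sp hq1 hq]
      split_ifs
      · rw [bot_eq_top]
        exact False.elim
      · rw [top_eq_bot]
        exact fun _ => False.elim
  · intro p hp1 hp
    refine tree_induction ?_ ?_ ?_ ?_
    · intro q hq
      rw [left_sp_sp_succ hm hq, left_sp_succ_sp hm hq, left_sp_lf hp1 hp, left_lf_sp hp1 hp]
      split_ifs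
      · rw [top_eq_bot]
        exact fun _ => False.elim
      · rw [bot_eq_top]
        exact False.elim
    · intro q hq
      rw [left_sp_sp_succ hm hq, left_sp_succ_sp hm hq, left_sp_lf hp1 hp, left_lf_sp hp1 hp]
      split_ifs
      · rw [top_eq_bot]
        exact False.elim
      · rw [bot_eq_top]
        exact fun _ => False.elim
    · intro q hq1 hq
      rw [left_sp_lf hp1 hp, left_lf_sp hp1 hp, left_sp_lf hq1 hq, left_lf_sp hq1 hq]
      suffices h : _ → _ → p = q from fun h1 h2 => by
        obtain rfl := h h1 h2
        exact ⟨rfl, rfl⟩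
      split_ifs <;> simp only [top_eq_top, bot_eq_bot, top_eq_bot, bot_eq_top, false_imp_iff] <;>
        omega
    · intro q hq1 hq
      rw [left_sp_lf hp1 hp, left_lf_sp hp1 hp, left_sp_lf hq1 hq, left_lf_sp hq1 hq]
      intro h1 h2
      exfalso
      revert h1 h2
      split_ifs <;> simp only [top_eq_top, bot_eq_bot, top_eq_bot, bot_eq_top, false_imp_iff] <;>
        omega
  · intro p hp1 hp
    refine tree_induction ?_ ?_ ?_ ?_
    · intro q hq
      rw [left_sp_sp_succ hm hq, left_sp_succ_sp hm hq, left_sp_lf hp1 hp, left_lf_sp hp1 hp]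
      split_ifs
      · rw [top_eq_bot]
        exact fun _ => False.elim
      · rw [bot_eq_top]
        exact False.elim
    · intro q hq
      rw [left_sp_sp_succ hm hq, left_sp_succ_sp hm hq, left_sp_lf hp1 hp, left_lf_sp hp1 hp]
      split_ifs
      · rw [top_eq_bot]
        exact False.elim
      · rw [bot_eq_top]
        exact fun _ => False.elim
    · intro q hq1 hq
      rw [left_sp_lf hp1 hp, left_lf_sp hp1 hp, left_sp_lf hq1 hq, left_lf_sp hq1 hq]
      intro h1 h2
      exfalso
      revert h1 h2
      split_ifs <;> simp only [top_eq_top, bot_eq_bot, top_eq_bot, bot_eq_top, false_imp_iff] <;>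
        omega
    · intro q hq1 hq
      rw [left_sp_lf hp1 hp, left_lf_sp hp1 hp, left_sp_lf hq1 hq, left_lf_sp hq1 hq]
      suffices h : _ → _ → p = q from fun h1 h2 => by
        obtain rfl := h h1 h2
        exact ⟨rfl, rfl⟩
      split_ifs <;> simp only [top_eq_top, bot_eq_bot, top_eq_bot, bot_eq_top, false_imp_iff] <;>
        omega

/-- The sums of `δ` along the spine. -/
def spineSum (δ : HalinVertex m₁ m₂ → HalinVertex m₁ m₂ → ZMod 2) : ℕ → ZMod 2
  | 0 => 0
  | p + 1 => spineSum δ p + δ (sp m₁ m₂ p) (sp m₁ m₂ (p + 1))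

/-- Sum `δ` along the spine from `u₀` and add one further term for each pendant leaf; `u₀` and
`u_{ℓ+1}` count as spine positions. -/
theorem exists_potential (δ : HalinVertex m₁ m₂ → HalinVertex m₁ m₂ → ZMod 2)
    (hδ : ∀ a b, δ a b = δ b a) :
    ∃ g : HalinVertex m₁ m₂ → ZMod 2, ∀ a b, (halinTree m₁ m₂).Adj a b → g a + g b = δ a b := by
  let g : HalinVertex m₁ m₂ → ZMod 2 := Sum.elim
    (fun j => if j.val = 0 ∨ j.val = m₁ + m₂ + 1 then spineSum δ j.val
      else spineSum δ j.val + δ (sp m₁ m₂ j.val) (lf m₁ m₂ j.val))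
    fun i => spineSum δ (i.val + 1)
  have hsp : ∀ p, p ≤ m₁ + m₂ + 1 → g (sp m₁ m₂ p) = spineSum δ p := by
    intro p hp
    generalize ha : sp m₁ m₂ p = a
    rcases a with i | i
    · rw [sp_eq_inl hp] at ha
      obtain ⟨rfl, ha⟩ := ha
      exact if_pos ha
    · rw [sp_eq_inr] at ha
      rw [ha]
      rfl
  have hlf : ∀ p, 1 ≤ p → p ≤ m₁ + m₂ →
      g (lf m₁ m₂ p) = spineSum δ p + δ (sp m₁ m₂ p) (lf m₁ m₂ p) := by
    intro p h1 hp
    have h2 : min p (m₁ + m₂ + 1) = p := by omega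
    simp only [g, lf, Sum.elim_inl, h2]
    rw [if_neg (by omega)]
  have e1 : ∀ p, p ≤ m₁ + m₂ → g (sp m₁ m₂ p) + g (sp m₁ m₂ (p + 1)) =
      δ (sp m₁ m₂ p) (sp m₁ m₂ (p + 1)) := by
    intro p hp
    rw [hsp _ (by omega), hsp _ (by omega), spineSum, ← add_assoc, CharTwo.add_self_eq_zero,
      zero_add]
  have e2 : ∀ p, 1 ≤ p → p ≤ m₁ + m₂ → g (sp m₁ m₂ p) + g (lf m₁ m₂ p) =
      δ (sp m₁ m₂ p) (lf m₁ m₂ p) := by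
    intro p h1 hp
    rw [hsp _ (by omega), hlf p h1 hp, ← add_assoc, CharTwo.add_self_eq_zero, zero_add]
  refine ⟨g, tree_induction e1 (fun p hp => ?_) e2 fun p h1 hp => ?_⟩
  · rw [add_comm, e1 p hp, hδ]
  · rw [add_comm, e2 p h1 hp, hδ]

theorem tree_const (hm : 1 ≤ m₁) (g : HalinVertex m₁ m₂ → ZMod 2)
    (hg : ∀ a b, (halinTree m₁ m₂).Adj a b → g a = g b) (a b : HalinVertex m₁ m₂) : g a = g b := by
  have hsp : ∀ p, p ≤ m₁ + m₂ + 1 → g (sp m₁ m₂ p) = g (sp m₁ m₂ 0) := by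
    intro p
    induction p with
    | zero => exact fun _ => rfl
    | succ p ih => exact fun hp => (hg _ _ (tree_adj_sp hm (by omega))).symm.trans (ih (by omega))
  have hall : ∀ a, g a = g (sp m₁ m₂ 0) := by
    rintro (j | i)
    · rw [inl_eq_lf]
      by_cases h : 1 ≤ j.val ∧ j.val ≤ m₁ + m₂
      · rw [← hg _ _ (tree_adj_lf h.1 h.2)]
        exact hsp _ (by omega)
      · by_cases h0 : j.val = 0
        · rw [h0, sp_zero]
        · have hl : j.val = m₁ + m₂ + 1 := by omega
          rw [hl, ← sp_last]
          exact hsp _ le_rfl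
    · rw [inr_eq_sp]
      exact hsp _ (by omega)
  rw [hall a, hall b]

/-! ### The chords and the plane scheme -/

/-- The edges of the cycle through the leaves, with their bounded faces to the left. -/
def chord (m₁ m₂ : ℕ) : Fin (m₁ + 1) ⊕ Fin (m₂ + 1) → HalinVertex m₁ m₂ × HalinVertex m₁ m₂
  | Sum.inl i => (lf m₁ m₂ (if i.val < m₁ then i.val + 1 else m₁ + m₂ + 1), lf m₁ m₂ i.val)
  | Sum.inr j => (lf m₁ m₂ (if j.val = 0 then 0 else m₁ + j.val), lf m₁ m₂ (m₁ + j.val + 1))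

theorem graph_adj_lf {p q : ℕ} (hp : p ≤ m₁ + m₂ + 1) (hq : q ≤ m₁ + m₂ + 1) :
    (halinGraph m₁ m₂).Adj (lf m₁ m₂ p) (lf m₁ m₂ q) ↔
      ((p + 1 = q ∧ p ≠ m₁) ∨ (p = m₁ ∧ q = m₁ + m₂ + 1) ∨ (p = 0 ∧ q = m₁ + 1)) ∨
      ((q + 1 = p ∧ q ≠ m₁) ∨ (q = m₁ ∧ p = m₁ + m₂ + 1) ∨ (q = 0 ∧ p = m₁ + 1)) := by
  rw [lf, lf, graph_adj_inl_inl]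
  simp only [min_eq_left hp, min_eq_left hq]

theorem chord_inl_of_lt {i : Fin (m₁ + 1)} (h : i.val < m₁) :
    chord m₁ m₂ (Sum.inl i) = (lf m₁ m₂ (i.val + 1), lf m₁ m₂ i.val) := by
  simp [chord, h]

theorem chord_inl_of_eq {i : Fin (m₁ + 1)} (h : i.val = m₁) :
    chord m₁ m₂ (Sum.inl i) = (lf m₁ m₂ (m₁ + m₂ + 1), lf m₁ m₂ m₁) := by
  simp [chord, h]

theorem chord_inr_of_eq {j : Fin (m₂ + 1)} (h : j.val = 0) :
    chord m₁ m₂ (Sum.inr j) = (lf m₁ m₂ 0, lf m₁ m₂ (m₁ + 1)) := by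
  simp [chord, h]

theorem chord_inr_of_ne {j : Fin (m₂ + 1)} (h : j.val ≠ 0) :
    chord m₁ m₂ (Sum.inr j) = (lf m₁ m₂ (m₁ + j.val), lf m₁ m₂ (m₁ + j.val + 1)) := by
  simp only [chord, h, if_false]

/-- Every property of the four kinds of chords holds for all chords. -/
theorem chord_induction {P : Fin (m₁ + 1) ⊕ Fin (m₂ + 1) →
      HalinVertex m₁ m₂ × HalinVertex m₁ m₂ → Prop}
    (h1 : ∀ (i : Fin (m₁ + 1)), i.val < m₁ → P (Sum.inl i) (lf m₁ m₂ (i.val + 1), lf m₁ m₂ i.val))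
    (h2 : ∀ (i : Fin (m₁ + 1)), i.val = m₁ →
      P (Sum.inl i) (lf m₁ m₂ (m₁ + m₂ + 1), lf m₁ m₂ m₁))
    (h3 : ∀ (j : Fin (m₂ + 1)), j.val = 0 → P (Sum.inr j) (lf m₁ m₂ 0, lf m₁ m₂ (m₁ + 1)))
    (h4 : ∀ (j : Fin (m₂ + 1)), 0 < j.val →
      P (Sum.inr j) (lf m₁ m₂ (m₁ + j.val), lf m₁ m₂ (m₁ + j.val + 1)))
    (e) : P e (chord m₁ m₂ e) := by
  rcases e with i | j
  · by_cases h : i.val < m₁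
    · rw [chord_inl_of_lt h]
      exact h1 i h
    · rw [chord_inl_of_eq (by omega)]
      exact h2 i (by omega)
  · by_cases h : j.val = 0
    · rw [chord_inr_of_eq h]
      exact h3 j h
    · rw [chord_inr_of_ne h]
      exact h4 j (Nat.pos_of_ne_zero h)

theorem exists_chord (a b : HalinVertex m₁ m₂) (h : (halinGraph m₁ m₂).Adj a b)
    (hT : ¬ (halinTree m₁ m₂).Adj a b) :
    ∃ e, (a, b) = chord m₁ m₂ e ∨ (b, a) = chord m₁ m₂ e := by
  rcases a with i | i
  swap
  · exact absurd ((graph_adj_inr_left _ _).1 h) hT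
  rcases b with j | j
  swap
  · exact absurd ((graph_adj_inr_right _ _).1 h) hT
  have key : ∀ p q, p ≤ m₁ + m₂ + 1 → q ≤ m₁ + m₂ + 1 → ((p + 1 = q ∧ p ≠ m₁) ∨
      (p = m₁ ∧ q = m₁ + m₂ + 1) ∨ (p = 0 ∧ q = m₁ + 1)) →
      ∃ e, (lf m₁ m₂ p, lf m₁ m₂ q) = chord m₁ m₂ e ∨ (lf m₁ m₂ q, lf m₁ m₂ p) = chord m₁ m₂ e := by
    rintro p q hp hq (⟨rfl, h⟩ | ⟨rfl, rfl⟩ | ⟨rfl, rfl⟩)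
    · by_cases hlt : p < m₁
      · exact ⟨Sum.inl ⟨p, by omega⟩, Or.inr (chord_inl_of_lt (i := ⟨p, by omega⟩) hlt).symm⟩
      · obtain ⟨k, rfl⟩ : ∃ k, p = m₁ + k := ⟨p - m₁, by omega⟩
        exact ⟨Sum.inr ⟨k, by omega⟩,
          Or.inl (chord_inr_of_ne (j := ⟨k, by omega⟩) (by
            change k ≠ 0
            omega)).symm⟩
    · exact ⟨Sum.inl ⟨p, by omega⟩, Or.inr (chord_inl_of_eq (i := ⟨p, by omega⟩) rfl).symm⟩
    · exact ⟨Sum.inr 0, Or.inl (chord_inr_of_eq rfl).symm⟩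
  rw [inl_eq_lf, inl_eq_lf]
  rw [graph_adj_inl_inl] at h
  rcases h with h | h
  · exact key _ _ (by omega) (by omega) h
  · obtain ⟨e, he⟩ := key _ _ (by omega) (by omega) h
    exact ⟨e, he.symm⟩

theorem chord_not_tree (e) :
    ¬ (halinTree m₁ m₂).Adj (chord m₁ m₂ e).1 (chord m₁ m₂ e).2 := by
  rcases e with i | j
  · exact tree_adj_inl_inl _ _
  · exact tree_adj_inl_inl _ _

theorem chord_adj (e) : (halinGraph m₁ m₂).Adj (chord m₁ m₂ e).1 (chord m₁ m₂ e).2 := by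
  refine chord_induction (P := fun _ c => (halinGraph m₁ m₂).Adj c.1 c.2) ?_ ?_ ?_ ?_ e
  · intro i hi
    rw [graph_adj_lf (by omega) (by omega)]
    omega
  · intro i hi
    rw [graph_adj_lf (by omega) (by omega)]
    omega
  · intro j hj
    rw [graph_adj_lf (by omega) (by omega)]
    omega
  · intro j hj
    rw [graph_adj_lf (by omega) (by omega)]
    omega

theorem top_eq_some (i : Fin (m₁ + 1)) : top m₁ m₂ i.val = some (Sum.inl i) := by
  simp only [top, Option.some.injEq, Sum.inl.injEq, Fin.ext_iff]
  omega

theorem bot_eq_some (j : Fin (m₂ + 1)) : bot m₁ m₂ (m₁ + j.val) = some (Sum.inr j) := by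
  simp only [bot, Option.some.injEq, Sum.inr.injEq, Fin.ext_iff]
  omega

theorem bot_zero : bot m₁ m₂ 0 = some (Sum.inr 0) := by
  rw [← bot_eq_some, bot_eq_bot]
  simp

theorem left_chord (hm : 1 ≤ m₁) (e) :
    left m₁ m₂ (chord m₁ m₂ e).1 (chord m₁ m₂ e).2 = some e := by
  refine chord_induction (P := fun e c => left m₁ m₂ c.1 c.2 = some e) ?_ ?_ ?_ ?_ e
  · exact fun i hi => (left_top_backward hi).trans (top_eq_some i)
  · exact fun i hi => left_last_top.trans (by rw [← top_eq_some i, hi])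
  · intro j hj
    obtain rfl : j = 0 := Fin.ext hj
    exact (left_zero_bot hm).trans bot_zero
  · exact fun j hj => (left_bot_forward (by omega) (by omega)).trans (bot_eq_some j)

theorem right_chord (hm : 1 ≤ m₁) (e) :
    left m₁ m₂ (chord m₁ m₂ e).2 (chord m₁ m₂ e).1 = none := by
  refine chord_induction (P := fun _ c => left m₁ m₂ c.2 c.1 = none) ?_ ?_ ?_ ?_ e
  · exact fun i hi => left_top_forward hi
  · exact fun i hi => left_top_last hm
  · exact fun j hj => left_bot_zero hm
  · exact fun j hj => left_bot_backward (by omega) (by omega)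

/-- The planar embedding of `H_{m₁,m₂}`. -/
def scheme (m₁ m₂ : ℕ) (hm : 1 ≤ m₁) :
    PlaneScheme (halinGraph m₁ m₂) (halinTree m₁ m₂) (Fin (m₁ + 1) ⊕ Fin (m₂ + 1)) where
  nb a := Equiv.ofBijective (fun k => ⟨nb m₁ m₂ a k, (adj_iff_exists_nb hm _ _).2 ⟨k, rfl⟩⟩)
    ⟨fun _ _ h => nb_injective hm a (congrArg Subtype.val h), fun b => by
      obtain ⟨k, hk⟩ := (adj_iff_exists_nb hm _ _).1 b.2
      exact ⟨k, Subtype.ext hk⟩⟩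
  left := left m₁ m₂
  left_next := left_nb_succ hm
  tree_le := le_sup_left
  chord := chord m₁ m₂
  chord_adj := chord_adj
  chord_not_tree := chord_not_tree
  left_chord := left_chord hm
  right_chord := right_chord hm
  exists_chord := exists_chord
  left_tree := left_tree_eq_some hm
  left_ne := left_tree_ne hm
  tree_inj := fun a b a' b' h h' => left_tree_injective hm a b h a' b' h'
  exists_potential := exists_potential
  tree_const := tree_const hm

/-! ### The dual adjacency of the scheme -/

theorem dualRel_of_left (hm : 1 ≤ m₁) (a b : HalinVertex m₁ m₂)
    (h : (halinTree m₁ m₂).Adj a b) : ∀ e e', left m₁ m₂ a b = some e → left m₁ m₂ b a = some e' →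
      halinDual m₁ m₂ e e' := by
  revert a b
  refine tree_induction ?_ ?_ ?_ ?_
  · intro p hp e e'
    rw [left_sp_sp_succ hm hp, left_sp_succ_sp hm hp, top, bot, Option.some.injEq,
      Option.some.injEq]
    rintro rfl rfl
    simp only [halinDual]
    omega
  · intro p hp e e'
    rw [left_sp_sp_succ hm hp, left_sp_succ_sp hm hp, top, bot, Option.some.injEq,
      Option.some.injEq]
    rintro rfl rfl
    simp only [halinDual]
    omega
  · intro p h1 hp e e'
    rw [left_sp_lf h1 hp, left_lf_sp h1 hp]
    split_ifs
    · rw [top, top, Option.some.injEq, Option.some.injEq]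
      rintro rfl rfl
      simp only [halinDual, pathRel]
      omega
    · rw [bot, bot, Option.some.injEq, Option.some.injEq]
      rintro rfl rfl
      simp only [halinDual, pathRel]
      omega
  · intro p h1 hp e e'
    rw [left_sp_lf h1 hp, left_lf_sp h1 hp]
    split_ifs
    · rw [top, top, Option.some.injEq, Option.some.injEq]
      rintro rfl rfl
      simp only [halinDual, pathRel]
      omega
    · rw [bot, bot, Option.some.injEq, Option.some.injEq]
      rintro rfl rfl
      simp only [halinDual, pathRel]
      omega

/-- Consecutive faces on one side share a pendant edge. Upper face `i` and lower face `j` can share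
only the spine edge at position `i + j`, and do so when the upper index has reached `m₁` or the
lower one is still 0. -/
theorem scheme_dualRel (hm : 1 ≤ m₁) : (scheme m₁ m₂ hm).dualRel = halinDual m₁ m₂ := by
  funext e e'
  apply propext
  constructor
  · rintro (rfl | ⟨a, b, h1, h2, h3⟩)
    · exact halinDual_refl e
    · exact dualRel_of_left hm a b h1 e e' h2 h3
  · have hpath₁ : ∀ i j : Fin (m₁ + 1), i.val + 1 = j.val →
        (scheme m₁ m₂ hm).dualRel (Sum.inl i) (Sum.inl j) := by
      intro i j hij
      refine Or.inr ⟨_, _, tree_adj_lf (p := j.val) (by omega) (by omega), ?_, ?_⟩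
      · refine (left_sp_lf (by omega) (by omega)).trans ?_
        rw [if_pos (by omega), ← hij, Nat.add_sub_cancel, top_eq_some]
      · refine (left_lf_sp (by omega) (by omega)).trans ?_
        rw [if_pos (by omega), top_eq_some]
    have hpath₂ : ∀ i j : Fin (m₂ + 1), i.val + 1 = j.val →
        (scheme m₁ m₂ hm).dualRel (Sum.inr i) (Sum.inr j) := by
      intro i j hij
      refine Or.inr ⟨_, _, (tree_adj_lf (p := m₁ + j.val) (by omega) (by omega)).symm, ?_, ?_⟩
      · refine (left_lf_sp (by omega) (by omega)).trans ?_
        rw [if_neg (by omega), ← hij, ← add_assoc, Nat.add_sub_cancel, bot_eq_some]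
      · refine (left_sp_lf (by omega) (by omega)).trans ?_
        rw [if_neg (by omega), bot_eq_some]
    have hcross : ∀ (i : Fin (m₁ + 1)) (j : Fin (m₂ + 1)), i.val = m₁ ∨ j.val = 0 →
        (scheme m₁ m₂ hm).dualRel (Sum.inl i) (Sum.inr j) := by
      intro i j hij
      refine Or.inr ⟨_, _, tree_adj_sp (p := i.val + j.val) hm (by omega), ?_, ?_⟩
      · refine (left_sp_sp_succ hm (by omega)).trans ?_
        rw [← top_eq_some, top_eq_top]
        omega
      · refine (left_sp_succ_sp hm (by omega)).trans ?_
        rw [← bot_eq_some, bot_eq_bot]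
        omega
    intro h
    rcases e with i | i <;> rcases e' with j | j
    · rcases h with h | h | h
      · exact Or.inl (congrArg _ (Fin.ext h))
      · exact hpath₁ i j h
      · exact PlaneScheme.dualRel_symm _ (hpath₁ j i h)
    · exact hcross i j h
    · exact PlaneScheme.dualRel_symm _ (hcross j i h)
    · rcases h with h | h | h
      · exact Or.inl (congrArg _ (Fin.ext h))
      · exact hpath₂ i j h
      · exact PlaneScheme.dualRel_symm _ (hpath₂ j i h)

theorem halinPoly_eq (hm : 1 ≤ m₁) :
    halinPoly m₁ m₂ = 2 * rankPoly (supportedSym (halinDual m₁ m₂)) := by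
  rw [halinPoly, (scheme m₁ m₂ hm).eulerGenusPoly_eq (Sum.inl 0) (by simp; omega), scheme_dualRel]

end Halin

end

/-! ### Recurrence and initial conditions -/

theorem mainTheorem5 (m₁ : ℕ) (hm₁ : 1 ≤ m₁) :
    (∀ m₂ : ℕ, 2 ≤ m₂ →
      halinPoly m₁ m₂ =
        (1 + 4 * X) * halinPoly m₁ (m₂ - 1) + 16 * X ^ 2 * halinPoly m₁ (m₂ - 2) +
          2 ^ (m₂ + 3) * X ^ 2 * lambdaPoly m₁ (m₂ - 1)) ∧
    halinPoly m₁ 0 = 2 * ringelPoly (m₁ + 2) ∧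
    halinPoly m₁ 1 = 2 * ringelPoly (m₁ + 3) := by
  refine ⟨fun m₂ hm₂ => ?_, ?_, ?_⟩
  · obtain ⟨k, rfl⟩ : ∃ k, m₂ = k + 2 := ⟨m₂ - 2, by omega⟩
    have e1 : k + 2 - 1 = k + 1 := rfl
    have e2 : k + 2 - 2 = k := rfl
    -- The factor 2 of `halinPoly_eq` is absorbed except in the last term, where it turns `2 ^ (k +
    -- 4)` into `2 ^ (m₂ + 3)`.
    rw [e1, e2, Halin.halinPoly_eq hm₁, Halin.halinPoly_eq hm₁, Halin.halinPoly_eq hm₁,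
      rankPoly_halinDual_recurrence m₁ k hm₁, lambdaPoly_eq_rankPoly]
    ring
  · rw [Halin.halinPoly_eq hm₁, ringelPoly_eq_halinDual_zero]
  · rw [Halin.halinPoly_eq hm₁, ringelPoly_eq_halinDual_one]
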